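/- Let $G=(V,E)$ be a finite simple graph. For a bijection $f:E\to\{1,2,\dots,|E|\}$ and a vertex $u$, let $\varphi_f(u)=\sum_{e\ni u} f(e)$ be the sum of the labels of the edges incident to $u$. The graph $G$ is called antimagic if there is such a bijection $f$ with $\varphi_f(u)\neq\varphi_f(v)$ for all distinct vertices $u,v$, and strongly antimagic if there is such an $f$ for which, in addition, $\varphi_f(u)<\varphi_f(v)$ for all vertices $u,v$ with $\deg(u)<\deg(v)$. A double spider is a finite tree with exactly two vertices of degree at least $3$. Theorem. Every double spider is strongly antimagic. In particular, every double spider is antimagic, as the Hartsfield–Ringel conjecture predicts for every tree other than $K_2$. -/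

import Mathlib

namespace SimpleGraph

variable {V : Type*} [Fintype V] [DecidableEq V]

/-- `f` labels the edges of `G` bijectively by `1, 2, …, |E|`.
The values of `f` outside the edge set play no role. -/
def IsEdgeLabeling (G : SimpleGraph V) [DecidableRel G.Adj] (f : Sym2 V → ℕ) : Prop :=
  Set.BijOn f G.edgeSet (Set.Icc 1 G.edgeFinset.card)

/-- The vertex sum at `u`: the sum of the labels of the edges incident to `u`. -/
def vertexSum (G : SimpleGraph V) [DecidableRel G.Adj] (f : Sym2 V → ℕ) (u : V) : ℕ :=
  ∑ e ∈ G.incidenceFinset u, f e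

/-- An antimagic labeling: a bijective edge labeling by `1, …, |E|` for which distinct vertices
have distinct vertex sums. -/
def IsAntimagicLabeling (G : SimpleGraph V) [DecidableRel G.Adj] (f : Sym2 V → ℕ) : Prop :=
  G.IsEdgeLabeling f ∧ ∀ u v : V, u ≠ v → G.vertexSum f u ≠ G.vertexSum f v

/-- A strongly antimagic labeling: an antimagic labeling for which a vertex of smaller degree
has a smaller vertex sum. -/
def IsStronglyAntimagicLabeling (G : SimpleGraph V) [DecidableRel G.Adj]
    (f : Sym2 V → ℕ) : Prop :=
  G.IsAntimagicLabeling f ∧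
    ∀ u v : V, G.degree u < G.degree v → G.vertexSum f u < G.vertexSum f v

/-- A graph is antimagic if it has an antimagic labeling. -/
def IsAntimagic (G : SimpleGraph V) [DecidableRel G.Adj] : Prop :=
  ∃ f : Sym2 V → ℕ, G.IsAntimagicLabeling f

/-- A graph is strongly antimagic if it has a strongly antimagic labeling. -/
def IsStronglyAntimagic (G : SimpleGraph V) [DecidableRel G.Adj] : Prop :=
  ∃ f : Sym2 V → ℕ, G.IsStronglyAntimagicLabeling f

/-- A double spider: a tree with exactly two vertices of degree greater than `2`. -/
def IsDoubleSpider (G : SimpleGraph V) [DecidableRel G.Adj] : Prop :=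
  G.IsTree ∧ (Finset.univ.filter fun v : V => 2 < G.degree v).card = 2

end SimpleGraph

/-! ### Label zones, relabelling, and what survives a relabelling. -/

namespace DoubleSpider

/-! The labels are split into a low zone `1, …, Y`, a middle zone up to `t` and a top zone. A
labelling is grown by insertion: old labels are shifted to free some values at the ends of the
zones, and the freed values go onto a new leg, onto the path joining the branch vertices, or onto
two edges that prolong a leg or that path. Under a shift a vertex sum grows by an amount that
depends only on the degree and on the numbers of its labels above `Y` and above `t`. Hence, if among
vertices of degree two a larger sum always comes with counts at least as large (`Sep`), no later
shift can make two sums meet or cross (`Sep.ins`). A new vertex of degree two then only needs a safe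
place: below all old sums, or between the sums of pairs with at most one label above `Y` (light) and
those with two (heavy); see `NewPair` and `Core.op`. Leaf labels stay at most `Y` and sums at degree
two exceed `Y`, so leaves lie below vertices of degree two.

It remains to control the two branch sums `fu` and `fv`. Everything relevant is recorded in a
`Summary`, which every insertion transforms by explicit formulas, so the problem becomes arithmetic
in the leg lengths (`Realizes`). The target is `Weak`: both branch sums exceed all others, and `fu <
fv`, where `v` has at least the degree of `u`. Ordinarily an even leg gives its branch vertex a
middle label and an odd leg a low one. Adding a leg at `v`, or a leg at each of `u` and `v`,
preserves suitable strengthenings of `Weak` (`Good`, `Separated`, `HasStrict`) for all parities. The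
delicate pair, an even leg at `u` with an odd leg at `v`, uses top labels, except for lengths 2 and
1, which have their own insertion `twoOne`.

Induction on the number of legs thus reduces to two legs at `u` and two or three at `v`. There an
explicit order of insertion works, or one of several does: their failures are jointly contradictory
by linear arithmetic. One family, legs `2, 2` against leaves with branch vertices adjacent, starts
from an explicit labelling.

Finally the tree is rooted at one branch vertex and each other vertex stands for the edge to its
parent. This turns the tree into lists of the required shape, onto which an abstract labelling with
the same leg lengths is copied. -/

/-- The numerical summary of a labelled double spider: the labels `1, …, m` are low up to `Y`,
middle up to `t` and top beyond. A vertex of degree two has at least `g` labels above `Y`. If it has at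
most one, then at most `c` of its labels are top and its sum is at most `ML`; if it has two, then
`x = 1` and its sum lies between `N` and `MH`. The branch vertex `u` has degree `du`, with `hu`
labels above `Y`, `zu` labels above `t` and sum `fu`; likewise for `v`. -/
structure Summary where
  Y : ℕ
  t : ℕ
  m : ℕ
  ML : ℕ
  N : ℕ
  MH : ℕ
  g : ℕ
  c : ℕ
  x : ℕ
  du : ℕ
  hu : ℕ
  zu : ℕ
  fu : ℕ
  dv : ℕ
  hv : ℕ
  zv : ℕ
  fv : ℕ

/-- The number of labels of a pair exceeding `Y`. -/
def above (Y : ℕ) (d : ℕ × ℕ) : ℕ := (if Y < d.1 then 1 else 0) + (if Y < d.2 then 1 else 0)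

/-- The size, the numbers of labels above `Y` and above `t`, and the sum of a list of labels. -/
def Stats (Y t : ℕ) (U : List ℕ) (d h z f : ℕ) : Prop :=
  U.length = d ∧ U.countP (fun x => decide (Y < x)) = h ∧
    U.countP (fun x => decide (t < x)) = z ∧ U.sum = f

/-- The relabelling that makes room for `a` labels at the bottom, `b` at the top of the low zone,
`n` at the bottom of the middle zone and `k` at the bottom of the top zone. -/
def shift (S : Summary) (a b n k : ℕ) (x : ℕ) : ℕ :=
  if x ≤ S.Y then x + a else if x ≤ S.t then x + (a + b + n) else x + (a + b + n + k)

def shiftPair (S : Summary) (a b n k : ℕ) (d : ℕ × ℕ) : ℕ × ℕ :=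
  (shift S a b n k d.1, shift S a b n k d.2)

/-- The effect of `shift` on the summary. -/
def Summary.ins (S : Summary) (a b n k : ℕ) : Summary where
  Y := S.Y + a + b
  t := S.t + a + b + n
  m := S.m + a + b + n + k
  ML := S.ML + 2 * a + b + n + S.c * k
  N := S.N + 2 * a + 2 * b + 2 * n + k
  MH := S.MH + S.x * (2 * a + 2 * b + 2 * n + k)
  g := S.g
  c := S.c
  x := S.x
  du := S.du
  hu := S.hu
  zu := S.zu
  fu := S.fu + a * S.du + (b + n) * S.hu + k * S.zu
  dv := S.dv
  hv := S.hv
  zv := S.zv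
  fv := S.fv + a * S.dv + (b + n) * S.hv + k * S.zv

/-- The conditions on a pair of labels meeting at a vertex of degree two. -/
structure GoodPair (S : Summary) (d : ℕ × ℕ) : Prop where
  g_le : S.g ≤ above S.Y d
  lt_sum : S.Y + 1 + S.g ≤ d.1 + d.2
  light : above S.Y d ≤ 1 → above S.t d ≤ S.c ∧ d.1 + d.2 ≤ S.ML
  heavy : above S.Y d = 2 → above S.t d = 1 ∧ S.x = 1 ∧ S.N ≤ d.1 + d.2 ∧ d.1 + d.2 ≤ S.MH

/-- Two pairs are separated compatibly with later relabellings. -/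
def Sep (S : Summary) (d e : ℕ × ℕ) : Prop :=
  (d.1 + d.2 = e.1 + e.2 → d = e ∨ d = e.swap) ∧
    (d.1 + d.2 < e.1 + e.2 → above S.Y d ≤ above S.Y e ∧ above S.t d ≤ above S.t e)

/-- `D` holds the pairs of labels at vertices of degree two, `L` the leaf labels, and `U` and `W`
the labels at the two branch vertices. `L` and `D` are otherwise unrelated to the shape of the tree,
so that relabelling can be studied on bare lists. -/
structure Core (D : List (ℕ × ℕ)) (L U W : List ℕ) (S : Summary) : Prop where
  Y_le : S.Y ≤ S.t
  g_le : S.g ≤ 1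
  c_le : S.c ≤ 1
  x_le : S.x ≤ 1
  Y_le_ML : S.Y ≤ S.ML
  leaf : ∀ x ∈ L, x ≤ S.Y
  pair : ∀ d ∈ D, GoodPair S d
  sep : ∀ d ∈ D, ∀ e ∈ D, Sep S d e
  statU : Stats S.Y S.t U S.du S.hu S.zu S.fu
  statW : Stats S.Y S.t W S.dv S.hv S.zv S.fv

/-- `E` is a list of the labels `1, …, m`. -/
def IsLabels (E : List ℕ) (m : ℕ) : Prop := E.Nodup ∧ (∀ x ∈ E, 1 ≤ x ∧ x ≤ m) ∧ E.length = m

theorem IsLabels.perm {E E' : List ℕ} {m : ℕ} (h : IsLabels E m) (p : E'.Perm E) :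
    IsLabels E' m :=
  ⟨p.nodup_iff.2 h.1, fun x hx => h.2.1 x (p.mem_iff.1 hx), p.length_eq.trans h.2.2⟩

theorem shift_injective (S : Summary) (a b n k : ℕ) :
    Function.Injective (shift S a b n k) := by
  intro x y h
  simp only [shift] at h
  split_ifs at h <;> omega

/-- The labels freed by `shift`. -/
def Free (S : Summary) (a b n k x : ℕ) : Prop :=
  (1 ≤ x ∧ x ≤ a) ∨ (S.Y + a < x ∧ x ≤ S.Y + a + b + n) ∨
    (S.t + a + b + n < x ∧ x ≤ S.t + a + b + n + k)

theorem IsLabels.ins {E newE : List ℕ} {S : Summary} (hS : S.Y ≤ S.t) (ht : S.t ≤ S.m)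
    (h : IsLabels E S.m) (a b n k : ℕ) (hnd : newE.Nodup) (hfree : ∀ x ∈ newE, Free S a b n k x)
    (hlen : newE.length = a + b + n + k) :
    IsLabels (newE ++ E.map (shift S a b n k)) (S.ins a b n k).m := by
  refine ⟨List.Nodup.append hnd (h.1.map (shift_injective S a b n k)) ?_, ?_, ?_⟩
  · intro x hx hx'
    obtain ⟨y, hy, rfl⟩ := List.mem_map.1 hx'
    have h1 := hfree _ hx
    have h2 := h.2.1 y hy
    simp only [shift, Free] at h1
    split_ifs at h1 <;> omega
  · intro x hx
    rcases List.mem_append.1 hx with hx | hx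
    · have h1 := hfree _ hx
      simp only [Free] at h1
      simp only [Summary.ins]
      omega
    · obtain ⟨y, hy, rfl⟩ := List.mem_map.1 hx
      have h2 := h.2.1 y hy
      simp only [shift, Summary.ins]
      split_ifs <;> omega
  · simp [Summary.ins, h.2.2, hlen]
    omega

section shift

variable (S : Summary) (a b n k : ℕ)

theorem above_shift_Y (d : ℕ × ℕ) :
    above (S.ins a b n k).Y (shiftPair S a b n k d) = above S.Y d := by
  have key : ∀ x, ((S.ins a b n k).Y < shift S a b n k x) ↔ S.Y < x := by
    intro x
    simp only [shift, Summary.ins]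
    split_ifs <;> omega
  simp only [above, shiftPair, key]

theorem above_shift_t (hS : S.Y ≤ S.t) (d : ℕ × ℕ) :
    above (S.ins a b n k).t (shiftPair S a b n k d) = above S.t d := by
  have key : ∀ x, ((S.ins a b n k).t < shift S a b n k x) ↔ S.t < x := by
    intro x
    simp only [shift, Summary.ins]
    split_ifs <;> omega
  simp only [above, shiftPair, key]

theorem shift_eq (hS : S.Y ≤ S.t) (x : ℕ) : shift S a b n k x =
    x + a + (b + n) * (if S.Y < x then 1 else 0) + k * (if S.t < x then 1 else 0) := by
  simp only [shift]
  split_ifs <;> omega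

theorem sum_shiftPair (hS : S.Y ≤ S.t) (d : ℕ × ℕ) :
    (shiftPair S a b n k d).1 + (shiftPair S a b n k d).2 =
      d.1 + d.2 + 2 * a + (b + n) * above S.Y d + k * above S.t d := by
  simp only [shiftPair, shift_eq S a b n k hS, above]
  ring

theorem above_le_two (Y : ℕ) (d : ℕ × ℕ) : above Y d ≤ 2 := by
  simp only [above]
  split_ifs <;> omega

theorem above_anti {Y t : ℕ} (h : Y ≤ t) (d : ℕ × ℕ) : above t d ≤ above Y d := by
  simp only [above]
  split_ifs <;> omega

theorem above_swap (Y : ℕ) (d : ℕ × ℕ) : above Y d.swap = above Y d := by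
  simp [above, add_comm]

variable {S}

/-- The low zone grows by `a + b`, while the sum of a pair grows by at least `2a`, and by `b` more
once it has a label above `Y`. The hypothesis `hb` therefore keeps the sum above every leaf label.
-/
theorem GoodPair.ins (hS : S.Y ≤ S.t) (hb : b ≤ a ∨ S.g = 1) {d : ℕ × ℕ}
    (h : GoodPair S d) : GoodPair (S.ins a b n k) (shiftPair S a b n k d) := by
  obtain ⟨h1, h2, h3, h4⟩ := h
  have hs := sum_shiftPair S a b n k hS d
  have ha := above_anti hS d
  have ha2 := above_le_two S.Y d
  refine ⟨?_, ?_, ?_, ?_⟩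
  · rw [above_shift_Y S a b n k]; exact h1
  · rw [hs]
    simp only [Summary.ins]
    have : b ≤ a + (b + n) * above S.Y d := by
      rcases hb with hb | hb
      · omega
      · have : 1 ≤ above S.Y d := by omega
        nlinarith
    have h5 := Nat.zero_le (k * above S.t d)
    omega
  · rw [above_shift_Y S a b n k, above_shift_t S a b n k hS, hs]
    intro h
    obtain ⟨h5, h6⟩ := h3 h
    refine ⟨h5, ?_⟩
    simp only [Summary.ins]
    have h7 : (b + n) * above S.Y d ≤ b + n := by nlinarith
    have h8 : k * above S.t d ≤ S.c * k := by nlinarith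
    omega
  · rw [above_shift_Y S a b n k, above_shift_t S a b n k hS, hs]
    intro h
    obtain ⟨h5, h6, h7, h8⟩ := h4 h
    refine ⟨h5, h6, ?_, ?_⟩ <;> simp only [Summary.ins, h, h5, h6] <;> omega

/-- A sum grows by `2a` plus a combination, with coefficients `b + n` and `k`, of its counts above
`Y` and `t`. Since `Sep` orders the counts as it orders the sums, the larger sum grows at least as
much and gaps never shrink. -/
theorem Sep.ins (hS : S.Y ≤ S.t) {d e : ℕ × ℕ} (h : Sep S d e) (h' : Sep S e d) :
    Sep (S.ins a b n k) (shiftPair S a b n k d) (shiftPair S a b n k e) := by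
  unfold Sep at *
  simp only [sum_shiftPair S a b n k hS, above_shift_Y S a b n k, above_shift_t S a b n k hS]
  rcases lt_trichotomy (d.1 + d.2) (e.1 + e.2) with hlt | heq | hgt
  · obtain ⟨h1, h2⟩ := h.2 hlt
    have h3 : (b + n) * above S.Y d ≤ (b + n) * above S.Y e := Nat.mul_le_mul_left _ h1
    have h4 : k * above S.t d ≤ k * above S.t e := Nat.mul_le_mul_left _ h2
    exact ⟨fun _ => by omega, fun _ => ⟨h1, h2⟩⟩
  · have : d = e ∨ d = e.swap := h.1 heq
    have hY : above S.Y d = above S.Y e := by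
      rcases this with rfl | rfl
      · rfl
      · exact above_swap _ _
    have ht : above S.t d = above S.t e := by
      rcases this with rfl | rfl
      · rfl
      · exact above_swap _ _
    refine ⟨fun _ => ?_, fun _ => ⟨hY.le, ht.le⟩⟩
    rcases this with rfl | rfl
    · exact Or.inl rfl
    · exact Or.inr rfl
  · obtain ⟨h1, h2⟩ := h'.2 hgt
    have h3 : (b + n) * above S.Y e ≤ (b + n) * above S.Y d := Nat.mul_le_mul_left _ h1
    have h4 : k * above S.t e ≤ k * above S.t d := Nat.mul_le_mul_left _ h2
    exact ⟨fun _ => by omega, fun _ => by omega⟩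

theorem Stats.ins (hS : S.Y ≤ S.t) {U : List ℕ} {d h z f : ℕ} (hU : Stats S.Y S.t U d h z f) :
    Stats (S.ins a b n k).Y (S.ins a b n k).t (U.map (shift S a b n k)) d h z
      (f + a * d + (b + n) * h + k * z) := by
  obtain ⟨rfl, rfl, rfl, rfl⟩ := hU
  have key1 : ∀ x, ((S.ins a b n k).Y < shift S a b n k x) ↔ S.Y < x := by
    intro x
    simp only [shift, Summary.ins]
    split_ifs <;> omega
  have key2 : ∀ x, ((S.ins a b n k).t < shift S a b n k x) ↔ S.t < x := by
    intro x
    simp only [shift, Summary.ins]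
    split_ifs <;> omega
  refine ⟨by simp, ?_, ?_, ?_⟩
  · simp only [List.countP_map, Function.comp_def, key1]
  · simp only [List.countP_map, Function.comp_def, key2]
  · induction U with
    | nil => simp
    | cons x U ih =>
      simp only [List.map_cons, List.sum_cons, ih, shift_eq S a b n k hS, List.length_cons,
        List.countP_cons, decide_eq_true_eq]
      ring

theorem Core.ins {D : List (ℕ × ℕ)} {L U W : List ℕ} (h : Core D L U W S)
    (hb : b ≤ a ∨ S.g = 1) :
    Core (D.map (shiftPair S a b n k)) (L.map (shift S a b n k)) (U.map (shift S a b n k))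
      (W.map (shift S a b n k)) (S.ins a b n k) where
  Y_le := by have := h.Y_le; simp only [Summary.ins]; omega
  g_le := h.g_le
  c_le := h.c_le
  x_le := h.x_le
  Y_le_ML := by
    have := h.Y_le_ML
    have := Nat.zero_le (S.c * k)
    simp only [Summary.ins]
    omega
  leaf := by
    intro x hx
    obtain ⟨y, hy, rfl⟩ := List.mem_map.1 hx
    have := h.leaf y hy
    simp only [shift, Summary.ins]
    split_ifs
    omega
  pair := by
    intro d hd
    obtain ⟨e, he, rfl⟩ := List.mem_map.1 hd
    exact (h.pair e he).ins a b n k h.Y_le hb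
  sep := by
    intro d hd e he
    obtain ⟨d', hd', rfl⟩ := List.mem_map.1 hd
    obtain ⟨e', he', rfl⟩ := List.mem_map.1 he
    exact (h.sep d' hd' e' he').ins a b n k h.Y_le (h.sep e' he' d' hd')
  statU := h.statU.ins a b n k h.Y_le
  statW := h.statW.ins a b n k h.Y_le

end shift

end DoubleSpider

/-! ### Adding new pairs to a relabelled structure. -/

namespace DoubleSpider

/-- The pair `d`, with `p` labels above `S'.Y` and `q` labels above `S'.t`, fits among the pairs of
a structure with summary `S` after the relabelling `shift S a b n k`. -/
structure NewPair (S : Summary) (a b n k : ℕ) (S' : Summary) (d : ℕ × ℕ) (p q : ℕ) : Prop where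
  hp : above S'.Y d = p
  hq : above S'.t d = q
  good : GoodPair S' d
  fits : ∀ s p' q', S.g ≤ p' → p' ≤ 2 → q' ≤ p' → S.Y + 1 + S.g ≤ s →
    (p' ≤ 1 → q' ≤ S.c ∧ s ≤ S.ML) → (p' = 2 → q' = 1 ∧ S.x = 1 ∧ S.N ≤ s ∧ s ≤ S.MH) →
    (d.1 + d.2 ≠ s + 2 * a + (b + n) * p' + k * q') ∧
    (d.1 + d.2 < s + 2 * a + (b + n) * p' + k * q' → p ≤ p' ∧ q ≤ q') ∧
    (s + 2 * a + (b + n) * p' + k * q' < d.1 + d.2 → p' ≤ p ∧ q' ≤ q)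

/-- Every enlargement except `forget` and the swap of branch vertices passes through here. Old pairs
are compared by `Core.ins`, new with old by `NewPair.fits`, new with new by `hnn`. The bounds of
`S'` may be looser than those of `S.ins`, which lets the new pairs into the recorded ranges. -/
theorem Core.op {D newD D' : List (ℕ × ℕ)} {L U W newL L' U' W' : List ℕ} {S S' : Summary}
    (h : Core D L U W S) (a b n k : ℕ) (hb : b ≤ a ∨ S.g = 1)
    (hY : S'.Y = (S.ins a b n k).Y) (ht : S'.t = (S.ins a b n k).t) (hg : S'.g = S.g)
    (hc : S.c ≤ S'.c) (hc1 : S'.c ≤ 1) (hx : S.x ≤ S'.x) (hx1 : S'.x ≤ 1)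
    (hML : (S.ins a b n k).ML ≤ S'.ML) (hN : S.x = 1 → S'.N ≤ (S.ins a b n k).N)
    (hMH : S.x = 1 → (S.ins a b n k).MH ≤ S'.MH)
    (hnew : ∀ d ∈ newD, ∃ p q, NewPair S a b n k S' d p q)
    (hnn : ∀ d ∈ newD, ∀ e ∈ newD, d ≠ e → Sep S' d e)
    (hnewL : ∀ x ∈ newL, x ≤ S'.Y)
    (hD : ∀ d ∈ D', d ∈ newD ∨ d ∈ D.map (shiftPair S a b n k))
    (hL : ∀ x ∈ L', x ∈ newL ∨ x ∈ L.map (shift S a b n k))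
    (hU : Stats S'.Y S'.t U' S'.du S'.hu S'.zu S'.fu)
    (hW : Stats S'.Y S'.t W' S'.dv S'.hv S'.zv S'.fv) : Core D' L' U' W' S' := by
  have h1 := h.ins a b n k hb
  have self : ∀ d, Sep S' d d := fun d => ⟨fun _ => Or.inl rfl, fun h => absurd h (lt_irrefl _)⟩
  have hold : ∀ d ∈ newD, ∀ e ∈ D, Sep S' d (shiftPair S a b n k e) ∧
      Sep S' (shiftPair S a b n k e) d := by
    intro d hd e he
    obtain ⟨p, q, hn⟩ := hnew d hd
    obtain ⟨g1, g2, g3, g4⟩ := h.pair e he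
    obtain ⟨f1, f2, f3⟩ := hn.fits _ _ _ g1 (above_le_two _ _) (above_anti h.Y_le e) g2 g3 g4
    have hs := sum_shiftPair S a b n k h.Y_le e
    have e1 := above_shift_Y S a b n k e
    have e2 := above_shift_t S a b n k h.Y_le e
    rw [← hY] at e1
    rw [← ht] at e2
    rw [← hs] at f1 f2 f3
    constructor
    · refine ⟨fun h => absurd h f1, fun h => ?_⟩
      rw [hn.hp, hn.hq, e1, e2]
      exact f2 h
    · refine ⟨fun h => absurd h.symm f1, fun h => ?_⟩
      rw [hn.hp, hn.hq, e1, e2]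
      exact f3 h
  refine ⟨?_, ?_, hc1, hx1, ?_, ?_, ?_, ?_, hU, hW⟩
  · rw [hY, ht]; exact h1.Y_le
  · rw [hg]; exact h.g_le
  · rw [hY]; exact h1.Y_le_ML.trans hML
  · intro x hx
    rcases hL x hx with hx | hx
    · exact hnewL x hx
    · rw [hY]; exact h1.leaf x hx
  · intro d hd
    rcases hD d hd with hd | hd
    · obtain ⟨p, q, hn⟩ := hnew d hd
      exact hn.good
    · obtain ⟨g1, g2, g3, g4⟩ := h1.pair d hd
      refine ⟨by rw [hg, hY]; exact g1, by rw [hg, hY]; exact g2, fun hh => ?_, fun hh => ?_⟩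
      · rw [hY] at hh
        obtain ⟨g5, g6⟩ := g3 hh
        exact ⟨by rw [ht]; exact g5.trans hc, g6.trans hML⟩
      · rw [hY] at hh
        obtain ⟨g5, g6, g7, g8⟩ := g4 hh
        have g6' : S.x = 1 := g6
        exact ⟨by rw [ht]; exact g5, by omega, (hN g6').trans g7, g8.trans (hMH g6')⟩
  · intro d hd e he
    rcases hD d hd with hd | hd <;> rcases hD e he with he | he
    · by_cases hde : d = e
      · subst hde; exact self d
      · exact hnn d hd e he hde
    · obtain ⟨e', he', rfl⟩ := List.mem_map.1 he
      exact (hold d hd e' he').1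
    · obtain ⟨d', hd', rfl⟩ := List.mem_map.1 hd
      exact (hold e he d' hd').2
    · have := h1.sep d hd e he
      unfold Sep at this ⊢
      rw [hY, ht]
      exact this

/-! ### Double spiders as lists, and their mirror images. -/

/-- The pairs of consecutive entries of a list. -/
def adj {α : Type*} (l : List α) : List (α × α) := l.zip l.tail

theorem adj_map {α β : Type*} (f : α → β) (l : List α) :
    adj (l.map f) = (adj l).map fun d => (f d.1, f d.2) := by
  simp only [adj, ← List.map_tail, List.zip_map]
  rfl

@[simp] theorem adj_cons_cons {α : Type*} (x y : α) (l : List α) :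
    adj (x :: y :: l) = (x, y) :: adj (y :: l) := rfl

@[simp] theorem adj_singleton {α : Type*} (x : α) : adj [x] = [] := rfl

@[simp] theorem adj_nil {α : Type*} : adj ([] : List α) = [] := rfl

theorem mem_adj_iff {α : Type*} {l : List α} {x y : α} :
    (x, y) ∈ adj l ↔ ∃ l₁ l₂, l = l₁ ++ x :: y :: l₂ := by
  induction l with
  | nil => simp
  | cons a l ih =>
    cases l with
    | nil =>
      simp only [adj_singleton, List.not_mem_nil, false_iff, not_exists]
      intro l₁ l₂ h
      have := congrArg List.length h
      simp at this
      omega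
    | cons b l =>
      rw [adj_cons_cons, List.mem_cons, ih]
      constructor
      · rintro (h | ⟨l₁, l₂, h⟩)
        · cases h
          exact ⟨[], l, rfl⟩
        · exact ⟨a :: l₁, l₂, by rw [h]; rfl⟩
      · rintro ⟨l₁, l₂, h⟩
        cases l₁ with
        | nil =>
          left
          simp only [List.nil_append, List.cons.injEq] at h
          rw [h.1, h.2.1]
        | cons c l₁ =>
          right
          simp only [List.cons_append, List.cons.injEq] at h
          exact ⟨l₁, l₂, h.2⟩

theorem mem_adj_reverse {α : Type*} (l : List α) (d : α × α) :
    d ∈ adj l.reverse ↔ d.swap ∈ adj l := by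
  obtain ⟨x, y⟩ := d
  rw [Prod.swap_prod_mk, mem_adj_iff, mem_adj_iff]
  constructor
  · rintro ⟨l₁, l₂, h⟩
    refine ⟨l₂.reverse, l₁.reverse, ?_⟩
    have := congrArg List.reverse h
    simpa using this
  · rintro ⟨l₁, l₂, h⟩
    refine ⟨l₂.reverse, l₁.reverse, ?_⟩
    simp [h]

/-- A double spider in list form: the legs at the two branch vertices, each listed from the leaf
to the centre, and the path joining the branch vertices. -/
structure Spider (α : Type*) where
  us : List (List α)
  vs : List (List α)
  mid : List α

namespace Spider

variable {α β : Type*}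

def map (f : α → β) (T : Spider α) : Spider β :=
  ⟨T.us.map (List.map f), T.vs.map (List.map f), T.mid.map f⟩

def edges (T : Spider α) : List α := T.mid ++ (T.us.flatten ++ T.vs.flatten)

def pairs (T : Spider α) : List (α × α) := adj T.mid ++ (T.us.flatMap adj ++ T.vs.flatMap adj)

def leaves (T : Spider α) : List α := T.us.flatMap (List.take 1) ++ T.vs.flatMap (List.take 1)

def atU (T : Spider α) : List α := T.mid.take 1 ++ T.us.flatMap fun l => l.reverse.take 1

def atV (T : Spider α) : List α := T.mid.reverse.take 1 ++ T.vs.flatMap fun l => l.reverse.take 1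

def swap (T : Spider α) : Spider α := ⟨T.vs, T.us, T.mid.reverse⟩

theorem edges_map (f : α → β) (T : Spider α) : (T.map f).edges = T.edges.map f := by
  simp [map, edges, List.map_flatten]

theorem pairs_map (f : α → β) (T : Spider α) :
    (T.map f).pairs = T.pairs.map fun d => (f d.1, f d.2) := by
  simp [map, pairs, List.map_flatMap, List.flatMap_map, adj_map]

theorem leaves_map (f : α → β) (T : Spider α) : (T.map f).leaves = T.leaves.map f := by
  simp [map, leaves, List.map_flatMap, List.flatMap_map, List.map_take]

theorem atU_map (f : α → β) (T : Spider α) : (T.map f).atU = T.atU.map f := by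
  simp [map, atU, List.map_flatMap, List.flatMap_map, List.map_take, ← List.map_reverse]

theorem atV_map (f : α → β) (T : Spider α) : (T.map f).atV = T.atV.map f := by
  simp [map, atV, List.map_flatMap, List.flatMap_map, List.map_take, ← List.map_reverse]

theorem atV_swap (T : Spider α) : T.swap.atV = T.atU := by simp [swap, atU, atV]

theorem leaves_swap (T : Spider α) : T.swap.leaves.Perm T.leaves := List.perm_append_comm

theorem edges_swap (T : Spider α) : T.swap.edges.Perm T.edges :=
  (List.reverse_perm _).append List.perm_append_comm

theorem mem_pairs_swap (T : Spider α) (d : α × α) (h : d ∈ T.swap.pairs) :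
    d ∈ T.pairs ∨ d.swap ∈ T.pairs := by
  simp only [swap, pairs, List.mem_append] at *
  rw [mem_adj_reverse] at h
  tauto

end Spider

def Summary.swap (S : Summary) : Summary :=
  { S with du := S.dv, hu := S.hv, zu := S.zv, fu := S.fv,
           dv := S.du, hv := S.hu, zv := S.zu, fv := S.fu }

/-- `T` is labelled by `1, …, m` in accordance with the summary `S`. -/
structure Valid (T : Spider ℕ) (S : Summary) : Prop where
  t_le : S.t ≤ S.m
  labels : IsLabels T.edges S.m
  core : Core T.pairs T.leaves T.atU T.atV S

theorem GoodPair.swap {S : Summary} {d : ℕ × ℕ} (h : GoodPair S d) : GoodPair S d.swap := by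
  obtain ⟨h1, h2, h3, h4⟩ := h
  refine ⟨?_, ?_, ?_, ?_⟩ <;>
    simp only [above_swap, Prod.fst_swap, Prod.snd_swap, add_comm d.2 d.1] <;> assumption

theorem Sep.swap_left {S : Summary} {d e : ℕ × ℕ} (h : Sep S d e) : Sep S d.swap e := by
  unfold Sep at *
  simp only [above_swap, Prod.fst_swap, Prod.snd_swap, add_comm d.2 d.1]
  refine ⟨fun hh => ?_, h.2⟩
  rcases h.1 hh with rfl | rfl
  · exact Or.inr rfl
  · exact Or.inl (by simp)

theorem Sep.swap_right {S : Summary} {d e : ℕ × ℕ} (h : Sep S d e) : Sep S d e.swap := by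
  unfold Sep at *
  simp only [above_swap, Prod.fst_swap, Prod.snd_swap, add_comm e.2 e.1, Prod.swap_swap]
  exact ⟨fun hh => (h.1 hh).symm, h.2⟩

/-- Exchanging the branch vertices reverses the middle path and with it the pairs along it.
`GoodPair` and `Sep` see only unordered pairs; this is why `Sep` identifies a pair with its swap. -/
theorem Valid.swap {T : Spider ℕ} {S : Summary} (h : Valid T S) : Valid T.swap S.swap where
  t_le := h.t_le
  labels := h.labels.perm T.edges_swap
  core := by
    have hc := h.core
    have hp : ∀ d ∈ T.swap.pairs, ∃ e ∈ T.pairs, e = d ∨ e = d.swap := by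
      intro d hd
      rcases T.mem_pairs_swap d hd with h | h
      · exact ⟨_, h, Or.inl rfl⟩
      · exact ⟨_, h, Or.inr rfl⟩
    refine ⟨hc.Y_le, hc.g_le, hc.c_le, hc.x_le, hc.Y_le_ML, ?_, ?_, ?_, hc.statW, ?_⟩
    · intro x hx
      exact hc.leaf x (T.leaves_swap.mem_iff.1 hx)
    · intro d hd
      obtain ⟨e, he, h1⟩ := hp d hd
      have : GoodPair S d := by
        rcases h1 with rfl | rfl
        · exact hc.pair _ he
        · exact (hc.pair _ he).swap
      obtain ⟨h1, h2, h3, h4⟩ := this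
      exact ⟨h1, h2, h3, h4⟩
    · intro d hd e he
      obtain ⟨d', hd', h1⟩ := hp d hd
      obtain ⟨e', he', h2⟩ := hp e he
      have h3 := hc.sep d' hd' e' he'
      have : Sep S d e := by
        rcases h1 with rfl | rfl <;> rcases h2 with rfl | rfl
        · exact h3
        · exact h3.swap_right
        · exact h3.swap_left
        · exact h3.swap_left.swap_right
      exact this
    · rw [T.atV_swap]
      exact hc.statU

end DoubleSpider

/-! ### Safe places for a new pair, and attaching a leg. -/

namespace DoubleSpider

section newPair

variable {S S' : Summary} {a b n k : ℕ} {d : ℕ × ℕ}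

/-- With `g = 1` every old sum is at least `Y + 2` and has a label above `Y`, so after the shift it
is at least the bound in `h`. The new pair is below all of them, and its counts are the least
possible. -/
theorem NewPair.lightLow (hg : S.g = 1) (hp : above S'.Y d = 1) (hq : above S'.t d = 0)
    (hd : GoodPair S' d) (h : d.1 + d.2 < S.Y + 2 + 2 * a + b + n) :
    NewPair S a b n k S' d 1 0 := by
  refine ⟨hp, hq, hd, fun s p' q' h1 h2 h3 h4 _ _ => ?_⟩
  have h5 : (b + n) * 1 ≤ (b + n) * p' := Nat.mul_le_mul_left _ (by omega)
  have h6 := Nat.zero_le (k * q')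
  refine ⟨by omega, fun _ => ⟨by omega, by omega⟩, fun h => by omega⟩

theorem NewPair.bottom (hp : above S'.Y d = 0) (hq : above S'.t d = 0)
    (hd : GoodPair S' d) (h : d.1 + d.2 < S.Y + 1 + S.g + 2 * a) :
    NewPair S a b n k S' d 0 0 := by
  refine ⟨hp, hq, hd, fun s p' q' h1 h2 h3 h4 _ _ => ?_⟩
  have h5 := Nat.zero_le ((b + n) * p')
  have h6 := Nat.zero_le (k * q')
  refine ⟨by omega, fun _ => ⟨by omega, by omega⟩, fun h => by omega⟩

/-- The new sum lies above all shifted light sums and below all shifted heavy ones. Its counts `(2,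
1)` dominate those of every light pair and equal those of every heavy pair. -/
theorem NewPair.heavyLow (hp : above S'.Y d = 2) (hq : above S'.t d = 1)
    (hd : GoodPair S' d) (h : S.ML + 2 * a + b + n + S.c * k < d.1 + d.2)
    (h' : S.x = 1 → d.1 + d.2 < S.N + 2 * a + 2 * b + 2 * n + k) :
    NewPair S a b n k S' d 2 1 := by
  refine ⟨hp, hq, hd, fun s p' q' h1 h2 h3 h4 h5 h6 => ?_⟩
  rcases Nat.lt_or_ge p' 2 with h7 | h7
  · obtain ⟨h8, h9⟩ := h5 (by omega)
    have h10 : (b + n) * p' ≤ (b + n) * 1 := Nat.mul_le_mul_left _ (by omega)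
    have h11 : k * q' ≤ k * S.c := Nat.mul_le_mul_left _ h8
    rw [mul_comm k S.c] at h11
    exact ⟨by omega, fun _ => by omega, fun _ => ⟨by omega, by omega⟩⟩
  · obtain rfl : p' = 2 := by omega
    obtain ⟨rfl, h9, h10, h11⟩ := h6 rfl
    have := h' h9
    exact ⟨by omega, fun _ => ⟨by omega, by omega⟩, fun _ => by omega⟩

/-- The same gap between light and heavy sums is used for a light pair: the counts `(1, 1)` are the
largest a light pair can have, and are dominated by the `(2, 1)` of a heavy one. -/
theorem NewPair.lightTop (hp : above S'.Y d = 1) (hq : above S'.t d = 1)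
    (hd : GoodPair S' d) (h : S.ML + 2 * a + b + n + S.c * k < d.1 + d.2)
    (h' : S.x = 1 → d.1 + d.2 < S.N + 2 * a + 2 * b + 2 * n + k) :
    NewPair S a b n k S' d 1 1 := by
  refine ⟨hp, hq, hd, fun s p' q' h1 h2 h3 h4 h5 h6 => ?_⟩
  rcases Nat.lt_or_ge p' 2 with h7 | h7
  · obtain ⟨h8, h9⟩ := h5 (by omega)
    have h10 : (b + n) * p' ≤ (b + n) * 1 := Nat.mul_le_mul_left _ (by omega)
    have h11 : k * q' ≤ k * S.c := Nat.mul_le_mul_left _ h8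
    rw [mul_comm k S.c] at h11
    refine ⟨by omega, fun _ => by omega, fun _ => ⟨by omega, ?_⟩⟩
    omega
  · obtain rfl : p' = 2 := by omega
    obtain ⟨rfl, h9, h10, h11⟩ := h6 rfl
    have := h' h9
    exact ⟨by omega, fun _ => ⟨by omega, by omega⟩, fun _ => by omega⟩

end newPair

theorem Valid.op {T T' : Spider ℕ} {S S' : Summary} (h : Valid T S) (a b n k : ℕ)
    (newE newL : List ℕ) (newD : List (ℕ × ℕ)) (hb : b ≤ a ∨ S.g = 1)
    (hm : S'.m = (S.ins a b n k).m)
    (hY : S'.Y = (S.ins a b n k).Y) (ht : S'.t = (S.ins a b n k).t) (hg : S'.g = S.g)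
    (hc : S.c ≤ S'.c ∧ S'.c ≤ 1) (hx : S.x ≤ S'.x ∧ S'.x ≤ 1)
    (hML : (S.ins a b n k).ML ≤ S'.ML) (hN : S.x = 1 → S'.N ≤ (S.ins a b n k).N)
    (hMH : S.x = 1 → (S.ins a b n k).MH ≤ S'.MH)
    (hE : T'.edges.Perm (newE ++ (T.map (shift S a b n k)).edges))
    (hnd : newE.Nodup) (hfree : ∀ x ∈ newE, Free S a b n k x)
    (hlen : newE.length = a + b + n + k)
    (hnew : ∀ d ∈ newD, ∃ p q, NewPair S a b n k S' d p q)
    (hnn : ∀ d ∈ newD, ∀ e ∈ newD, d ≠ e → Sep S' d e)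
    (hnewL : ∀ x ∈ newL, x ≤ S'.Y)
    (hD : ∀ d ∈ T'.pairs, d ∈ newD ∨ d ∈ (T.map (shift S a b n k)).pairs)
    (hL : ∀ x ∈ T'.leaves, x ∈ newL ∨ x ∈ (T.map (shift S a b n k)).leaves)
    (hU : Stats S'.Y S'.t T'.atU S'.du S'.hu S'.zu S'.fu)
    (hW : Stats S'.Y S'.t T'.atV S'.dv S'.hv S'.zv S'.fv) : Valid T' S' where
  t_le := by
    have h1 := h.t_le
    rw [ht, hm]
    simp only [Summary.ins]
    omega
  labels := by
    rw [hm]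
    rw [Spider.edges_map] at hE
    exact (h.labels.ins h.core.Y_le h.t_le a b n k hnd hfree hlen).perm hE
  core := by
    rw [Spider.pairs_map] at hD
    rw [Spider.leaves_map] at hL
    exact h.core.op a b n k hb hY ht hg hc.1 hc.2 hx.1 hx.2 hML hN hMH hnew hnn hnewL hD hL hU hW

theorem Stats.cons {Y t : ℕ} {U : List ℕ} {d h z f : ℕ} (hU : Stats Y t U d h z f) (x : ℕ) :
    Stats Y t (x :: U) (d + 1) (h + if Y < x then 1 else 0) (z + if t < x then 1 else 0)
      (f + x) := by
  obtain ⟨rfl, rfl, rfl, rfl⟩ := hU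
  refine ⟨rfl, ?_, ?_, ?_⟩
  · simp [List.countP_cons]
  · simp [List.countP_cons]
  · simp [add_comm]

theorem Stats.perm {Y t : ℕ} {U U' : List ℕ} {d h z f : ℕ} (hU : Stats Y t U d h z f)
    (p : U'.Perm U) : Stats Y t U' d h z f := by
  obtain ⟨rfl, rfl, rfl, rfl⟩ := hU
  exact ⟨p.length_eq, p.countP_eq _, p.countP_eq _, p.sum_eq⟩

theorem Valid.statU_map {T : Spider ℕ} {S : Summary} (h : Valid T S) (a b n k : ℕ) :
    Stats (S.ins a b n k).Y (S.ins a b n k).t (T.map (shift S a b n k)).atU S.du S.hu S.zu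
      (S.ins a b n k).fu := by
  rw [Spider.atU_map]
  exact h.core.statU.ins a b n k h.core.Y_le

theorem Valid.statV_map {T : Spider ℕ} {S : Summary} (h : Valid T S) (a b n k : ℕ) :
    Stats (S.ins a b n k).Y (S.ins a b n k).t (T.map (shift S a b n k)).atV S.dv S.hv S.zv
      (S.ins a b n k).fv := by
  rw [Spider.atV_map]
  exact h.core.statW.ins a b n k h.core.Y_le

/-- Attach a new leg at `u`. -/
theorem Valid.newLeg {T : Spider ℕ} {S S' : Summary} (h : Valid T S) (a b n k : ℕ)
    (l : List ℕ) (y w : ℕ) (hl : l.take 1 = [y]) (hl' : l.reverse.take 1 = [w])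
    (hb : b ≤ a ∨ S.g = 1) (hm : S'.m = (S.ins a b n k).m)
    (hY : S'.Y = (S.ins a b n k).Y) (ht : S'.t = (S.ins a b n k).t) (hg : S'.g = S.g)
    (hc : S.c ≤ S'.c ∧ S'.c ≤ 1) (hx : S.x ≤ S'.x ∧ S'.x ≤ 1)
    (hML : (S.ins a b n k).ML ≤ S'.ML) (hN : S.x = 1 → S'.N ≤ (S.ins a b n k).N)
    (hMH : S.x = 1 → (S.ins a b n k).MH ≤ S'.MH)
    (hnd : l.Nodup) (hfree : ∀ x ∈ l, Free S a b n k x) (hlen : l.length = a + b + n + k)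
    (hnew : ∀ d ∈ adj l, ∃ p q, NewPair S a b n k S' d p q)
    (hnn : ∀ d ∈ adj l, ∀ e ∈ adj l, d ≠ e → Sep S' d e)
    (hy : y ≤ S'.Y)
    (hdu : S'.du = S.du + 1) (hhu : S'.hu = S.hu + if S'.Y < w then 1 else 0)
    (hzu : S'.zu = S.zu + if S'.t < w then 1 else 0) (hfu : S'.fu = (S.ins a b n k).fu + w)
    (hdv : S'.dv = S.dv) (hhv : S'.hv = S.hv)
    (hzv : S'.zv = S.zv) (hfv : S'.fv = (S.ins a b n k).fv) :
    Valid ⟨l :: T.us.map (List.map (shift S a b n k)), T.vs.map (List.map (shift S a b n k)),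
      T.mid.map (shift S a b n k)⟩ S' := by
  refine h.op a b n k l [y] (adj l) hb hm hY ht hg hc hx hML hN hMH ?_ hnd hfree hlen hnew hnn
    (by simpa using hy) ?_ ?_ ?_ ?_
  · simp only [Spider.edges, Spider.map, List.flatten_cons]
    rw [List.append_assoc]
    exact List.perm_append_comm_assoc _ _ _
  · intro d hd
    simp only [Spider.pairs, Spider.map, List.flatMap_cons, List.mem_append] at *
    tauto
  · intro x hx
    simp only [Spider.leaves, Spider.map, List.flatMap_cons, List.mem_append, hl] at *
    tauto
  · rw [hdu, hhu, hzu, hfu, hY, ht]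
    refine Stats.perm ((h.statU_map a b n k).cons w) ?_
    simp only [Spider.atU, Spider.map, List.flatMap_cons, hl']
    exact List.perm_middle
  · rw [hdv, hhv, hzv, hfv, hY, ht]
    exact h.statV_map a b n k

end DoubleSpider

/-! ### New legs with one to four edges. -/

namespace DoubleSpider

def Summary.leg1 (S : Summary) : Summary :=
  { S.ins 1 0 0 0 with du := S.du + 1, fu := (S.ins 1 0 0 0).fu + 1 }

def Summary.leg2 (S : Summary) : Summary :=
  { S.ins 1 0 1 0 with
    du := S.du + 1, hu := S.hu + 1, fu := (S.ins 1 0 1 0).fu + (S.Y + 2) }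

def Summary.topLeaf (S : Summary) : Summary :=
  { S.ins 0 1 0 0 with du := S.du + 1, fu := (S.ins 0 1 0 0).fu + (S.Y + 1) }

/-- The leg is `1, Y + 2, t + 3` from leaf to centre. Its upper pair is heavy with sum `Y + t + 5`,
the new least heavy sum, and `u` receives a top label. -/
def Summary.leg3top (S : Summary) : Summary :=
  { S.ins 1 0 1 1 with
    x := 1, N := S.Y + S.t + 5, MH := max ((S.ins 1 0 1 1).MH) (S.Y + S.t + 5)
    du := S.du + 1, hu := S.hu + 1, zu := S.zu + 1, fu := (S.ins 1 0 1 1).fu + (S.t + 3) }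

/-- The leg is `1, Y + 3, t + 4, Y + 2` from leaf to centre. The middle pair is heavy with sum `Y +
t + 7`. The last pair is light with sum `Y + t + 6` and contains a top label, hence `c := 1`; the
branch vertex itself receives only a low label. -/
def Summary.leg4top (S : Summary) : Summary :=
  { S.ins 1 1 1 1 with
    c := 1, ML := S.Y + S.t + 6,
    x := 1, N := S.Y + S.t + 7, MH := max ((S.ins 1 1 1 1).MH) (S.Y + S.t + 7)
    du := S.du + 1, fu := (S.ins 1 1 1 1).fu + (S.Y + 2) }

theorem above_eq_two {Y x y : ℕ} (hx : Y < x) (hy : Y < y) : above Y (x, y) = 2 := by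
  simp [above, hx, hy]

theorem above_eq_one {Y x y : ℕ} (hx : x ≤ Y) (hy : Y < y) : above Y (x, y) = 1 := by
  simp [above, hx.not_gt, hy]

theorem above_eq_one' {Y x y : ℕ} (hx : Y < x) (hy : y ≤ Y) : above Y (x, y) = 1 := by
  simp [above, hx, hy.not_gt]

theorem above_eq_zero {Y x y : ℕ} (hx : x ≤ Y) (hy : y ≤ Y) : above Y (x, y) = 0 := by
  simp [above, hx.not_gt, hy.not_gt]

variable {T : Spider ℕ} {S : Summary}

theorem Valid.leg1 (h : Valid T S) :
    Valid ⟨[1] :: T.us.map (List.map (shift S 1 0 0 0)), T.vs.map (List.map (shift S 1 0 0 0)),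
      T.mid.map (shift S 1 0 0 0)⟩ S.leg1 := by
  have h1 := h.core.Y_le
  have h2 := h.core.c_le
  have h3 := h.core.x_le
  refine h.newLeg 1 0 0 0 [1] 1 1 rfl rfl (Or.inl (by omega)) rfl rfl rfl rfl ⟨le_rfl, h2⟩
    ⟨le_rfl, h3⟩ le_rfl (fun _ => le_rfl) (fun _ => le_rfl) (by simp) (by simp [Free]) rfl
    (by simp) (by simp) ?_ rfl ?_ ?_ rfl rfl rfl rfl rfl <;>
  simp [Summary.leg1, Summary.ins]

theorem Valid.topLeaf (h : Valid T S) (hg : S.g = 1) :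
    Valid ⟨[S.Y + 1] :: T.us.map (List.map (shift S 0 1 0 0)),
      T.vs.map (List.map (shift S 0 1 0 0)), T.mid.map (shift S 0 1 0 0)⟩ S.topLeaf := by
  have h1 := h.core.Y_le
  have h2 := h.core.c_le
  have h3 := h.core.x_le
  refine h.newLeg 0 1 0 0 [S.Y + 1] (S.Y + 1) (S.Y + 1) rfl rfl (Or.inr hg) rfl rfl rfl rfl
    ⟨le_rfl, h2⟩ ⟨le_rfl, h3⟩ le_rfl (fun _ => le_rfl) (fun _ => le_rfl) (by simp) (by simp [Free])
    rfl (by simp) (by simp) ?_ rfl ?_ ?_ rfl rfl rfl rfl rfl <;>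
  simp [Summary.topLeaf, Summary.ins]
  omega

theorem Valid.leg2 (h : Valid T S) (hg : S.g = 1) :
    Valid ⟨[1, S.Y + 2] :: T.us.map (List.map (shift S 1 0 1 0)),
      T.vs.map (List.map (shift S 1 0 1 0)), T.mid.map (shift S 1 0 1 0)⟩ S.leg2 := by
  have h1 := h.core.Y_le
  have h2 := h.core.c_le
  have h3 := h.core.x_le
  have h4 := h.core.Y_le_ML
  refine h.newLeg 1 0 1 0 [1, S.Y + 2] 1 (S.Y + 2) rfl rfl (Or.inl (by omega)) rfl rfl rfl rfl
    ⟨le_rfl, h2⟩ ⟨le_rfl, h3⟩ le_rfl (fun _ => le_rfl) (fun _ => le_rfl) (by simp) ?_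
    rfl ?_ (by simp) ?_ rfl ?_ ?_ rfl rfl rfl rfl rfl
  · simp [Free]
  · intro d hd
    simp only [adj_cons_cons, adj_singleton, List.mem_singleton] at hd
    subst hd
    have e5 : above S.leg2.Y (1, S.Y + 2) = 1 := by
      apply above_eq_one <;> simp [Summary.leg2, Summary.ins]
    have e6 : above S.leg2.t (1, S.Y + 2) = 0 := by
      apply above_eq_zero <;> simp [Summary.leg2, Summary.ins]
      omega
    refine ⟨1, 0, NewPair.lightLow hg e5 e6 ⟨?_, ?_, fun _ => ⟨?_, ?_⟩, ?_⟩ ?_⟩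
    · rw [e5]; simp [Summary.leg2, Summary.ins]; omega
    · simp [Summary.leg2, Summary.ins]; omega
    · rw [e6]; omega
    · simp [Summary.leg2, Summary.ins]; omega
    · omega
    · simp; omega
  · simp [Summary.leg2, Summary.ins]
  · simp [Summary.leg2, Summary.ins]
  · simp [Summary.leg2, Summary.ins]
    omega

/-- The shift takes the bounds `ML` and `N` to `ML + 3 + c` and `N + 5`; the two hypotheses place
the new heavy sum `Y + t + 5` strictly between them. -/
theorem Valid.leg3top (h : Valid T S) (hg : S.g = 1) (hML : S.ML + S.c < S.Y + S.t + 2)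
    (hN : S.x = 1 → S.Y + S.t < S.N) :
    Valid ⟨[1, S.Y + 2, S.t + 3] :: T.us.map (List.map (shift S 1 0 1 1)),
      T.vs.map (List.map (shift S 1 0 1 1)), T.mid.map (shift S 1 0 1 1)⟩ S.leg3top := by
  have h1 := h.core.Y_le
  have h2 := h.core.c_le
  have h3 := h.core.x_le
  have h4 := h.core.Y_le_ML
  have e1 : above S.leg3top.Y (S.Y + 2, S.t + 3) = 2 := by
    apply above_eq_two <;> simp [Summary.leg3top, Summary.ins]
    omega
  have e2 : above S.leg3top.t (S.Y + 2, S.t + 3) = 1 := by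
    apply above_eq_one <;> simp [Summary.leg3top, Summary.ins]
    omega
  have e5 : above S.leg3top.Y (1, S.Y + 2) = 1 := by
    apply above_eq_one <;> simp [Summary.leg3top, Summary.ins]
  have e6 : above S.leg3top.t (1, S.Y + 2) = 0 := by
    apply above_eq_zero <;> simp [Summary.leg3top, Summary.ins]
    omega
  refine h.newLeg 1 0 1 1 [1, S.Y + 2, S.t + 3] 1 (S.t + 3) rfl rfl (Or.inl (by omega)) rfl rfl rfl
    rfl ⟨le_rfl, h2⟩ ⟨h3, le_rfl⟩ le_rfl ?_ (fun _ => le_max_left _ _) ?_ ?_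
    rfl ?_ ?_ ?_ rfl ?_ ?_ rfl rfl rfl rfl rfl
  · intro h5
    have := hN h5
    simp [Summary.leg3top, Summary.ins]
    omega
  · simp
    omega
  · simp [Free]
  · intro d hd
    simp only [adj_cons_cons, adj_singleton, List.mem_cons, List.not_mem_nil, or_false] at hd
    rcases hd with rfl | rfl
    · refine ⟨1, 0, NewPair.lightLow hg e5 e6 ⟨?_, ?_, fun _ => ⟨?_, ?_⟩, ?_⟩ ?_⟩
      · rw [e5]; simp [Summary.leg3top, Summary.ins]; omega
      · simp [Summary.leg3top, Summary.ins]; omega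
      · rw [e6]; omega
      · simp [Summary.leg3top, Summary.ins]; omega
      · omega
      · simp; omega
    · refine ⟨2, 1, NewPair.heavyLow e1 e2 ⟨?_, ?_, ?_, fun _ => ⟨e2, rfl, ?_, ?_⟩⟩ ?_ ?_⟩
      · rw [e1]; simp [Summary.leg3top, Summary.ins]; omega
      · simp [Summary.leg3top, Summary.ins]; omega
      · omega
      · simp [Summary.leg3top]; omega
      · simp [Summary.leg3top]; omega
      · simp; omega
      · intro h5
        have := hN h5
        simp; omega
  · intro d hd e he hne
    simp only [adj_cons_cons, adj_singleton, List.mem_cons, List.not_mem_nil, or_false] at hd he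
    rcases hd with rfl | rfl <;> rcases he with rfl | rfl
    · exact absurd rfl hne
    · unfold Sep
      simp only [e1, e2, e5, e6]
      exact ⟨fun _ => by omega, fun _ => by omega⟩
    · unfold Sep
      simp only [e1, e2, e5, e6]
      exact ⟨fun _ => by omega, fun _ => by omega⟩
    · exact absurd rfl hne
  · simp [Summary.leg3top, Summary.ins]
  · simp [Summary.leg3top, Summary.ins]; omega
  · simp [Summary.leg3top, Summary.ins]

/-- The shift takes `ML` and `N` to `ML + 4 + c` and `N + 7`. Since `c ≤ 1`, both new sums `Y + t +
6` and `Y + t + 7` fit strictly between, the light one below the heavy one. -/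
theorem Valid.leg4top (h : Valid T S) (hg : S.g = 1) (hML : S.ML ≤ S.Y + S.t)
    (hN : S.x = 1 → S.Y + S.t < S.N) :
    Valid ⟨[1, S.Y + 3, S.t + 4, S.Y + 2] :: T.us.map (List.map (shift S 1 1 1 1)),
      T.vs.map (List.map (shift S 1 1 1 1)), T.mid.map (shift S 1 1 1 1)⟩ S.leg4top := by
  have h1 := h.core.Y_le
  have h2 := h.core.c_le
  have h3 := h.core.x_le
  have h4 := h.core.Y_le_ML
  have e1 : above S.leg4top.Y (S.Y + 3, S.t + 4) = 2 := by
    apply above_eq_two <;> simp [Summary.leg4top, Summary.ins]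
    omega
  have e2 : above S.leg4top.t (S.Y + 3, S.t + 4) = 1 := by
    apply above_eq_one <;> simp [Summary.leg4top, Summary.ins]
    omega
  have e3 : above S.leg4top.Y (S.t + 4, S.Y + 2) = 1 := by
    apply above_eq_one' <;> simp [Summary.leg4top, Summary.ins]
    omega
  have e4 : above S.leg4top.t (S.t + 4, S.Y + 2) = 1 := by
    apply above_eq_one' <;> simp [Summary.leg4top, Summary.ins]
    omega
  have e5 : above S.leg4top.Y (1, S.Y + 3) = 1 := by
    apply above_eq_one <;> simp [Summary.leg4top, Summary.ins]
  have e6 : above S.leg4top.t (1, S.Y + 3) = 0 := by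
    apply above_eq_zero <;> simp [Summary.leg4top, Summary.ins]
    omega
  refine h.newLeg 1 1 1 1 [1, S.Y + 3, S.t + 4, S.Y + 2] 1 (S.Y + 2) rfl rfl (Or.inl (by omega)) rfl
    rfl rfl rfl ⟨h2, le_rfl⟩ ⟨h3, le_rfl⟩ ?_ ?_ (fun _ => le_max_left _ _) ?_ ?_
    rfl ?_ ?_ ?_ rfl ?_ ?_ rfl rfl rfl rfl rfl
  · simp [Summary.leg4top, Summary.ins]
    omega
  · intro h5
    have := hN h5
    simp [Summary.leg4top, Summary.ins]
    omega
  · simp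
    omega
  · simp [Free]
  · intro d hd
    simp only [adj_cons_cons, adj_singleton, List.mem_cons, List.not_mem_nil, or_false] at hd
    rcases hd with rfl | rfl | rfl
    · refine ⟨1, 0, NewPair.lightLow hg e5 e6 ⟨?_, ?_, fun _ => ⟨?_, ?_⟩, ?_⟩ ?_⟩
      · rw [e5]; simp [Summary.leg4top, Summary.ins]; omega
      · simp [Summary.leg4top, Summary.ins]; omega
      · rw [e6]; omega
      · simp [Summary.leg4top]; omega
      · omega
      · simp; omega
    · refine ⟨2, 1, NewPair.heavyLow e1 e2 ⟨?_, ?_, ?_, fun _ => ⟨e2, rfl, ?_, ?_⟩⟩ ?_ ?_⟩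
      · rw [e1]; simp [Summary.leg4top, Summary.ins]; omega
      · simp [Summary.leg4top, Summary.ins]; omega
      · omega
      · simp [Summary.leg4top]; omega
      · simp [Summary.leg4top]; omega
      · simp; omega
      · intro h5
        have := hN h5
        simp; omega
    · refine ⟨1, 1, NewPair.lightTop e3 e4 ⟨?_, ?_, fun _ => ⟨?_, ?_⟩, ?_⟩ ?_ ?_⟩
      · rw [e3]; simp [Summary.leg4top, Summary.ins]; omega
      · simp [Summary.leg4top, Summary.ins]; omega
      · rw [e4]; simp [Summary.leg4top]
      · simp [Summary.leg4top]; omega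
      · omega
      · simp; omega
      · intro h5
        have := hN h5
        simp; omega
  · intro d hd e he hne
    simp only [adj_cons_cons, adj_singleton, List.mem_cons, List.not_mem_nil, or_false] at hd he
    unfold Sep
    rcases hd with rfl | rfl | rfl <;> rcases he with rfl | rfl | rfl <;>
      first
      | exact absurd rfl hne
      | (simp only [e1, e2, e3, e4, e5, e6]
         exact ⟨fun _ => by omega, fun _ => by omega⟩)
  · simp [Summary.leg4top, Summary.ins]
  · simp [Summary.leg4top, Summary.ins]
  · simp [Summary.leg4top, Summary.ins]; omega

end DoubleSpider

/-! ### Prolonging a leg or the middle path by two edges. -/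

namespace DoubleSpider

variable {T : Spider ℕ} {S : Summary}

theorem take_reverse_cons {α : Type*} (x y : α) (l : List α) :
    (x :: y :: l).reverse.take 1 = (y :: l).reverse.take 1 := by
  rw [List.reverse_cons, List.take_append_of_le_length]
  simp

theorem Stats.replace {Y t x y : ℕ} {U : List ℕ} {d h z f : ℕ} (hU : Stats Y t (x :: U) d h z f)
    (h1 : Y < x ↔ Y < y) (h2 : t < x ↔ t < y) : Stats Y t (y :: U) d h z (f + y - x) := by
  obtain ⟨rfl, rfl, rfl, rfl⟩ := hU
  refine ⟨rfl, ?_, ?_, ?_⟩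
  · simp [List.countP_cons, h1]
  · simp [List.countP_cons, h2]
  · simp
    omega

/-- Prolong a leg at `u` beyond its leaf, whose label is `1`. -/
theorem Valid.extLeg {us vs : List (List ℕ)} {mid l : List ℕ}
    (h : Valid ⟨(1 :: l) :: us, vs, mid⟩ S)
    (hg : S.g = 1) (hML : S.Y + 1 ≤ S.ML) :
    Valid ⟨(1 :: (S.Y + 2) :: (1 :: l).map (shift S 1 0 1 0)) ::
        us.map (List.map (shift S 1 0 1 0)),
      vs.map (List.map (shift S 1 0 1 0)), mid.map (shift S 1 0 1 0)⟩ (S.ins 1 0 1 0) := by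
  have h1 := h.core.Y_le
  have h2 := h.core.c_le
  have h3 := h.core.x_le
  have h4 : 1 ≤ S.Y := h.core.leaf 1 (by simp [Spider.leaves])
  have h5 : shift S 1 0 1 0 1 = 2 := by simp [shift, h4]
  have e1 : above (S.ins 1 0 1 0).Y (1, S.Y + 2) = 1 := by
    apply above_eq_one <;> simp [Summary.ins]
  have e2 : above (S.ins 1 0 1 0).t (1, S.Y + 2) = 0 := by
    apply above_eq_zero <;> simp [Summary.ins]; omega
  have e3 : above (S.ins 1 0 1 0).Y (S.Y + 2, 2) = 1 := by
    apply above_eq_one' <;> simp [Summary.ins]; omega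
  have e4 : above (S.ins 1 0 1 0).t (S.Y + 2, 2) = 0 := by
    apply above_eq_zero <;> simp [Summary.ins]
    omega
  -- The former leaf label `1` has become `2`. The new sums are `Y + 3` and `Y + 4`, whereas every
  -- old sum is now at least `Y + 5`.
  refine h.op 1 0 1 0 [1, S.Y + 2] [1] [(1, S.Y + 2), (S.Y + 2, 2)] (Or.inl (by omega)) rfl rfl rfl
    rfl ⟨le_rfl, h2⟩ ⟨le_rfl, h3⟩ le_rfl (fun _ => le_rfl) (fun _ => le_rfl) ?_ (by simp) ?_ rfl ?_
    ?_ ?_ ?_ ?_ ?_ ?_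
  · simp only [Spider.edges, Spider.map, List.map_cons, List.flatten_cons, List.cons_append,
      List.nil_append]
    exact (List.perm_middle (l₁ := mid.map (shift S 1 0 1 0))).trans
      (List.perm_middle.cons 1)
  · simp [Free]
  · intro d hd
    simp only [List.mem_cons, List.not_mem_nil, or_false] at hd
    rcases hd with rfl | rfl
    · refine ⟨1, 0, NewPair.lightLow hg e1 e2 ⟨?_, ?_, fun _ => ⟨?_, ?_⟩, ?_⟩ ?_⟩
      · rw [e1]; simp [Summary.ins]; omega
      · simp [Summary.ins]; omega
      · rw [e2]; omega
      · simp [Summary.ins]; omega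
      · omega
      · dsimp only; omega
    · refine ⟨1, 0, NewPair.lightLow hg e3 e4 ⟨?_, ?_, fun _ => ⟨?_, ?_⟩, ?_⟩ ?_⟩
      · rw [e3]; simp [Summary.ins]; omega
      · simp [Summary.ins]; omega
      · rw [e4]; omega
      · simp [Summary.ins]; omega
      · omega
      · dsimp only; omega
  · intro d hd e he hne
    simp only [List.mem_cons, List.not_mem_nil, or_false] at hd he
    rcases hd with rfl | rfl <;> rcases he with rfl | rfl
    · exact absurd rfl hne
    · unfold Sep
      simp only [e1, e2, e3, e4]
      exact ⟨fun _ => by omega, fun _ => by omega⟩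
    · unfold Sep
      simp only [e1, e2, e3, e4]
      exact ⟨fun _ => by omega, fun _ => by omega⟩
    · exact absurd rfl hne
  · simp [Summary.ins]
  · intro d hd
    simp only [Spider.pairs, Spider.map, List.map_cons, List.flatMap_cons, List.mem_append,
      adj_cons_cons, List.mem_cons, h5] at *
    tauto
  · intro x hx
    simp [Spider.leaves, Spider.map] at hx ⊢
    exact hx.imp_right Or.inr
  · have := h.statU_map 1 0 1 0
    simp only [Spider.atU, Spider.map, List.map_cons, List.flatMap_cons, take_reverse_cons]
      at this ⊢
    exact this
  · exact h.statV_map 1 0 1 0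

/-- Prolong the middle path at `u`, where its last label is the least middle label. -/
theorem Valid.extMidHigh {us vs : List (List ℕ)} {l : List ℕ}
    (h : Valid ⟨us, vs, (S.Y + 1) :: l⟩ S) (hg : S.g = 1) (hML : S.Y + 1 ≤ S.ML)
    (ht : S.Y + 1 ≤ S.t) :
    Valid ⟨us.map (List.map (shift S 1 0 1 0)), vs.map (List.map (shift S 1 0 1 0)),
      (S.Y + 2) :: 1 :: ((S.Y + 1) :: l).map (shift S 1 0 1 0)⟩
      { S.ins 1 0 1 0 with fu := (S.ins 1 0 1 0).fu - 1 } := by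
  have h1 := h.core.Y_le
  have h2 := h.core.c_le
  have h3 := h.core.x_le
  have h5 : shift S 1 0 1 0 (S.Y + 1) = S.Y + 3 := by simp [shift, ht]
  have e1 : above (S.ins 1 0 1 0).Y (S.Y + 2, 1) = 1 := by
    apply above_eq_one' <;> simp [Summary.ins]
  have e2 : above (S.ins 1 0 1 0).t (S.Y + 2, 1) = 0 := by
    apply above_eq_zero <;> simp [Summary.ins]; omega
  have e3 : above (S.ins 1 0 1 0).Y (1, S.Y + 3) = 1 := by
    apply above_eq_one <;> simp [Summary.ins]
  have e4 : above (S.ins 1 0 1 0).t (1, S.Y + 3) = 0 := by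
    apply above_eq_zero <;> simp [Summary.ins]; omega
  refine h.op 1 0 1 0 [S.Y + 2, 1] [] [(S.Y + 2, 1), (1, S.Y + 3)] (Or.inl (by omega)) rfl rfl rfl
    rfl ⟨le_rfl, h2⟩ ⟨le_rfl, h3⟩ le_rfl (fun _ => le_rfl) (fun _ => le_rfl) ?_ (by simp) ?_ rfl ?_
    ?_ ?_ ?_ ?_ ?_ ?_
  · simp [Spider.edges, Spider.map]
  · simp [Free]
  · intro d hd
    simp only [List.mem_cons, List.not_mem_nil, or_false] at hd
    rcases hd with rfl | rfl
    · refine ⟨1, 0, NewPair.lightLow hg e1 e2 ⟨?_, ?_, fun _ => ⟨?_, ?_⟩, ?_⟩ ?_⟩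
      · dsimp only; rw [e1]; simp [Summary.ins]; omega
      · simp [Summary.ins]; omega
      · dsimp only; rw [e2]; omega
      · simp [Summary.ins]; omega
      · dsimp only; omega
      · dsimp only; omega
    · refine ⟨1, 0, NewPair.lightLow hg e3 e4 ⟨?_, ?_, fun _ => ⟨?_, ?_⟩, ?_⟩ ?_⟩
      · dsimp only; rw [e3]; simp [Summary.ins]; omega
      · simp [Summary.ins]; omega
      · dsimp only; rw [e4]; omega
      · simp [Summary.ins]; omega
      · dsimp only; omega
      · dsimp only; omega
  · intro d hd e he hne
    simp only [List.mem_cons, List.not_mem_nil, or_false] at hd he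
    rcases hd with rfl | rfl <;> rcases he with rfl | rfl
    · exact absurd rfl hne
    · unfold Sep
      simp only [e1, e2, e3, e4]
      exact ⟨fun _ => by omega, fun _ => by omega⟩
    · unfold Sep
      simp only [e1, e2, e3, e4]
      exact ⟨fun _ => by omega, fun _ => by omega⟩
    · exact absurd rfl hne
  · simp
  · intro d hd
    simp only [Spider.pairs, Spider.map, List.map_cons, List.mem_append,
      adj_cons_cons, List.mem_cons, h5] at *
    tauto
  · exact fun x hx => Or.inr hx
  · have := h.statU_map 1 0 1 0
    simp only [Spider.atU, Spider.map, List.map_cons, h5, List.take_succ_cons, List.take_zero,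
      List.cons_append, List.nil_append] at this ⊢
    -- Only the label at `u` differs from the relabelled spider: `Y + 3` gives way to `Y + 2`, which
    -- costs `u` one unit.
    have h6 := this.replace (y := S.Y + 2) (by simp [Summary.ins]) (by simp [Summary.ins]; omega)
    have h7 : (S.ins 1 0 1 0).fu + (S.Y + 2) - (S.Y + 3) = (S.ins 1 0 1 0).fu - 1 := by omega
    rw [h7] at h6
    exact h6
  · have := h.statV_map 1 0 1 0
    simp only [Spider.atV, Spider.map, List.map_cons, take_reverse_cons] at this ⊢
    exact this

/-- Prolong the middle path at `u`, where its last label is `1`. -/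
theorem Valid.extMidLow {us vs : List (List ℕ)} {l : List ℕ}
    (h : Valid ⟨us, vs, 1 :: l⟩ S) (hg : S.g = 1) (hML : S.Y + 1 ≤ S.ML) (hY : 1 ≤ S.Y) :
    Valid ⟨us.map (List.map (shift S 1 0 1 0)), vs.map (List.map (shift S 1 0 1 0)),
      1 :: (S.Y + 2) :: (1 :: l).map (shift S 1 0 1 0)⟩
      { S.ins 1 0 1 0 with fu := (S.ins 1 0 1 0).fu - 1 } := by
  have h1 := h.core.Y_le
  have h2 := h.core.c_le
  have h3 := h.core.x_le
  have h5 : shift S 1 0 1 0 1 = 2 := by simp [shift, hY]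
  have e1 : above (S.ins 1 0 1 0).Y (1, S.Y + 2) = 1 := by
    apply above_eq_one <;> simp [Summary.ins]
  have e2 : above (S.ins 1 0 1 0).t (1, S.Y + 2) = 0 := by
    apply above_eq_zero <;> simp [Summary.ins]; omega
  have e3 : above (S.ins 1 0 1 0).Y (S.Y + 2, 2) = 1 := by
    apply above_eq_one' <;> simp [Summary.ins]; omega
  have e4 : above (S.ins 1 0 1 0).t (S.Y + 2, 2) = 0 := by
    apply above_eq_zero <;> simp [Summary.ins]
    omega
  refine h.op 1 0 1 0 [1, S.Y + 2] [] [(1, S.Y + 2), (S.Y + 2, 2)] (Or.inl (by omega)) rfl rfl rfl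
    rfl ⟨le_rfl, h2⟩ ⟨le_rfl, h3⟩ le_rfl (fun _ => le_rfl) (fun _ => le_rfl) ?_ (by simp) ?_ rfl ?_
    ?_ ?_ ?_ ?_ ?_ ?_
  · simp [Spider.edges, Spider.map]
  · simp [Free]
  · intro d hd
    simp only [List.mem_cons, List.not_mem_nil, or_false] at hd
    rcases hd with rfl | rfl
    · refine ⟨1, 0, NewPair.lightLow hg e1 e2 ⟨?_, ?_, fun _ => ⟨?_, ?_⟩, ?_⟩ ?_⟩
      · dsimp only; rw [e1]; simp [Summary.ins]; omega
      · simp [Summary.ins]; omega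
      · dsimp only; rw [e2]; omega
      · simp [Summary.ins]; omega
      · dsimp only; omega
      · dsimp only; omega
    · refine ⟨1, 0, NewPair.lightLow hg e3 e4 ⟨?_, ?_, fun _ => ⟨?_, ?_⟩, ?_⟩ ?_⟩
      · dsimp only; rw [e3]; simp [Summary.ins]; omega
      · simp [Summary.ins]; omega
      · dsimp only; rw [e4]; omega
      · simp [Summary.ins]; omega
      · dsimp only; omega
      · dsimp only; omega
  · intro d hd e he hne
    simp only [List.mem_cons, List.not_mem_nil, or_false] at hd he
    rcases hd with rfl | rfl <;> rcases he with rfl | rfl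
    · exact absurd rfl hne
    · unfold Sep
      simp only [e1, e2, e3, e4]
      exact ⟨fun _ => by omega, fun _ => by omega⟩
    · unfold Sep
      simp only [e1, e2, e3, e4]
      exact ⟨fun _ => by omega, fun _ => by omega⟩
    · exact absurd rfl hne
  · simp
  · intro d hd
    simp only [Spider.pairs, Spider.map, List.map_cons, List.mem_append,
      adj_cons_cons, List.mem_cons, h5] at *
    tauto
  · exact fun x hx => Or.inr hx
  · have := h.statU_map 1 0 1 0
    simp only [Spider.atU, Spider.map, List.map_cons, h5, List.take_succ_cons, List.take_zero,
      List.cons_append, List.nil_append] at this ⊢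
    -- At `u` the shifted label `2` gives way to `1`, again at a cost of one unit.
    have h6 := this.replace (y := 1) (by simp [Summary.ins]; omega) (by simp [Summary.ins])
    exact h6
  · have := h.statV_map 1 0 1 0
    simp only [Spider.atV, Spider.map, List.map_cons, take_reverse_cons] at this ⊢
    exact this

end DoubleSpider

/-! ### Inserting the middle path; the legs of lengths 2 and 1; the empty start. -/

namespace DoubleSpider

variable {T : Spider ℕ} {S : Summary}

/-- Insert the middle path. -/
theorem Valid.newMid {us vs : List (List ℕ)} {S' : Summary} (h : Valid ⟨us, vs, []⟩ S)
    (a b n k : ℕ) (l : List ℕ) (y w : ℕ) (hl : l.take 1 = [y]) (hl' : l.reverse.take 1 = [w])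
    (hb : b ≤ a ∨ S.g = 1) (hm : S'.m = (S.ins a b n k).m)
    (hY : S'.Y = (S.ins a b n k).Y) (ht : S'.t = (S.ins a b n k).t) (hg : S'.g = S.g)
    (hc : S.c ≤ S'.c ∧ S'.c ≤ 1) (hx : S.x ≤ S'.x ∧ S'.x ≤ 1)
    (hML : (S.ins a b n k).ML ≤ S'.ML) (hN : S.x = 1 → S'.N ≤ (S.ins a b n k).N)
    (hMH : S.x = 1 → (S.ins a b n k).MH ≤ S'.MH)
    (hnd : l.Nodup) (hfree : ∀ x ∈ l, Free S a b n k x) (hlen : l.length = a + b + n + k)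
    (hnew : ∀ d ∈ adj l, ∃ p q, NewPair S a b n k S' d p q)
    (hnn : ∀ d ∈ adj l, ∀ e ∈ adj l, d ≠ e → Sep S' d e)
    (hdu : S'.du = S.du + 1) (hhu : S'.hu = S.hu + if S'.Y < y then 1 else 0)
    (hzu : S'.zu = S.zu + if S'.t < y then 1 else 0) (hfu : S'.fu = (S.ins a b n k).fu + y)
    (hdv : S'.dv = S.dv + 1) (hhv : S'.hv = S.hv + if S'.Y < w then 1 else 0)
    (hzv : S'.zv = S.zv + if S'.t < w then 1 else 0) (hfv : S'.fv = (S.ins a b n k).fv + w) :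
    Valid ⟨us.map (List.map (shift S a b n k)), vs.map (List.map (shift S a b n k)), l⟩ S' := by
  refine h.op a b n k l [] (adj l) hb hm hY ht hg hc hx hML hN hMH ?_ hnd hfree hlen hnew hnn
    (by simp) ?_ ?_ ?_ ?_
  · simp [Spider.edges, Spider.map]
  · intro d hd
    simp only [Spider.pairs, Spider.map, List.mem_append] at *
    tauto
  · exact fun x hx => Or.inr hx
  · rw [hdu, hhu, hzu, hfu, hY, ht]
    have := (h.statU_map a b n k).cons y
    simp only [Spider.atU, Spider.map, hl, List.map_nil, List.take_nil, List.nil_append] at this ⊢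
    exact this
  · rw [hdv, hhv, hzv, hfv, hY, ht]
    have := (h.statV_map a b n k).cons w
    simp only [Spider.atV, Spider.map, hl', List.map_nil, List.reverse_nil, List.take_nil,
      List.nil_append] at this ⊢
    exact this

def Summary.midMiddle (S : Summary) : Summary :=
  { S.ins 0 0 1 0 with
    du := S.du + 1, hu := S.hu + 1, fu := (S.ins 0 0 1 0).fu + (S.Y + 1)
    dv := S.dv + 1, hv := S.hv + 1, fv := (S.ins 0 0 1 0).fv + (S.Y + 1) }

def Summary.midLow (S : Summary) : Summary :=
  { S.ins 1 0 0 0 with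
    du := S.du + 1, fu := (S.ins 1 0 0 0).fu + 1, dv := S.dv + 1, fv := (S.ins 1 0 0 0).fv + 1 }

def Summary.midTop (S : Summary) : Summary :=
  { S.ins 0 0 0 1 with
    du := S.du + 1, hu := S.hu + 1, zu := S.zu + 1, fu := (S.ins 0 0 0 1).fu + (S.t + 1)
    dv := S.dv + 1, hv := S.hv + 1, zv := S.zv + 1, fv := (S.ins 0 0 0 1).fv + (S.t + 1) }

/-- The middle path `1, Y + 2`. -/
def Summary.mid2 (S : Summary) : Summary :=
  { S.ins 1 0 1 0 with
    du := S.du + 1, fu := (S.ins 1 0 1 0).fu + 1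
    dv := S.dv + 1, hv := S.hv + 1, fv := (S.ins 1 0 1 0).fv + (S.Y + 2) }

/-- The middle path `Y + 1, t + 2`. -/
def Summary.mid2top (S : Summary) : Summary :=
  { S.ins 0 0 1 1 with
    x := 1, N := S.Y + S.t + 3, MH := max ((S.ins 0 0 1 1).MH) (S.Y + S.t + 3)
    du := S.du + 1, hu := S.hu + 1, fu := (S.ins 0 0 1 1).fu + (S.Y + 1)
    dv := S.dv + 1, hv := S.hv + 1, zv := S.zv + 1, fv := (S.ins 0 0 1 1).fv + (S.t + 2) }

/-- The middle path `1, Y + 2, t + 3`. -/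
def Summary.mid3top (S : Summary) : Summary :=
  { S.ins 1 0 1 1 with
    x := 1, N := S.Y + S.t + 5, MH := max ((S.ins 1 0 1 1).MH) (S.Y + S.t + 5)
    du := S.du + 1, fu := (S.ins 1 0 1 1).fu + 1
    dv := S.dv + 1, hv := S.hv + 1, zv := S.zv + 1, fv := (S.ins 1 0 1 1).fv + (S.t + 3) }

section mid

variable {us vs : List (List ℕ)}

theorem Valid.midMiddle (h : Valid ⟨us, vs, []⟩ S) :
    Valid ⟨us.map (List.map (shift S 0 0 1 0)), vs.map (List.map (shift S 0 0 1 0)), [S.Y + 1]⟩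
      S.midMiddle := by
  have h1 := h.core.Y_le
  have h2 := h.core.c_le
  have h3 := h.core.x_le
  refine h.newMid 0 0 1 0 [S.Y + 1] (S.Y + 1) (S.Y + 1) rfl rfl (Or.inl (by omega)) rfl rfl rfl rfl
    ⟨le_rfl, h2⟩ ⟨le_rfl, h3⟩ le_rfl (fun _ => le_rfl) (fun _ => le_rfl) (by simp) (by simp [Free])
    rfl (by simp) (by simp) rfl ?_ ?_ rfl rfl ?_ ?_ rfl <;>
  simp [Summary.midMiddle, Summary.ins] <;> omega

theorem Valid.midLow (h : Valid ⟨us, vs, []⟩ S) :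
    Valid ⟨us.map (List.map (shift S 1 0 0 0)), vs.map (List.map (shift S 1 0 0 0)), [1]⟩
      S.midLow := by
  have h1 := h.core.Y_le
  have h2 := h.core.c_le
  have h3 := h.core.x_le
  refine h.newMid 1 0 0 0 [1] 1 1 rfl rfl (Or.inl (by omega)) rfl rfl rfl rfl
    ⟨le_rfl, h2⟩ ⟨le_rfl, h3⟩ le_rfl (fun _ => le_rfl) (fun _ => le_rfl) (by simp) (by simp [Free])
    rfl (by simp) (by simp) rfl ?_ ?_ rfl rfl ?_ ?_ rfl <;>
  simp [Summary.midLow, Summary.ins]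

theorem Valid.midTop (h : Valid ⟨us, vs, []⟩ S) :
    Valid ⟨us.map (List.map (shift S 0 0 0 1)), vs.map (List.map (shift S 0 0 0 1)), [S.t + 1]⟩
      S.midTop := by
  have h1 := h.core.Y_le
  have h2 := h.core.c_le
  have h3 := h.core.x_le
  refine h.newMid 0 0 0 1 [S.t + 1] (S.t + 1) (S.t + 1) rfl rfl (Or.inl (by omega)) rfl rfl rfl rfl
    ⟨le_rfl, h2⟩ ⟨le_rfl, h3⟩ le_rfl (fun _ => le_rfl) (fun _ => le_rfl) (by simp) (by simp [Free])
    rfl (by simp) (by simp) rfl ?_ ?_ rfl rfl ?_ ?_ rfl <;>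
  simp [Summary.midTop, Summary.ins] <;> omega

theorem Valid.mid2 (h : Valid ⟨us, vs, []⟩ S) (hg : S.g = 1) :
    Valid ⟨us.map (List.map (shift S 1 0 1 0)), vs.map (List.map (shift S 1 0 1 0)), [1, S.Y + 2]⟩
      S.mid2 := by
  have h1 := h.core.Y_le
  have h2 := h.core.c_le
  have h3 := h.core.x_le
  have h4 := h.core.Y_le_ML
  have e5 : above S.mid2.Y (1, S.Y + 2) = 1 := by
    apply above_eq_one <;> simp [Summary.mid2, Summary.ins]
  have e6 : above S.mid2.t (1, S.Y + 2) = 0 := by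
    apply above_eq_zero <;> simp [Summary.mid2, Summary.ins]; omega
  refine h.newMid 1 0 1 0 [1, S.Y + 2] 1 (S.Y + 2) rfl rfl (Or.inl (by omega)) rfl rfl rfl rfl
    ⟨le_rfl, h2⟩ ⟨le_rfl, h3⟩ le_rfl (fun _ => le_rfl) (fun _ => le_rfl) (by simp) (by simp [Free])
    rfl ?_ (by simp) rfl ?_ ?_ rfl rfl ?_ ?_ rfl
  · intro d hd
    simp only [adj_cons_cons, adj_singleton, List.mem_singleton] at hd
    subst hd
    refine ⟨1, 0, NewPair.lightLow hg e5 e6 ⟨?_, ?_, fun _ => ⟨?_, ?_⟩, ?_⟩ ?_⟩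
    · rw [e5]; simp [Summary.mid2, Summary.ins]; omega
    · simp [Summary.mid2, Summary.ins]; omega
    · rw [e6]; omega
    · simp [Summary.mid2, Summary.ins]; omega
    · omega
    · dsimp only; omega
  all_goals simp [Summary.mid2, Summary.ins] <;> omega

theorem Valid.mid2top (h : Valid ⟨us, vs, []⟩ S) (hML : S.ML + S.c < S.Y + S.t + 2)
    (hN : S.x = 1 → S.Y + S.t < S.N) :
    Valid ⟨us.map (List.map (shift S 0 0 1 1)), vs.map (List.map (shift S 0 0 1 1)),
      [S.Y + 1, S.t + 2]⟩ S.mid2top := by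
  have h1 := h.core.Y_le
  have h2 := h.core.c_le
  have h3 := h.core.x_le
  have h4 := h.core.Y_le_ML
  have h5 := h.core.g_le
  have e1 : above S.mid2top.Y (S.Y + 1, S.t + 2) = 2 := by
    apply above_eq_two <;> simp [Summary.mid2top, Summary.ins]; omega
  have e2 : above S.mid2top.t (S.Y + 1, S.t + 2) = 1 := by
    apply above_eq_one <;> simp [Summary.mid2top, Summary.ins]; omega
  refine h.newMid 0 0 1 1 [S.Y + 1, S.t + 2] (S.Y + 1) (S.t + 2) rfl rfl (Or.inl (by omega)) rfl rfl
    rfl rfl ⟨le_rfl, h2⟩ ⟨h3, le_rfl⟩ le_rfl ?_ (fun _ => le_max_left _ _) ?_ ?_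
    rfl ?_ (by simp) rfl ?_ ?_ rfl rfl ?_ ?_ rfl
  · intro h5
    have := hN h5
    simp [Summary.mid2top, Summary.ins]
    omega
  · simp
    omega
  · simp [Free]
  · intro d hd
    simp only [adj_cons_cons, adj_singleton, List.mem_singleton] at hd
    subst hd
    refine ⟨2, 1, NewPair.heavyLow e1 e2 ⟨?_, ?_, ?_, fun _ => ⟨e2, rfl, ?_, ?_⟩⟩ ?_ ?_⟩
    · rw [e1]; simp [Summary.mid2top, Summary.ins]; omega
    · simp [Summary.mid2top, Summary.ins]; omega
    · omega
    · simp [Summary.mid2top]; omega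
    · simp [Summary.mid2top]; omega
    · dsimp only; omega
    · intro h5
      have := hN h5
      dsimp only; omega
  all_goals simp [Summary.mid2top, Summary.ins] <;> omega

theorem Valid.mid3top (h : Valid ⟨us, vs, []⟩ S) (hg : S.g = 1) (hML : S.ML + S.c < S.Y + S.t + 2)
    (hN : S.x = 1 → S.Y + S.t < S.N) :
    Valid ⟨us.map (List.map (shift S 1 0 1 1)), vs.map (List.map (shift S 1 0 1 1)),
      [1, S.Y + 2, S.t + 3]⟩ S.mid3top := by
  have h1 := h.core.Y_le
  have h2 := h.core.c_le
  have h3 := h.core.x_le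
  have h4 := h.core.Y_le_ML
  have e1 : above S.mid3top.Y (S.Y + 2, S.t + 3) = 2 := by
    apply above_eq_two <;> simp [Summary.mid3top, Summary.ins]; omega
  have e2 : above S.mid3top.t (S.Y + 2, S.t + 3) = 1 := by
    apply above_eq_one <;> simp [Summary.mid3top, Summary.ins]; omega
  have e5 : above S.mid3top.Y (1, S.Y + 2) = 1 := by
    apply above_eq_one <;> simp [Summary.mid3top, Summary.ins]
  have e6 : above S.mid3top.t (1, S.Y + 2) = 0 := by
    apply above_eq_zero <;> simp [Summary.mid3top, Summary.ins]; omega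
  refine h.newMid 1 0 1 1 [1, S.Y + 2, S.t + 3] 1 (S.t + 3) rfl rfl (Or.inl (by omega)) rfl rfl
    rfl rfl ⟨le_rfl, h2⟩ ⟨h3, le_rfl⟩ le_rfl ?_ (fun _ => le_max_left _ _) ?_ ?_
    rfl ?_ ?_ rfl ?_ ?_ rfl rfl ?_ ?_ rfl
  · intro h5
    have := hN h5
    simp [Summary.mid3top, Summary.ins]
    omega
  · simp
    omega
  · simp [Free]
  · intro d hd
    simp only [adj_cons_cons, adj_singleton, List.mem_cons, List.not_mem_nil, or_false] at hd
    rcases hd with rfl | rfl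
    · refine ⟨1, 0, NewPair.lightLow hg e5 e6 ⟨?_, ?_, fun _ => ⟨?_, ?_⟩, ?_⟩ ?_⟩
      · rw [e5]; simp [Summary.mid3top, Summary.ins]; omega
      · simp [Summary.mid3top, Summary.ins]; omega
      · rw [e6]; omega
      · simp [Summary.mid3top, Summary.ins]; omega
      · omega
      · dsimp only; omega
    · refine ⟨2, 1, NewPair.heavyLow e1 e2 ⟨?_, ?_, ?_, fun _ => ⟨e2, rfl, ?_, ?_⟩⟩ ?_ ?_⟩
      · rw [e1]; simp [Summary.mid3top, Summary.ins]; omega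
      · simp [Summary.mid3top, Summary.ins]; omega
      · omega
      · simp [Summary.mid3top]; omega
      · simp [Summary.mid3top]; omega
      · dsimp only; omega
      · intro h5
        have := hN h5
        dsimp only; omega
  · intro d hd e he hne
    simp only [adj_cons_cons, adj_singleton, List.mem_cons, List.not_mem_nil, or_false] at hd he
    rcases hd with rfl | rfl <;> rcases he with rfl | rfl
    · exact absurd rfl hne
    · unfold Sep
      simp only [e1, e2, e5, e6]
      exact ⟨fun _ => by omega, fun _ => by omega⟩
    · unfold Sep
      simp only [e1, e2, e5, e6]
      exact ⟨fun _ => by omega, fun _ => by omega⟩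
    · exact absurd rfl hne
  all_goals simp [Summary.mid3top, Summary.ins] <;> omega

end mid

/-- Attach a leg of length two at `u` whose leaf has the largest low label, and a leg of length one
at `v`. -/
def Summary.twoOne (S : Summary) : Summary :=
  { S.ins 2 1 0 0 with
    du := S.du + 1, fu := (S.ins 2 1 0 0).fu + 1, dv := S.dv + 1, fv := (S.ins 2 1 0 0).fv + 2 }

/-- The new pair `Y + 3, 1` consists of two low labels, so `g` must be `0`. Its sum `Y + 4` just
exceeds the largest possible leaf label `Y + 3` and stays below every old sum, which is now at least
`Y + 5`. -/
theorem Valid.twoOne (h : Valid T S) (hg : S.g = 0) (hML : S.Y + 1 ≤ S.ML + 2) :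
    Valid ⟨[S.Y + 3, 1] :: T.us.map (List.map (shift S 2 1 0 0)),
      [2] :: T.vs.map (List.map (shift S 2 1 0 0)), T.mid.map (shift S 2 1 0 0)⟩ S.twoOne := by
  have h1 := h.core.Y_le
  have h2 := h.core.c_le
  have h3 := h.core.x_le
  have e1 : above S.twoOne.Y (S.Y + 3, 1) = 0 := by
    apply above_eq_zero <;> simp [Summary.twoOne, Summary.ins]
  have e2 : above S.twoOne.t (S.Y + 3, 1) = 0 := by
    apply above_eq_zero <;> simp [Summary.twoOne, Summary.ins]
    omega
  refine h.op 2 1 0 0 [S.Y + 3, 1, 2] [S.Y + 3, 2] [(S.Y + 3, 1)] (Or.inl (by omega)) rfl rfl rfl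
    rfl ⟨le_rfl, h2⟩ ⟨le_rfl, h3⟩ le_rfl (fun _ => le_rfl) (fun _ => le_rfl) ?_ ?_ ?_ rfl ?_
    (by simp) ?_ ?_ ?_ ?_ ?_
  · simp only [Spider.edges, Spider.map, List.flatten_cons, List.cons_append, List.nil_append]
    refine List.perm_middle.trans (List.Perm.cons _ (List.perm_middle.trans (List.Perm.cons _ ?_)))
    rw [← List.append_assoc, ← List.append_assoc]
    exact List.perm_middle
  · simp
  · simp [Free]
  · intro d hd
    simp only [List.mem_singleton] at hd
    subst hd
    refine ⟨0, 0, NewPair.bottom e1 e2 ⟨?_, ?_, fun _ => ⟨?_, ?_⟩, ?_⟩ ?_⟩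
    · rw [e1]; exact hg.le
    · simp [Summary.twoOne, Summary.ins, hg]
    · rw [e2]; exact Nat.zero_le _
    · simp [Summary.twoOne, Summary.ins]; omega
    · omega
    · dsimp only; omega
  · simp [Summary.twoOne, Summary.ins]
  · intro d hd
    simp only [Spider.pairs, Spider.map, List.flatMap_cons, List.mem_append, adj_cons_cons,
      adj_singleton, List.mem_cons, List.not_mem_nil, or_false, false_or] at *
    tauto
  · intro x hx
    simp [Spider.leaves, Spider.map] at hx ⊢
    rcases hx with hx | hx | hx | hx
    exacts [Or.inl (Or.inl hx), Or.inr (Or.inl hx), Or.inl (Or.inr hx), Or.inr (Or.inr hx)]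
  · have := ((h.statU_map 2 1 0 0).cons 1).perm
      (U' := (Spider.atU ⟨[S.Y + 3, 1] :: T.us.map (List.map (shift S 2 1 0 0)),
      [2] :: T.vs.map (List.map (shift S 2 1 0 0)), T.mid.map (shift S 2 1 0 0)⟩))
      (by simp only [Spider.atU, Spider.map, List.flatMap_cons]; exact List.perm_middle)
    simpa [Summary.twoOne, Summary.ins] using this
  · have := ((h.statV_map 2 1 0 0).cons 2).perm
      (U' := (Spider.atV ⟨[S.Y + 3, 1] :: T.us.map (List.map (shift S 2 1 0 0)),
      [2] :: T.vs.map (List.map (shift S 2 1 0 0)), T.mid.map (shift S 2 1 0 0)⟩))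
      (by simp only [Spider.atV, Spider.map, List.flatMap_cons]; exact List.perm_middle)
    simpa [Summary.twoOne, Summary.ins] using this

/-- There is no pair yet, so `g = 1` costs nothing. -/
def Summary.zero : Summary := ⟨0, 0, 0, 0, 0, 0, 1, 0, 0, 0, 0, 0, 0, 0, 0, 0, 0⟩

theorem valid_zero : Valid ⟨[], [], []⟩ Summary.zero where
  t_le := le_rfl
  labels := by simp [IsLabels, Spider.edges, Summary.zero]
  core := by
    refine ⟨le_rfl, le_rfl, Nat.zero_le _, Nat.zero_le _, le_rfl, ?_, ?_, ?_, ?_, ?_⟩ <;>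
      simp [Spider.leaves, Spider.pairs, Spider.atU, Spider.atV, Stats, Summary.zero]

/-- Gives up the requirement of a label above `Y` in each pair, as `twoOne` demands. -/
theorem Valid.forget (h : Valid T S) : Valid T { S with g := 0 } where
  t_le := h.t_le
  labels := h.labels
  core := by
    obtain ⟨h1, h2, h3, h4, h5, h6, h7, h8, h9, h10⟩ := h.core
    refine ⟨h1, Nat.zero_le _, h3, h4, h5, h6, ?_, h8, h9, h10⟩
    intro d hd
    obtain ⟨g1, g2, g3, g4⟩ := h7 d hd
    exact ⟨Nat.zero_le _, by dsimp only; omega, g3, g4⟩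

end DoubleSpider

/-! ### Labellings described by leg lengths alone. -/

namespace DoubleSpider

/-- Some double spider with legs of lengths `A` and `B` and path length `p` can be labelled in
accordance with `S`. -/
def Realizes (A B : Multiset ℕ) (p : ℕ) (S : Summary) : Prop :=
  ∃ T : Spider ℕ, (T.us.map List.length : Multiset ℕ) = A ∧
    (T.vs.map List.length : Multiset ℕ) = B ∧ T.mid.length = p ∧ Valid T S

theorem Summary.ins_ins (S : Summary) (k : ℕ) :
    (S.ins k 0 k 0).ins 1 0 1 0 = S.ins (k + 1) 0 (k + 1) 0 := by
  simp only [Summary.ins, Summary.mk.injEq, true_and]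
  refine ⟨by ring, by ring, by ring, by ring, by ring, by ring, by ring, by ring⟩

theorem Realizes.swap {A B : Multiset ℕ} {p : ℕ} {S : Summary} (h : Realizes A B p S) :
    Realizes B A p S.swap := by
  obtain ⟨T, h1, h2, h3, h4⟩ := h
  exact ⟨T.swap, h2, h1, by simpa [Spider.swap] using h3, h4.swap⟩

theorem map_length_map (f : ℕ → ℕ) (L : List (List ℕ)) :
    (L.map (List.map f)).map List.length = L.map List.length := by
  simp

theorem Realizes.extLeg {us vs : List (List ℕ)} {l mid : List ℕ} {S : Summary}
    (h : Valid ⟨(1 :: l) :: us, vs, mid⟩ S) (hg : S.g = 1) (hML : S.Y + 1 ≤ S.ML) (k : ℕ) :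
    Realizes ((2 * k + (l.length + 1)) ::ₘ (us.map List.length : Multiset ℕ))
      (vs.map List.length : Multiset ℕ) mid.length (S.ins k 0 k 0) := by
  suffices ∃ us' vs' l' mid', us'.map List.length = us.map List.length ∧
      vs'.map List.length = vs.map List.length ∧ mid'.length = mid.length ∧
      l'.length = 2 * k + l.length ∧ Valid ⟨(1 :: l') :: us', vs', mid'⟩ (S.ins k 0 k 0) by
    obtain ⟨us', vs', l', mid', h1, h2, h3, h4, h5⟩ := this
    refine ⟨_, ?_, ?_, h3, h5⟩
    · simp only [List.map_cons, h1, List.length_cons, h4, Multiset.cons_coe]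
      rfl
    · simp only [h2]
  induction k with
  | zero => exact ⟨us, vs, l, mid, rfl, rfl, rfl, by simp, by simpa [Summary.ins] using h⟩
  | succ k ih =>
    obtain ⟨us', vs', l', mid', h1, h2, h3, h4, h5⟩ := ih
    have := h5.extLeg hg (by simp only [Summary.ins]; omega)
    rw [Summary.ins_ins] at this
    refine ⟨_, _, _, _, ?_, ?_, ?_, ?_, this⟩
    · rw [map_length_map, h1]
    · rw [map_length_map, h2]
    · rw [List.length_map, h3]
    · simp [h4]; ring

/-- Each prolongation of the middle path at `u` costs `u` one unit. The hypothesis `1 ≤ du` makes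
the shifted sum at least `k`, so the truncated subtractions add up. -/
theorem Summary.ins_sub_ins (S : Summary) (k : ℕ) (h : 1 ≤ S.du) :
    { ({S.ins k 0 k 0 with fu := (S.ins k 0 k 0).fu - k} : Summary).ins 1 0 1 0 with
      fu := (({S.ins k 0 k 0 with fu := (S.ins k 0 k 0).fu - k} : Summary).ins 1 0 1 0).fu - 1 } =
    { S.ins (k + 1) 0 (k + 1) 0 with fu := (S.ins (k + 1) 0 (k + 1) 0).fu - (k + 1) } := by
  have := Nat.mul_le_mul_left k h
  simp only [Summary.ins, Summary.mk.injEq, true_and]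
  refine ⟨by ring, by ring, by ring, by ring, by ring, by ring, ?_, by ring⟩
  have e1 : (k + 1) * S.du = k * S.du + S.du := by ring
  have e2 : (0 + (k + 1)) * S.hu = k * S.hu + S.hu := by ring
  rw [e1, e2]
  simp only [zero_add, one_mul, zero_mul, add_zero]
  omega

theorem Realizes.extMidHigh {us vs : List (List ℕ)} {l : List ℕ} {S : Summary}
    (h : Valid ⟨us, vs, (S.Y + 1) :: l⟩ S) (hg : S.g = 1) (hML : S.Y + 1 ≤ S.ML)
    (hY : S.Y + 1 ≤ S.t) (hd : 1 ≤ S.du)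
    (k : ℕ) :
    Realizes (us.map List.length : Multiset ℕ) (vs.map List.length : Multiset ℕ)
      (2 * k + (l.length + 1)) { S.ins k 0 k 0 with fu := (S.ins k 0 k 0).fu - k } := by
  suffices ∃ us' vs' l', us'.map List.length = us.map List.length ∧
      vs'.map List.length = vs.map List.length ∧
      l'.length = 2 * k + l.length ∧ Valid ⟨us', vs', ((S.ins k 0 k 0).Y + 1) :: l'⟩
        { S.ins k 0 k 0 with fu := (S.ins k 0 k 0).fu - k } by
    obtain ⟨us', vs', l', h1, h2, h4, h5⟩ := this
    refine ⟨_, ?_, ?_, ?_, h5⟩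
    · simp only [h1]
    · simp only [h2]
    · simp [h4, add_assoc]
  induction k with
  | zero => exact ⟨us, vs, l, rfl, rfl, by simp, by simpa [Summary.ins] using h⟩
  | succ k ih =>
    obtain ⟨us', vs', l', h1, h2, h4, h5⟩ := ih
    have := Valid.extMidHigh (S := { S.ins k 0 k 0 with fu := (S.ins k 0 k 0).fu - k }) h5 hg
      (by simp only [Summary.ins]; omega) (by simp only [Summary.ins]; omega)
    rw [Summary.ins_sub_ins S k hd] at this
    refine ⟨_, _, _, ?_, ?_, ?_, this⟩
    · rw [map_length_map, h1]
    · rw [map_length_map, h2]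
    · simp [h4]; ring

theorem Realizes.extMidLow {us vs : List (List ℕ)} {l : List ℕ} {S : Summary}
    (h : Valid ⟨us, vs, 1 :: l⟩ S) (hg : S.g = 1) (hML : S.Y + 1 ≤ S.ML) (hY : 1 ≤ S.Y)
    (hd : 1 ≤ S.du) (k : ℕ) :
    Realizes (us.map List.length : Multiset ℕ) (vs.map List.length : Multiset ℕ)
      (2 * k + (l.length + 1)) { S.ins k 0 k 0 with fu := (S.ins k 0 k 0).fu - k } := by
  suffices ∃ us' vs' l', us'.map List.length = us.map List.length ∧
      vs'.map List.length = vs.map List.length ∧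
      l'.length = 2 * k + l.length ∧ Valid ⟨us', vs', 1 :: l'⟩
        { S.ins k 0 k 0 with fu := (S.ins k 0 k 0).fu - k } by
    obtain ⟨us', vs', l', h1, h2, h4, h5⟩ := this
    refine ⟨_, ?_, ?_, ?_, h5⟩
    · simp only [h1]
    · simp only [h2]
    · simp [h4, add_assoc]
  induction k with
  | zero => exact ⟨us, vs, l, rfl, rfl, by simp, by simpa [Summary.ins] using h⟩
  | succ k ih =>
    obtain ⟨us', vs', l', h1, h2, h4, h5⟩ := ih
    have := Valid.extMidLow h5 hg (by simp only [Summary.ins]; omega)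
      (by simp only [Summary.ins]; omega)
    rw [Summary.ins_sub_ins S k hd] at this
    refine ⟨_, _, _, ?_, ?_, ?_, this⟩
    · rw [map_length_map, h1]
    · rw [map_length_map, h2]
    · simp [h4]; ring

end DoubleSpider

namespace DoubleSpider

theorem Realizes.of_eq {A B A' B' : Multiset ℕ} {p p' : ℕ} {S S' : Summary}
    (h : Realizes A B p S) (hA : A = A') (hB : B = B') (hp : p = p') (hS : S = S') :
    Realizes A' B' p' S' := by
  subst hA hB hp hS
  exact h

namespace Realizes

variable {A B : Multiset ℕ} {p Y t m ML N MH c x du hu zu fu dv hv zv fv : ℕ}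

/-- Prolongation happens at the leaf end, so the first piece of a leg fixes the zone of the label at
`u`: low for an odd leg, middle for an even one (`uEven`). -/
theorem uOdd (h : Realizes A B p ⟨Y, t, m, ML, N, MH, 1, c, x, du, hu, zu, fu, dv, hv, zv, fv⟩)
    (k : ℕ) : Realizes ((2 * k + 1) ::ₘ A) B p
      ⟨Y + k + 1, t + 2 * k + 1, m + 2 * k + 1, ML + 3 * k + 2, N + 4 * k + 2,
        MH + x * (4 * k + 2), 1, c, x, du + 1, hu, zu, fu + (k + 1) * du + k * hu + k + 1,
        dv, hv, zv, fv + (k + 1) * dv + k * hv⟩ := by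
  obtain ⟨T, rfl, rfl, rfl, h⟩ := h
  have h1 := h.core.Y_le_ML
  have := Realizes.extLeg h.leg1 rfl (by simp only [Summary.leg1, Summary.ins] at *; omega) k
  refine this.of_eq ?_ ?_ (by simp) ?_
  · rw [map_length_map]; rfl
  · rw [map_length_map]
  · simp only [Summary.leg1, Summary.ins]
    congr 1 <;> ring

theorem uEven (h : Realizes A B p ⟨Y, t, m, ML, N, MH, 1, c, x, du, hu, zu, fu, dv, hv, zv, fv⟩)
    (k : ℕ) : Realizes ((2 * k + 2) ::ₘ A) B p
      ⟨Y + k + 1, t + 2 * k + 2, m + 2 * k + 2, ML + 3 * k + 3, N + 4 * k + 4,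
        MH + x * (4 * k + 4), 1, c, x, du + 1, hu + 1, zu,
        fu + (k + 1) * du + (k + 1) * hu + Y + 2 * k + 2,
        dv, hv, zv, fv + (k + 1) * dv + (k + 1) * hv⟩ := by
  obtain ⟨T, rfl, rfl, rfl, h⟩ := h
  have h1 := h.core.Y_le_ML
  have := Realizes.extLeg (h.leg2 rfl) rfl (by simp only [Summary.leg2, Summary.ins] at *; omega) k
  refine this.of_eq ?_ ?_ (by simp) ?_
  · rw [map_length_map]; rfl
  · rw [map_length_map]
  · simp only [Summary.leg2, Summary.ins]
    congr 1 <;> ring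

/-- An odd leg of length at least 3 can instead give `u` a top label, at the price of a heavy pair.
-/
theorem uTopOdd (h : Realizes A B p ⟨Y, t, m, ML, N, MH, 1, c, x, du, hu, zu, fu, dv, hv, zv, fv⟩)
    (k : ℕ) (hML : ML + c < Y + t + 2) (hN : x = 1 → Y + t < N) :
    Realizes ((2 * k + 3) ::ₘ A) B p
      ⟨Y + k + 1, t + 2 * k + 2, m + 2 * k + 3, ML + 3 * k + 3 + c, Y + t + 5 + 4 * k,
        max (MH + x * 5) (Y + t + 5) + 4 * k, 1, c, 1, du + 1, hu + 1, zu + 1,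
        fu + (k + 1) * du + (k + 1) * hu + zu + t + 2 * k + 3,
        dv, hv, zv, fv + (k + 1) * dv + (k + 1) * hv + zv⟩ := by
  obtain ⟨T, rfl, rfl, rfl, h⟩ := h
  have h1 := h.core.Y_le_ML
  have := Realizes.extLeg (h.leg3top rfl hML hN) rfl
    (by simp only [Summary.leg3top, Summary.ins] at *; omega) k
  refine this.of_eq ?_ ?_ (by simp) ?_
  · rw [map_length_map]; rfl
  · rw [map_length_map]
  · simp only [Summary.leg3top, Summary.ins]
    congr 1 <;> ring_nf

/-- An even leg of length at least 4 can instead give `u` only a low label, at the price of a heavy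
pair and of a light pair with a top label. -/
theorem uTopEven (h : Realizes A B p ⟨Y, t, m, ML, N, MH, 1, c, x, du, hu, zu, fu, dv, hv, zv, fv⟩)
    (k : ℕ) (hML : ML ≤ Y + t) (hN : x = 1 → Y + t < N) :
    Realizes ((2 * k + 4) ::ₘ A) B p
      ⟨Y + k + 2, t + 2 * k + 3, m + 2 * k + 4, Y + t + 6 + 3 * k, Y + t + 7 + 4 * k,
        max (MH + x * 7) (Y + t + 7) + 4 * k, 1, 1, 1, du + 1, hu, zu,
        fu + (k + 1) * du + (k + 2) * hu + zu + Y + k + 2,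
        dv, hv, zv, fv + (k + 1) * dv + (k + 2) * hv + zv⟩ := by
  obtain ⟨T, rfl, rfl, rfl, h⟩ := h
  have h1 := h.core.Y_le_ML
  have := Realizes.extLeg (h.leg4top rfl hML hN) rfl
    (by simp only [Summary.leg4top, Summary.ins] at *; omega) k
  refine this.of_eq ?_ ?_ (by simp) ?_
  · rw [map_length_map]; rfl
  · rw [map_length_map]
  · simp only [Summary.leg4top, Summary.ins]
    congr 1 <;> ring_nf

theorem uTopLeaf
    (h : Realizes A B p ⟨Y, t, m, ML, N, MH, 1, c, x, du, hu, zu, fu, dv, hv, zv, fv⟩) :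
    Realizes (1 ::ₘ A) B p
      ⟨Y + 1, t + 1, m + 1, ML + 1, N + 2, MH + x * 2, 1, c, x, du + 1, hu, zu,
        fu + hu + Y + 1, dv, hv, zv, fv + hv⟩ := by
  obtain ⟨T, rfl, rfl, rfl, h⟩ := h
  refine Realizes.of_eq ⟨_, rfl, rfl, rfl, h.topLeaf rfl⟩ ?_ ?_ (by simp) ?_
  · simp [Function.comp_def]
  · rw [map_length_map]
  · simp only [Summary.topLeaf, Summary.ins]
    congr 1 <;> ring_nf

/-- In these names `U` tells that the path is prolonged at its end at `u`. `High` and `Low` tell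
whether the label there is middle or low; the variants with `Top` and a suffix put a top label at
the opposite end. -/
theorem midHighU (h : Realizes A B 0 ⟨Y, t, m, ML, N, MH, 1, c, x, du, hu, zu, fu, dv, hv, zv, fv⟩)
    (k : ℕ) : Realizes A B (2 * k + 1)
      ⟨Y + k, t + 2 * k + 1, m + 2 * k + 1, ML + 3 * k + 1, N + 4 * k + 2, MH + x * (4 * k + 2),
        1, c, x, du + 1, hu + 1, zu, fu + k * du + (k + 1) * hu + Y + k + 1,
        dv + 1, hv + 1, zv, fv + k * dv + (k + 1) * hv + Y + 2 * k + 1⟩ := by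
  obtain ⟨⟨us, vs, mid⟩, rfl, rfl, hm, h⟩ := h
  obtain rfl := List.eq_nil_of_length_eq_zero hm
  have h1 := h.core.Y_le_ML
  have h2 := h.core.Y_le
  simp only at h1 h2
  have := Realizes.extMidHigh (S := Summary.midMiddle
    ⟨Y, t, m, ML, N, MH, 1, c, x, du, hu, zu, fu, dv, hv, zv, fv⟩) h.midMiddle rfl
    (by simp only [Summary.midMiddle, Summary.ins] at *; omega)
    (by simp only [Summary.midMiddle, Summary.ins] at *; omega)
    (by simp only [Summary.midMiddle, Summary.ins] at *; omega) k
  refine this.of_eq ?_ ?_ (by simp) ?_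
  · rw [map_length_map]
  · rw [map_length_map]
  · simp only [Summary.midMiddle, Summary.ins]
    congr 1 <;> first | ring1 | (apply Nat.sub_eq_of_eq_add; ring1)

theorem midLowU (h : Realizes A B 0 ⟨Y, t, m, ML, N, MH, 1, c, x, du, hu, zu, fu, dv, hv, zv, fv⟩)
    (k : ℕ) : Realizes A B (2 * k + 1)
      ⟨Y + k + 1, t + 2 * k + 1, m + 2 * k + 1, ML + 3 * k + 2, N + 4 * k + 2,
        MH + x * (4 * k + 2), 1, c, x, du + 1, hu, zu, fu + (k + 1) * du + k * hu + 1,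
        dv + 1, hv, zv, fv + (k + 1) * dv + k * hv + k + 1⟩ := by
  obtain ⟨⟨us, vs, mid⟩, rfl, rfl, hm, h⟩ := h
  obtain rfl := List.eq_nil_of_length_eq_zero hm
  have h1 := h.core.Y_le_ML
  simp only at h1
  have := Realizes.extMidLow h.midLow rfl
    (by simp only [Summary.midLow, Summary.ins] at *; omega)
    (by simp only [Summary.midLow, Summary.ins] at *; omega)
    (by simp only [Summary.midLow, Summary.ins] at *; omega) k
  refine this.of_eq ?_ ?_ (by simp) ?_
  · rw [map_length_map]
  · rw [map_length_map]
  · simp only [Summary.midLow, Summary.ins]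
    congr 1 <;> first | ring1 | (apply Nat.sub_eq_of_eq_add; ring1)

theorem midTop (h : Realizes A B 0 ⟨Y, t, m, ML, N, MH, 1, c, x, du, hu, zu, fu, dv, hv, zv, fv⟩) :
    Realizes A B 1
      ⟨Y, t, m + 1, ML + c, N + 1, MH + x, 1, c, x, du + 1, hu + 1, zu + 1, fu + zu + t + 1,
        dv + 1, hv + 1, zv + 1, fv + zv + t + 1⟩ := by
  obtain ⟨⟨us, vs, mid⟩, rfl, rfl, hm, h⟩ := h
  obtain rfl := List.eq_nil_of_length_eq_zero hm
  refine Realizes.of_eq ⟨_, rfl, rfl, rfl, h.midTop⟩ ?_ ?_ (by simp) ?_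
  · rw [map_length_map]
  · rw [map_length_map]
  · simp only [Summary.midTop, Summary.ins]
    congr 1 <;> ring_nf

theorem midEvenLowU
    (h : Realizes A B 0 ⟨Y, t, m, ML, N, MH, 1, c, x, du, hu, zu, fu, dv, hv, zv, fv⟩)
    (k : ℕ) : Realizes A B (2 * k + 2)
      ⟨Y + k + 1, t + 2 * k + 2, m + 2 * k + 2, ML + 3 * k + 3, N + 4 * k + 4,
        MH + x * (4 * k + 4), 1, c, x, du + 1, hu, zu, fu + (k + 1) * du + (k + 1) * hu + 1,
        dv + 1, hv + 1, zv, fv + (k + 1) * dv + (k + 1) * hv + Y + 2 * k + 2⟩ := by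
  obtain ⟨⟨us, vs, mid⟩, rfl, rfl, hm, h⟩ := h
  obtain rfl := List.eq_nil_of_length_eq_zero hm
  have h1 := h.core.Y_le_ML
  simp only at h1
  have := Realizes.extMidLow (h.mid2 rfl) rfl
    (by simp only [Summary.mid2, Summary.ins] at *; omega)
    (by simp only [Summary.mid2, Summary.ins] at *; omega)
    (by simp only [Summary.mid2, Summary.ins] at *; omega) k
  refine this.of_eq ?_ ?_ (by simp) ?_
  · rw [map_length_map]
  · rw [map_length_map]
  · simp only [Summary.mid2, Summary.ins]
    congr 1 <;> first | ring1 | (apply Nat.sub_eq_of_eq_add; ring1)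

theorem midEvenHighU
    (h : Realizes A B 0 ⟨Y, t, m, ML, N, MH, 1, c, x, du, hu, zu, fu, dv, hv, zv, fv⟩)
    (k : ℕ) : Realizes A B (2 * k + 2)
      ⟨Y + k + 1, t + 2 * k + 2, m + 2 * k + 2, ML + 3 * k + 3, N + 4 * k + 4,
        MH + x * (4 * k + 4), 1, c, x, du + 1, hu + 1, zu,
        fu + (k + 1) * du + (k + 1) * hu + Y + k + 2,
        dv + 1, hv, zv, fv + (k + 1) * dv + (k + 1) * hv + k + 1⟩ := by
  obtain ⟨⟨us, vs, mid⟩, rfl, rfl, hm, h⟩ := h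
  obtain rfl := List.eq_nil_of_length_eq_zero hm
  have h1 := h.core.Y_le_ML
  have h2 := h.core.Y_le
  simp only at h1 h2
  -- The path of two edges is laid starting from `v`, so that the middle label falls at `u`, where
  -- the prolongation then takes place.
  have h3 := h.swap.mid2 rfl
  have h4 := h3.swap
  have := Realizes.extMidHigh (S := (Summary.mid2
    ⟨Y, t, m, ML, N, MH, 1, c, x, dv, hv, zv, fv, du, hu, zu, fu⟩).swap) h4 rfl
    (by simp only [Summary.mid2, Summary.swap, Summary.ins] at *; omega)
    (by simp only [Summary.mid2, Summary.swap, Summary.ins] at *; omega)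
    (by simp only [Summary.mid2, Summary.swap, Summary.ins] at *; omega) k
  refine this.of_eq ?_ ?_ (by simp) ?_
  · simp [Function.comp_def]
  · simp [Function.comp_def]
  · simp only [Summary.mid2, Summary.swap, Summary.ins]
    congr 1 <;> first | ring1 | (apply Nat.sub_eq_of_eq_add; ring1)

theorem midEvenTopU
    (h : Realizes A B 0 ⟨Y, t, m, ML, N, MH, 1, c, x, du, hu, zu, fu, dv, hv, zv, fv⟩)
    (k : ℕ) (hML : ML + c < Y + t + 2) (hN : x = 1 → Y + t < N) : Realizes A B (2 * k + 2)
      ⟨Y + k, t + 2 * k + 1, m + 2 * k + 2, ML + 3 * k + 1 + c, Y + t + 3 + 4 * k,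
        max (MH + x * 3) (Y + t + 3) + 4 * k, 1, c, 1, du + 1, hu + 1, zu,
        fu + k * du + (k + 1) * hu + zu + Y + k + 1,
        dv + 1, hv + 1, zv + 1, fv + k * dv + (k + 1) * hv + zv + t + 2 * k + 2⟩ := by
  obtain ⟨⟨us, vs, mid⟩, rfl, rfl, hm, h⟩ := h
  obtain rfl := List.eq_nil_of_length_eq_zero hm
  have h1 := h.core.Y_le_ML
  have h2 := h.core.Y_le
  simp only at h1 h2
  have := Realizes.extMidHigh (S := Summary.mid2top
    ⟨Y, t, m, ML, N, MH, 1, c, x, du, hu, zu, fu, dv, hv, zv, fv⟩) (h.mid2top hML hN) rfl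
    (by simp only [Summary.mid2top, Summary.ins] at *; omega)
    (by simp only [Summary.mid2top, Summary.ins] at *; omega)
    (by simp only [Summary.mid2top, Summary.ins] at *; omega) k
  refine this.of_eq ?_ ?_ (by simp) ?_
  · rw [map_length_map]
  · rw [map_length_map]
  · simp only [Summary.mid2top, Summary.ins]
    congr 1 <;> first | (ring_nf; done) | (apply Nat.sub_eq_of_eq_add; ring1)

theorem midOddTopU
    (h : Realizes A B 0 ⟨Y, t, m, ML, N, MH, 1, c, x, du, hu, zu, fu, dv, hv, zv, fv⟩)
    (k : ℕ) (hML : ML + c < Y + t + 2) (hN : x = 1 → Y + t < N) : Realizes A B (2 * k + 3)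
      ⟨Y + k + 1, t + 2 * k + 2, m + 2 * k + 3, ML + 3 * k + 3 + c, Y + t + 5 + 4 * k,
        max (MH + x * 5) (Y + t + 5) + 4 * k, 1, c, 1, du + 1, hu, zu,
        fu + (k + 1) * du + (k + 1) * hu + zu + 1,
        dv + 1, hv + 1, zv + 1, fv + (k + 1) * dv + (k + 1) * hv + zv + t + 2 * k + 3⟩ := by
  obtain ⟨⟨us, vs, mid⟩, rfl, rfl, hm, h⟩ := h
  obtain rfl := List.eq_nil_of_length_eq_zero hm
  have h1 := h.core.Y_le_ML
  have h2 := h.core.Y_le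
  simp only at h1 h2
  have := Realizes.extMidLow (h.mid3top rfl hML hN) rfl
    (by simp only [Summary.mid3top, Summary.ins] at *; omega)
    (by simp only [Summary.mid3top, Summary.ins] at *; omega)
    (by simp only [Summary.mid3top, Summary.ins] at *; omega) k
  refine this.of_eq ?_ ?_ (by simp) ?_
  · rw [map_length_map]
  · rw [map_length_map]
  · simp only [Summary.mid3top, Summary.ins]
    congr 1 <;> first | (ring_nf; done) | (apply Nat.sub_eq_of_eq_add; ring1)

theorem twoOne {g : ℕ}
    (h : Realizes A B p ⟨Y, t, m, ML, N, MH, g, c, x, du, hu, zu, fu, dv, hv, zv, fv⟩) :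
    Realizes (2 ::ₘ A) (1 ::ₘ B) p
      ⟨Y + 3, t + 3, m + 3, ML + 5, N + 6, MH + x * 6, 0, c, x, du + 1, hu, zu,
        fu + 2 * du + hu + 1, dv + 1, hv, zv, fv + 2 * dv + hv + 2⟩ := by
  obtain ⟨T, rfl, rfl, rfl, h⟩ := h
  have h1 := h.core.Y_le_ML
  refine Realizes.of_eq ⟨_, rfl, rfl, rfl, h.forget.twoOne rfl (by dsimp only at *; omega)⟩
    ?_ ?_ (by simp) ?_
  · simp [Function.comp_def]
  · simp [Function.comp_def]
  · simp only [Summary.twoOne, Summary.ins]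
    congr 1 <;> ring_nf

end Realizes

theorem realizes_zero : Realizes 0 0 0 ⟨0, 0, 0, 0, 0, 0, 1, 0, 0, 0, 0, 0, 0, 0, 0, 0, 0⟩ :=
  ⟨⟨[], [], []⟩, rfl, rfl, rfl, valid_zero⟩

end DoubleSpider

/-! ### The mirrored insertions, and single leaves without the condition on `g`. -/

namespace DoubleSpider.Realizes

variable {A B : Multiset ℕ} {p Y t m ML N MH c x du hu zu fu dv hv zv fv : ℕ}

theorem vOdd
    (h : Realizes A B p ⟨Y, t, m, ML, N, MH, 1, c, x, du, hu, zu, fu, dv, hv, zv, fv⟩)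
    (k : ℕ) :
    Realizes A ((2 * k + 1) ::ₘ B) p
      ⟨Y + k + 1, t + 2 * k + 1, m + 2 * k + 1, ML + 3 * k + 2, N + 4 * k + 2,
        MH + x * (4 * k + 2), 1, c, x, du, hu, zu, fu + (k + 1) * du + k * hu, dv + 1, hv, zv,
        fv + (k + 1) * dv + k * hv + k + 1⟩ :=
  (h.swap.uOdd k).swap

theorem vEven
    (h : Realizes A B p ⟨Y, t, m, ML, N, MH, 1, c, x, du, hu, zu, fu, dv, hv, zv, fv⟩)
    (k : ℕ) :
    Realizes A ((2 * k + 2) ::ₘ B) p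
      ⟨Y + k + 1, t + 2 * k + 2, m + 2 * k + 2, ML + 3 * k + 3, N + 4 * k + 4,
        MH + x * (4 * k + 4), 1, c, x, du, hu, zu, fu + (k + 1) * du + (k + 1) * hu, dv + 1,
        hv + 1, zv, fv + (k + 1) * dv + (k + 1) * hv + Y + 2 * k + 2⟩ :=
  (h.swap.uEven k).swap

theorem vTopOdd
    (h : Realizes A B p ⟨Y, t, m, ML, N, MH, 1, c, x, du, hu, zu, fu, dv, hv, zv, fv⟩)
    (k : ℕ) (hML : ML + c < Y + t + 2) (hN : x = 1 → Y + t < N) :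
    Realizes A ((2 * k + 3) ::ₘ B) p
      ⟨Y + k + 1, t + 2 * k + 2, m + 2 * k + 3, ML + 3 * k + 3 + c, Y + t + 5 + 4 * k,
        max (MH + x * 5) (Y + t + 5) + 4 * k, 1, c, 1, du, hu, zu,
        fu + (k + 1) * du + (k + 1) * hu + zu, dv + 1, hv + 1, zv + 1,
        fv + (k + 1) * dv + (k + 1) * hv + zv + t + 2 * k + 3⟩ :=
  (h.swap.uTopOdd k hML hN).swap

theorem vTopLeaf
    (h : Realizes A B p ⟨Y, t, m, ML, N, MH, 1, c, x, du, hu, zu, fu, dv, hv, zv, fv⟩) :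
    Realizes A (1 ::ₘ B) p
      ⟨Y + 1, t + 1, m + 1, ML + 1, N + 2, MH + x * 2, 1, c, x, du, hu, zu, fu + hu, dv + 1, hv,
        zv, fv + hv + Y + 1⟩ :=
  (h.swap.uTopLeaf).swap

theorem midHighV
    (h : Realizes A B 0 ⟨Y, t, m, ML, N, MH, 1, c, x, du, hu, zu, fu, dv, hv, zv, fv⟩)
    (k : ℕ) :
    Realizes A B (2 * k + 1)
      ⟨Y + k, t + 2 * k + 1, m + 2 * k + 1, ML + 3 * k + 1, N + 4 * k + 2, MH + x * (4 * k + 2),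
        1, c, x, du + 1, hu + 1, zu, fu + k * du + (k + 1) * hu + Y + 2 * k + 1, dv + 1, hv + 1,
        zv, fv + k * dv + (k + 1) * hv + Y + k + 1⟩ :=
  (h.swap.midHighU k).swap

theorem midEvenLowV
    (h : Realizes A B 0 ⟨Y, t, m, ML, N, MH, 1, c, x, du, hu, zu, fu, dv, hv, zv, fv⟩)
    (k : ℕ) :
    Realizes A B (2 * k + 2)
      ⟨Y + k + 1, t + 2 * k + 2, m + 2 * k + 2, ML + 3 * k + 3, N + 4 * k + 4,
        MH + x * (4 * k + 4), 1, c, x, du + 1, hu + 1, zu,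
        fu + (k + 1) * du + (k + 1) * hu + Y + 2 * k + 2, dv + 1, hv, zv,
        fv + (k + 1) * dv + (k + 1) * hv + 1⟩ :=
  (h.swap.midEvenLowU k).swap

theorem midEvenHighV
    (h : Realizes A B 0 ⟨Y, t, m, ML, N, MH, 1, c, x, du, hu, zu, fu, dv, hv, zv, fv⟩)
    (k : ℕ) :
    Realizes A B (2 * k + 2)
      ⟨Y + k + 1, t + 2 * k + 2, m + 2 * k + 2, ML + 3 * k + 3, N + 4 * k + 4,
        MH + x * (4 * k + 4), 1, c, x, du + 1, hu, zu, fu + (k + 1) * du + (k + 1) * hu + k + 1,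
        dv + 1, hv + 1, zv, fv + (k + 1) * dv + (k + 1) * hv + Y + k + 2⟩ :=
  (h.swap.midEvenHighU k).swap

theorem midEvenTopV
    (h : Realizes A B 0 ⟨Y, t, m, ML, N, MH, 1, c, x, du, hu, zu, fu, dv, hv, zv, fv⟩)
    (k : ℕ) (hML : ML + c < Y + t + 2) (hN : x = 1 → Y + t < N) :
    Realizes A B (2 * k + 2)
      ⟨Y + k, t + 2 * k + 1, m + 2 * k + 2, ML + 3 * k + 1 + c, Y + t + 3 + 4 * k,
        max (MH + x * 3) (Y + t + 3) + 4 * k, 1, c, 1, du + 1, hu + 1, zu + 1,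
        fu + k * du + (k + 1) * hu + zu + t + 2 * k + 2, dv + 1, hv + 1, zv,
        fv + k * dv + (k + 1) * hv + zv + Y + k + 1⟩ :=
  (h.swap.midEvenTopU k hML hN).swap

/-- A leg of one edge creates no pair, so nothing is asked of `g` and the insertion remains
available after `twoOne`. -/
theorem uOne {g : ℕ}
    (h : Realizes A B p ⟨Y, t, m, ML, N, MH, g, c, x, du, hu, zu, fu, dv, hv, zv, fv⟩) :
    Realizes (1 ::ₘ A) B p
      ⟨Y + 1, t + 1, m + 1, ML + 2, N + 2, MH + x * 2, g, c, x, du + 1, hu, zu, fu + du + 1,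
        dv, hv, zv, fv + dv⟩ := by
  obtain ⟨T, rfl, rfl, rfl, h⟩ := h
  refine Realizes.of_eq ⟨_, rfl, rfl, rfl, h.leg1⟩ ?_ ?_ (by simp) ?_
  · simp [Function.comp_def]
  · rw [map_length_map]
  · simp only [Summary.leg1, Summary.ins]
    congr 1 <;> ring_nf

theorem vOne {g : ℕ}
    (h : Realizes A B p ⟨Y, t, m, ML, N, MH, g, c, x, du, hu, zu, fu, dv, hv, zv, fv⟩) :
    Realizes A (1 ::ₘ B) p
      ⟨Y + 1, t + 1, m + 1, ML + 2, N + 2, MH + x * 2, g, c, x, du, hu, zu, fu + du,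
        dv + 1, hv, zv, fv + dv + 1⟩ :=
  h.swap.uOne.swap

end DoubleSpider.Realizes

/-! ### Invariants for the branch sums and the insertions that keep them. -/

namespace DoubleSpider

/-- The vertex sums of the branch vertices dominate all others, and that of `v` dominates that
of `u`, in a way that survives the relabellings below. -/
def Weak (S : Summary) : Prop :=
  3 ≤ S.du ∧ S.du ≤ S.dv ∧ S.du + S.hu ≤ S.dv + S.hv ∧
    S.Y < S.fu ∧ S.ML < S.fu ∧ S.MH < S.fu ∧ S.fu < S.fv

/-- Lengthening a leg by two edges raises `ML` by 3, `MH` by 4 if there are heavy pairs, and `fu` by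
`du + hu`. As `du ≥ 3`, the condition `1 ≤ hu` is what keeps `fu` ahead of heavy pairs. -/
def Good (S : Summary) : Prop := S.g = 1 ∧ (S.x = 1 → 1 ≤ S.hu) ∧ Weak S

/-- Vertices of degree two with one large label are separated from those with two. -/
def Separated (S : Summary) : Prop :=
  Good S ∧ 1 ≤ S.hu ∧ S.ML ≤ S.Y + S.t ∧ (S.x = 1 → S.Y + S.t < S.N) ∧ S.zu ≤ S.zv ∧
    2 * S.hu + S.zu ≤ 2 * S.hv + S.zv + 1 ∧ S.Y + S.t + 2 ≤ S.fu ∧ 1 ≤ S.Y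

def HasWeak (A B : Multiset ℕ) (p : ℕ) : Prop := ∃ S, Realizes A B p S ∧ Weak S

def HasGood (A B : Multiset ℕ) (p : ℕ) : Prop := ∃ S, Realizes A B p S ∧ Good S

def HasSeparated (A B : Multiset ℕ) (p : ℕ) : Prop := ∃ S, Realizes A B p S ∧ Separated S

/-- Only light labels lie above `t` at vertices of degree two with a low label. -/
def HasStrict (A B : Multiset ℕ) (p : ℕ) : Prop :=
  ∃ S, Realizes A B p S ∧ Separated S ∧ S.c = 0 ∧ 2 ≤ S.hu

variable {A B : Multiset ℕ} {p : ℕ}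

theorem HasGood.weak (h : HasGood A B p) : HasWeak A B p := by
  obtain ⟨S, h1, h2⟩ := h
  exact ⟨S, h1, h2.2.2⟩

theorem HasSeparated.good (h : HasSeparated A B p) : HasGood A B p := by
  obtain ⟨S, h1, h2⟩ := h
  exact ⟨S, h1, h2.1⟩

theorem HasStrict.separated (h : HasStrict A B p) : HasSeparated A B p := by
  obtain ⟨S, h1, h2⟩ := h
  exact ⟨S, h1, h2.1⟩

theorem Realizes.x_le {S : Summary} (h : Realizes A B p S) : S.x ≤ 1 := by
  obtain ⟨T, -, -, -, h⟩ := h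
  exact h.core.x_le

theorem Realizes.Y_le {S : Summary} (h : Realizes A B p S) : S.Y ≤ S.t := by
  obtain ⟨T, -, -, -, h⟩ := h
  exact h.core.Y_le

/-- The leg contributes to both branch sums through the shifts; `du ≤ dv` and `du + hu ≤ dv + hv`
give `v` the larger share, and `v` also receives the new label. -/
theorem HasGood.vOdd (h : HasGood A B p) (k : ℕ) : HasGood A ((2 * k + 1) ::ₘ B) p := by
  obtain ⟨⟨Y, t, m, ML, N, MH, g, c, x, du, hu, zu, fu, dv, hv, zv, fv⟩, h,
    rfl, h1, h2, h3, h4, h5, h6, h7, h8⟩ := h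
  have hx := Nat.le_one_iff_eq_zero_or_eq_one.1 h.x_le
  dsimp only at *
  have e1 : k * 3 ≤ k * du := Nat.mul_le_mul_left k h2
  have e2 := Nat.zero_le (k * hu)
  have e3 : k * (du + hu) ≤ k * (dv + hv) := Nat.mul_le_mul_left k h4
  have e4 : x * (4 * k + 2) ≤ (k + 1) * du + k * hu := by
    rcases hx with rfl | rfl
    · simp
    · have := Nat.mul_le_mul_left k (h1 rfl)
      have := h1 rfl
      linarith
  refine ⟨_, h.vOdd k, rfl, h1, ?_, ?_, ?_, ?_, ?_, ?_, ?_⟩ <;> dsimp only <;> linarith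

theorem HasGood.vEven (h : HasGood A B p) (k : ℕ) : HasGood A ((2 * k + 2) ::ₘ B) p := by
  obtain ⟨⟨Y, t, m, ML, N, MH, g, c, x, du, hu, zu, fu, dv, hv, zv, fv⟩, h,
    rfl, h1, h2, h3, h4, h5, h6, h7, h8⟩ := h
  have hx := Nat.le_one_iff_eq_zero_or_eq_one.1 h.x_le
  dsimp only at *
  have e1 : k * 3 ≤ k * du := Nat.mul_le_mul_left k h2
  have e2 := Nat.zero_le (k * hu)
  have e3 : k * (du + hu) ≤ k * (dv + hv) := Nat.mul_le_mul_left k h4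
  have e4 : x * (4 * k + 4) ≤ (k + 1) * du + (k + 1) * hu := by
    rcases hx with rfl | rfl
    · simp
    · have := Nat.mul_le_mul_left k (h1 rfl)
      have := h1 rfl
      linarith
  refine ⟨_, h.vEven k, rfl, h1, ?_, ?_, ?_, ?_, ?_, ?_, ?_⟩ <;> dsimp only <;> linarith

theorem HasGood.odd_odd (h : HasGood A B p) (k j : ℕ) :
    HasGood ((2 * k + 1) ::ₘ A) ((2 * j + 1) ::ₘ B) p := by
  obtain ⟨⟨Y, t, m, ML, N, MH, g, c, x, du, hu, zu, fu, dv, hv, zv, fv⟩, h,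
    rfl, h1, h2, h3, h4, h5, h6, h7, h8⟩ := h
  have hx := Nat.le_one_iff_eq_zero_or_eq_one.1 h.x_le
  dsimp only at *
  have e1 : k * 3 ≤ k * du := Nat.mul_le_mul_left k h2
  have e2 := Nat.zero_le (k * hu)
  have e3 : k * (du + hu) ≤ k * (dv + hv) := Nat.mul_le_mul_left k h4
  have e5 : j * 3 ≤ j * du := Nat.mul_le_mul_left j h2
  have e6 := Nat.zero_le (j * hu)
  have e7 : j * (du + hu) ≤ j * (dv + hv) := Nat.mul_le_mul_left j h4
  have e4 : x * (4 * k + 2) ≤ (k + 1) * du + k * hu := by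
    rcases hx with rfl | rfl
    · simp
    · have := Nat.mul_le_mul_left k (h1 rfl)
      have := h1 rfl
      linarith
  have e8 : x * (4 * j + 2) ≤ (j + 1) * du + j * hu := by
    rcases hx with rfl | rfl
    · simp
    · have := Nat.mul_le_mul_left j (h1 rfl)
      have := h1 rfl
      linarith
  -- The leg at `v` comes first: its label at `v` is then raised by `k + 1` during the insertion at
  -- `u`, which makes up for the label `k + 1` that `u` receives.
  refine ⟨_, (h.vOdd j).uOdd k, rfl, h1, ?_, ?_, ?_, ?_, ?_, ?_, ?_⟩ <;> dsimp only <;> linarith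

theorem HasGood.odd_even (h : HasGood A B p) (k j : ℕ) :
    HasGood ((2 * k + 1) ::ₘ A) ((2 * j + 2) ::ₘ B) p := by
  obtain ⟨⟨Y, t, m, ML, N, MH, g, c, x, du, hu, zu, fu, dv, hv, zv, fv⟩, h,
    rfl, h1, h2, h3, h4, h5, h6, h7, h8⟩ := h
  have hx := Nat.le_one_iff_eq_zero_or_eq_one.1 h.x_le
  dsimp only at *
  have e1 : k * 3 ≤ k * du := Nat.mul_le_mul_left k h2
  have e2 := Nat.zero_le (k * hu)
  have e3 : k * (du + hu) ≤ k * (dv + hv) := Nat.mul_le_mul_left k h4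
  have e5 : j * 3 ≤ j * du := Nat.mul_le_mul_left j h2
  have e6 := Nat.zero_le (j * hu)
  have e7 : j * (du + hu) ≤ j * (dv + hv) := Nat.mul_le_mul_left j h4
  have e4 : x * (4 * k + 2) ≤ (k + 1) * du + k * hu := by
    rcases hx with rfl | rfl
    · simp
    · have := Nat.mul_le_mul_left k (h1 rfl)
      have := h1 rfl
      linarith
  have e8 : x * (4 * j + 4) ≤ (j + 1) * du + (j + 1) * hu := by
    rcases hx with rfl | rfl
    · simp
    · have := Nat.mul_le_mul_left j (h1 rfl)
      have := h1 rfl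
      linarith
  refine ⟨_, (h.vEven j).uOdd k, rfl, h1, ?_, ?_, ?_, ?_, ?_, ?_, ?_⟩ <;> dsimp only <;> linarith

theorem HasGood.even_even (h : HasGood A B p) (k j : ℕ) :
    HasGood ((2 * k + 2) ::ₘ A) ((2 * j + 2) ::ₘ B) p := by
  obtain ⟨⟨Y, t, m, ML, N, MH, g, c, x, du, hu, zu, fu, dv, hv, zv, fv⟩, h,
    rfl, h1, h2, h3, h4, h5, h6, h7, h8⟩ := h
  have hx := Nat.le_one_iff_eq_zero_or_eq_one.1 h.x_le
  dsimp only at *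
  have e1 : k * 3 ≤ k * du := Nat.mul_le_mul_left k h2
  have e2 := Nat.zero_le (k * hu)
  have e3 : k * (du + hu) ≤ k * (dv + hv) := Nat.mul_le_mul_left k h4
  have e5 : j * 3 ≤ j * du := Nat.mul_le_mul_left j h2
  have e6 := Nat.zero_le (j * hu)
  have e7 : j * (du + hu) ≤ j * (dv + hv) := Nat.mul_le_mul_left j h4
  have e4 : x * (4 * k + 4) ≤ (k + 1) * du + (k + 1) * hu := by
    rcases hx with rfl | rfl
    · simp
    · have := Nat.mul_le_mul_left k (h1 rfl)
      have := h1 rfl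
      linarith
  have e8 : x * (4 * j + 4) ≤ (j + 1) * du + (j + 1) * hu := by
    rcases hx with rfl | rfl
    · simp
    · have := Nat.mul_le_mul_left j (h1 rfl)
      have := h1 rfl
      linarith
  -- Apart from the common terms, `v` gains `Y + 2j + 2` and then `2(k + 1)` from the second
  -- insertion, while `u` gains only `Y + j + 1 + 2k + 2`.
  refine ⟨_, (h.vEven j).uEven k, rfl, fun _ => ?_, ?_, ?_, ?_, ?_, ?_, ?_, ?_⟩ <;> dsimp only <;>
    linarith

/-- The even leg gives `u` a middle label, so the odd leg at `v` must give a top one. Here `ML`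
grows by `3j + 3k + 6 + c` and `Y + t` by `3j + 3k + 6`: `c = 0` is what preserves `ML ≤ Y + t`. -/
theorem HasStrict.even_odd (h : HasStrict A B p) (k j : ℕ) :
    HasStrict ((2 * k + 2) ::ₘ A) ((2 * j + 3) ::ₘ B) p := by
  obtain ⟨⟨Y, t, m, ML, N, MH, g, c, x, du, hu, zu, fu, dv, hv, zv, fv⟩, h,
    ⟨⟨rfl, -, h2, h3, h4, h5, h6, h7, h8⟩, h1, h9, h10, h11, h12, h13, h14⟩, rfl, h15⟩ := h
  have hx := h.x_le
  have hY := h.Y_le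
  dsimp only at *
  have e1 : k * 3 ≤ k * du := Nat.mul_le_mul_left k h2
  have e2 : k * 1 ≤ k * hu := Nat.mul_le_mul_left k h1
  have e3 : k * (du + hu) ≤ k * (dv + hv) := Nat.mul_le_mul_left k h4
  have e5 : j * 3 ≤ j * du := Nat.mul_le_mul_left j h2
  have e6 : j * 1 ≤ j * hu := Nat.mul_le_mul_left j h1
  have e7 : j * (du + hu) ≤ j * (dv + hv) := Nat.mul_le_mul_left j h4
  have hmax : max (MH + x * 5) (Y + t + 5) ≤ fu + 4 := max_le (by omega) (by omega)
  refine ⟨_, (h.vTopOdd j (by omega) h10).uEven k, ⟨⟨rfl, fun _ => ?_, ?_, ?_, ?_, ?_, ?_, ?_, ?_⟩,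
    ?_, ?_, fun _ => ?_, ?_, ?_, ?_, ?_⟩, rfl, ?_⟩ <;> dsimp only <;> linarith

/-- The leg at `u` is arranged to hand over the low label `Y + k + 2`, and the leaf at `v` takes the
next value. The remaining shifts contribute `(k + 1)(du + hu) + 2hu + zu` to `u` and the same
expression at `v`, which explains the condition `2 * S.hu + S.zu ≤ 2 * S.hv + S.zv + 1` in
`Separated`: the surplus label pays for the `+ 1`. -/
theorem HasSeparated.even_one (h : HasSeparated A B p) (k : ℕ) :
    HasSeparated ((2 * k + 4) ::ₘ A) (1 ::ₘ B) p := by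
  obtain ⟨⟨Y, t, m, ML, N, MH, g, c, x, du, hu, zu, fu, dv, hv, zv, fv⟩, h,
    ⟨rfl, -, h2, h3, h4, h5, h6, h7, h8⟩, h1, h9, h10, h11, h12, h13, h14⟩ := h
  have hx := h.x_le
  dsimp only at *
  have e1 : k * 3 ≤ k * du := Nat.mul_le_mul_left k h2
  have e2 : k * 1 ≤ k * hu := Nat.mul_le_mul_left k h1
  have e3 : k * (du + hu) ≤ k * (dv + hv) := Nat.mul_le_mul_left k h4
  have hmax : max (MH + x * 7) (Y + t + 7) ≤ fu + 6 := max_le (by omega) (by omega)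
  refine ⟨_, (h.uTopEven k h9 h10).vTopLeaf, ⟨rfl, fun _ => ?_, ?_, ?_, ?_, ?_, ?_, ?_, ?_⟩,
    ?_, ?_, fun _ => ?_, ?_, ?_, ?_, ?_⟩ <;> dsimp only <;> linarith

/-- The new labels are `1` at `u` and `2` at `v`, and the shifts add `2du + hu` against `2dv + hv`;
the two degree conditions of `Weak` together compare these. -/
theorem HasWeak.two_one (h : HasWeak A B p) : HasWeak (2 ::ₘ A) (1 ::ₘ B) p := by
  obtain ⟨⟨Y, t, m, ML, N, MH, g, c, x, du, hu, zu, fu, dv, hv, zv, fv⟩, h,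
    h2, h3, h4, h5, h6, h7, h8⟩ := h
  have hx := h.x_le
  dsimp only at *
  refine ⟨_, h.twoOne, ?_, ?_, ?_, ?_, ?_, ?_, ?_⟩ <;> dsimp only <;> linarith

theorem HasWeak.one (h : HasWeak A B p) : HasWeak A (1 ::ₘ B) p := by
  obtain ⟨⟨Y, t, m, ML, N, MH, g, c, x, du, hu, zu, fu, dv, hv, zv, fv⟩, h,
    h2, h3, h4, h5, h6, h7, h8⟩ := h
  have hx := h.x_le
  dsimp only at *
  refine ⟨_, h.vOne, ?_, ?_, ?_, ?_, ?_, ?_, ?_⟩ <;> dsimp only <;> linarith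

end DoubleSpider

/-! ### Base cases: explicit orders of insertion. -/

namespace DoubleSpider

/-- Serves to play several candidate labellings against each other. If none meets the target, each
violates one of the three inequalities, and in the applications these violations contradict one
another. -/
theorem Realizes.not_dominates {A B : Multiset ℕ} {p : ℕ} {S : Summary} {P : Summary → Prop}
    (r : Realizes A B p S) (hn : ¬ ∃ S, Realizes A B p S ∧ P S)
    (h : S.ML < S.fu ∧ S.MH < S.fu ∧ S.fu < S.fv → P S) :
    ¬ (S.ML < S.fu ∧ S.MH < S.fu ∧ S.fu < S.fv) :=
  fun hlt => hn ⟨S, r, h hlt⟩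

/-- Two uses of `vOdd 0` give the same labels but the cruder bound `ML = 4`. Without any pair, `ML`
may be as small as `Y`, and some base cases need this. -/
theorem realizes_one_one :
    Realizes 0 {1, 1} 0 ⟨2, 2, 2, 2, 0, 0, 1, 0, 0, 0, 0, 0, 0, 2, 0, 0, 3⟩ := by
  refine ⟨⟨[], [[1], [2]], []⟩, rfl, rfl, rfl, le_rfl, ?_, ?_⟩
  · simp [IsLabels, Spider.edges]
  · refine ⟨le_rfl, le_rfl, Nat.zero_le _, Nat.zero_le _, le_rfl, ?_, ?_, ?_, ?_, ?_⟩ <;>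
      simp [Spider.leaves, Spider.pairs, Spider.atU, Spider.atV, Stats]

theorem realizes_one_one_one :
    Realizes {1, 1} {1} 0 ⟨3, 3, 3, 3, 0, 0, 1, 0, 0, 2, 0, 0, 5, 1, 0, 0, 1⟩ := by
  refine ⟨⟨[[2], [3]], [[1]], []⟩, rfl, rfl, rfl, le_rfl, ?_, ?_⟩
  · simp [IsLabels, Spider.edges]
  · refine ⟨le_rfl, le_rfl, Nat.zero_le _, Nat.zero_le _, le_rfl, ?_, ?_, ?_, ?_, ?_⟩ <;>
      simp [Spider.leaves, Spider.pairs, Spider.atU, Spider.atV, Stats]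

/-- In these names `o` and `e` are the parities of the legs at `u` and at `v`, a digit is a leg
length, and the last word concerns the path. Labels placed early are raised by all later insertions,
so the order of insertion decides how the branch sums compare. -/
theorem hasGood_oo_ee_odd (a b c d q : ℕ) (hab : a ≤ b) (hcd : c ≤ d) :
    HasGood {2 * b + 1, 2 * a + 1} {2 * d + 2, 2 * c + 2} (2 * q + 1) :=
  ⟨_, ((((realizes_zero.uOdd a).vEven c).midHighV q).uOdd b).vEven d,
    by simp only [Good, Weak, true_and, zero_ne_one, false_implies]; omega⟩

theorem hasGood_oo_ee_even (a b c d q : ℕ) (hab : a ≤ b) (hcd : c ≤ d) :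
    HasGood {2 * b + 1, 2 * a + 1} {2 * d + 2, 2 * c + 2} (2 * q + 2) :=
  ⟨_, ((((realizes_zero.uOdd a).vEven c).midEvenLowV q).uOdd b).vEven d,
    by simp only [Good, Weak, true_and, zero_ne_one, false_implies]; omega⟩

theorem hasGood_oe_ee_odd (a b c d q : ℕ) (hcd : c ≤ d) :
    HasGood {2 * b + 2, 2 * a + 1} {2 * d + 2, 2 * c + 2} (2 * q + 1) :=
  ⟨_, ((((realizes_zero.uOdd a).vEven c).uEven b).vEven d).midHighU q,
    by simp only [Good, Weak, true_and, zero_ne_one, false_implies]; omega⟩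

theorem hasGood_oe_ee_even (a b c d q : ℕ) (hcd : c ≤ d) :
    HasGood {2 * b + 2, 2 * a + 1} {2 * d + 2, 2 * c + 2} (2 * q + 2) :=
  ⟨_, ((((realizes_zero.vEven c).midEvenLowV q).uOdd a).vEven d).uEven b,
    by simp only [Good, Weak, true_and, zero_ne_one, false_implies]; omega⟩

theorem hasGood_ee_ee_odd (a b c d q : ℕ) (hab : a ≤ b) (hcd : c ≤ d) :
    HasGood {2 * b + 2, 2 * a + 2} {2 * d + 2, 2 * c + 2} (2 * q + 1) :=
  ⟨_, ((((realizes_zero.vEven c).uEven a).midLowU q).vEven d).uEven b,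
    by simp only [Good, Weak, true_and, zero_ne_one, false_implies]; omega⟩

theorem hasGood_ee_ee_even (a b c d q : ℕ) (hab : a ≤ b) (hcd : c ≤ d) :
    HasGood {2 * b + 2, 2 * a + 2} {2 * d + 2, 2 * c + 2} (2 * q + 2) :=
  ⟨_, ((((realizes_zero.uEven a).vEven c).uEven b).vEven d).midEvenLowU q,
    by simp only [Good, Weak, true_and, zero_ne_one, false_implies]; omega⟩

theorem hasGood_11_oe_odd (c d q : ℕ) :
    HasGood {1, 1} {2 * d + 2, 2 * c + 1} (2 * q + 1) :=
  ⟨_, ((((realizes_zero.uOdd 0).uOdd 0).vOdd c).vEven d).midHighU q,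
    by simp only [Good, Weak, true_and, zero_ne_one, false_implies]; omega⟩

/-- One candidate makes the longer form of leg at `u` carry a top label, the other leaves it low.
For any given lengths one of the two dominates. -/
theorem hasGood_oo_oe_odd (a b c d q : ℕ) :
    HasGood {2 * b + 3, 2 * a + 1} {2 * d + 2, 2 * c + 1} (2 * q + 1) := by
  by_contra hn
  have g1 := Realizes.not_dominates (P := Good) (((((realizes_zero.vOdd c).vEven d).uOdd
    a).uTopOdd b (by omega) (by omega)).midHighU q) hn fun hlt => by
    dsimp only at hlt
    simp only [Good, Weak, true_and, true_implies]
    omega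
  have g2 := Realizes.not_dominates (P := Good) (((((realizes_zero.uOdd a).uOdd (b + 1)).vOdd
    c).vEven d).midHighU q) hn fun hlt => by
    dsimp only at hlt
    simp only [Good, Weak, true_and, zero_ne_one, false_implies]
    omega
  dsimp only at g1 g2
  omega

theorem hasGood_oo_oe_even (a b c d q : ℕ) (hab : a ≤ b + 1) :
    HasGood {2 * b + 3, 2 * a + 1} {2 * d + 2, 2 * c + 1} (2 * q + 2) := by
  by_contra hn
  have g1 := Realizes.not_dominates (P := Good) (((((realizes_zero.uOdd a).vOdd c).vEven
    d).midEvenLowU q).uTopOdd b (by omega) (by omega)) hn fun hlt => by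
    dsimp only at hlt
    simp only [Good, Weak, true_and, true_implies]
    omega
  have g2 := Realizes.not_dominates (P := Good) (((((realizes_zero.uOdd a).vOdd c).uOdd (b +
    1)).vEven d).midEvenTopV q (by omega) (by omega)) hn fun hlt => by
    dsimp only at hlt
    simp only [Good, Weak, true_and, true_implies]
    omega
  dsimp only at g1 g2
  omega

theorem hasGood_oe_oe_odd (a b c d q : ℕ) :
    HasGood {2 * b + 2, 2 * a + 1} {2 * d + 2, 2 * c + 1} (2 * q + 1) := by
  by_contra hn
  have g1 := Realizes.not_dominates (P := Good) ((((((realizes_zero.midHighU q).vEven d).uOdd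
    a).vOdd c).uEven b).of_eq rfl (Multiset.cons_swap _ _ _) rfl rfl) hn fun hlt => by
    dsimp only at hlt
    simp only [Good, Weak, true_and, zero_ne_one, false_implies]
    omega
  have g2 := Realizes.not_dominates (P := Good) (((((realizes_zero.vOdd c).uOdd a).vEven d).uEven
    b).midHighU q) hn fun hlt => by
    dsimp only at hlt
    simp only [Good, Weak, true_and, zero_ne_one, false_implies]
    omega
  dsimp only at g1 g2
  omega

theorem hasGood_oe_oe_even (a b c d q : ℕ) :
    HasGood {2 * b + 2, 2 * a + 1} {2 * d + 2, 2 * c + 1} (2 * q + 2) :=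
  ⟨_, ((((realizes_zero.uOdd a).vOdd c).uEven b).vEven d).midEvenTopU q (by omega) (by omega),
    by simp only [Good, Weak, true_and, true_implies]; omega⟩

theorem hasGood_oo_ooo_odd (a b c d e q : ℕ) (hab : a ≤ b) (hcd : c ≤ d) (hde : d ≤ e + 1) :
    HasGood {2 * b + 1, 2 * a + 1} {2 * e + 3, 2 * d + 1, 2 * c + 1} (2 * q + 1) := by
  by_contra hn
  have g1 := Realizes.not_dominates (P := Good) ((((((realizes_zero.uOdd a).vOdd c).midHighV
    q).uOdd b).vOdd d).vTopOdd e (by omega) (by omega)) hn fun hlt => by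
    dsimp only at hlt
    simp only [Good, Weak, true_and, true_implies]
    omega
  have g2 := Realizes.not_dominates (P := Good) ((((((realizes_zero.uOdd a).vOdd c).vOdd d).vOdd
    (e + 1)).midHighV q).uOdd b) hn fun hlt => by
    dsimp only at hlt
    simp only [Good, Weak, true_and, zero_ne_one, false_implies]
    omega
  dsimp only at g1 g2
  omega

theorem hasGood_oo_ooo_even (a b c d e q : ℕ) (hab : a ≤ b) (hcd : c ≤ d) (hde : d ≤ e + 1) :
    HasGood {2 * b + 1, 2 * a + 1} {2 * e + 3, 2 * d + 1, 2 * c + 1} (2 * q + 2) := by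
  by_contra hn
  have g1 := Realizes.not_dominates (P := Good) ((((((realizes_zero.uOdd a).vOdd c).midEvenLowV
    q).uOdd b).vOdd d).vTopOdd e (by omega) (by omega)) hn fun hlt => by
    dsimp only at hlt
    simp only [Good, Weak, true_and, true_implies]
    omega
  have g2 := Realizes.not_dominates (P := Good) ((((((realizes_zero.vOdd c).vOdd d).uOdd a).vOdd
    (e + 1)).midEvenLowV q).uOdd b) hn fun hlt => by
    dsimp only at hlt
    simp only [Good, Weak, true_and, zero_ne_one, false_implies]
    omega
  dsimp only at g1 g2
  omega

theorem hasGood_oe_ooo_odd (a b c d e q : ℕ) (hcd : c ≤ d) :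
    HasGood {2 * b + 2, 2 * a + 1} {2 * e + 3, 2 * d + 1, 2 * c + 1} (2 * q + 1) := by
  by_contra hn
  have g1 := Realizes.not_dominates (P := Good) ((((((realizes_zero.uOdd a).vOdd c).uEven b).vOdd
    d).vTopOdd e (by omega) (by omega)).midHighU q) hn fun hlt => by
    dsimp only at hlt
    simp only [Good, Weak, true_and, true_implies]
    omega
  have g2 := Realizes.not_dominates (P := Good) ((((((realizes_zero.vOdd c).vOdd d).uOdd a).vOdd
    (e + 1)).uEven b).midHighU q) hn fun hlt => by
    dsimp only at hlt
    simp only [Good, Weak, true_and, zero_ne_one, false_implies]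
    omega
  dsimp only at g1 g2
  omega

theorem hasGood_oe_ooo_even (a b c d e q : ℕ) (hcd : c ≤ d) (hde : d ≤ e) :
    HasGood {2 * b + 2, 2 * a + 1} {2 * e + 1, 2 * d + 1, 2 * c + 1} (2 * q + 2) :=
  ⟨_, ((((((realizes_zero.vOdd c).uEven b).vOdd d).uOdd a).vOdd e).midEvenTopU q (by omega) (by
    omega)).of_eq (Multiset.cons_swap _ _ _) rfl rfl rfl,
    by simp only [Good, Weak, true_and, true_implies]; omega⟩

theorem hasGood_oo_111_odd (a b q : ℕ) (hab : a ≤ b) :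
    HasGood {2 * b + 1, 2 * a + 1} {1, 1, 1} (2 * q + 1) :=
  ⟨_, (((((realizes_zero.uOdd a).vOdd 0).vOdd 0).vOdd 0).midHighV q).uOdd b,
    by simp only [Good, Weak, true_and, zero_ne_one, false_implies]; omega⟩

theorem hasGood_oo_111_even (a b q : ℕ) (hab : a ≤ b) :
    HasGood {2 * b + 1, 2 * a + 1} {1, 1, 1} (2 * q + 2) :=
  ⟨_, (((realizes_one_one.uOdd a).vOdd 0).midEvenLowV q).uOdd b,
    by simp only [Good, Weak, true_and, zero_ne_one, false_implies]; omega⟩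

theorem hasGood_oe_111_odd (a b q : ℕ) :
    HasGood {2 * b + 2, 2 * a + 1} {1, 1, 1} (2 * q + 1) :=
  ⟨_, (((((realizes_zero.vOdd 0).vOdd 0).uOdd a).vOdd 0).uEven b).midHighU q,
    by simp only [Good, Weak, true_and, zero_ne_one, false_implies]; omega⟩

theorem hasGood_11_oe_even (c d q : ℕ) :
    HasGood {1, 1} {2 * d + 2, 2 * c + 1} (2 * q + 2) :=
  ⟨_, ((((realizes_zero.uOdd 0).vOdd c).uOdd 0).vEven d).midEvenTopV q (by omega) (by omega),
    by simp only [Good, Weak, true_and, true_implies]; omega⟩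

theorem hasGood_ee_ooe_odd (a b c d e q : ℕ) (hcd : c ≤ d) :
    HasGood {2 * b + 2, 2 * a + 2} {2 * e + 2, 2 * d + 1, 2 * c + 1} (2 * q + 1) :=
  ⟨_, (((((realizes_zero.vOdd c).vOdd d).uEven a).vEven e).uEven b).midHighU q,
    by simp only [Good, Weak, true_and, zero_ne_one, false_implies]; omega⟩

theorem hasGood_ee_ooe_even (a b c d e q : ℕ) (hab : a ≤ b) (hcd : c ≤ d) :
    HasGood {2 * b + 2, 2 * a + 2} {2 * e + 2, 2 * d + 1, 2 * c + 1} (2 * q + 2) :=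
  ⟨_, (((((realizes_zero.uEven a).vOdd c).vOdd d).vEven e).uEven b).midEvenLowU q,
    by simp only [Good, Weak, true_and, zero_ne_one, false_implies]; omega⟩

theorem hasStrict_ee_ooo_of_three_le (a b c d e q : ℕ) (hab : a ≤ b) (hcd : c ≤ d) :
    HasStrict {2 * b + 2, 2 * a + 2} {2 * e + 1, 2 * d + 1, 2 * c + 1} (2 * q + 3) :=
  ⟨_, (((((realizes_zero.uEven a).vOdd c).vOdd d).vOdd e).uEven b).midOddTopU q (by omega) (by
    omega),
    by simp only [Separated, Good, Weak, true_and, true_implies]; omega⟩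

theorem hasStrict_ee_ooo_one (a b c d e : ℕ) (hab : a ≤ b) (hcd : c ≤ d) (hde : d ≤ e + 1) :
    HasStrict {2 * b + 2, 2 * a + 2} {2 * e + 3, 2 * d + 1, 2 * c + 1} 1 := by
  by_contra hn
  have g1 := Realizes.not_dominates (P := fun S => Separated S ∧ S.c = 0 ∧ 2 ≤ S.hu)
    ((((((realizes_zero.vOdd c).uEven a).vOdd d).uEven b).midLowU 0).vTopOdd e (by omega) (by
    omega)) hn fun hlt => by
    dsimp only at hlt
    simp only [Separated, Good, Weak, true_and, true_implies]
    omega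
  have g2 := Realizes.not_dominates (P := fun S => Separated S ∧ S.c = 0 ∧ 2 ≤ S.hu)
    ((((((realizes_zero.uEven a).vOdd c).vOdd d).uEven b).vTopOdd e (by omega) (by
    omega)).midLowU 0) hn fun hlt => by
    dsimp only at hlt
    simp only [Separated, Good, Weak, true_and, true_implies]
    omega
  dsimp only at g1 g2
  omega

theorem hasStrict_ee_ooo_even (a b c d e q : ℕ) (hab : a ≤ b) (hcd : c ≤ d) :
    HasStrict {2 * b + 2, 2 * a + 2} {2 * e + 3, 2 * d + 1, 2 * c + 1} (2 * q + 2) :=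
  ⟨_, (((((realizes_zero.uEven a).vOdd c).uEven b).vOdd d).vTopOdd e (by omega) (by
    omega)).midEvenLowU q,
    by simp only [Separated, Good, Weak, true_and, true_implies]; omega⟩

theorem hasGood_ee_111_even (a b q : ℕ) (hab : a ≤ b) :
    HasGood {2 * b + 2, 2 * a + 2} {1, 1, 1} (2 * q + 2) :=
  ⟨_, (((((realizes_zero.vOdd 0).vOdd 0).uEven a).vOdd 0).uEven b).midEvenLowU q,
    by simp only [Good, Weak, true_and, zero_ne_one, false_implies]; omega⟩

theorem hasGood_ef_111_one (a b : ℕ) (hab : a ≤ b + 1) :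
    HasGood {2 * b + 4, 2 * a + 2} {1, 1, 1} 1 :=
  ⟨_, ((((((realizes_zero.vOdd 0).vOdd 0).midHighU 0).uTopEven b (by omega) (by omega)).uEven
    a).vTopLeaf).of_eq (Multiset.cons_swap _ _ _) rfl rfl rfl,
    by simp only [Good, Weak, true_and, true_implies]; omega⟩

theorem hasSeparated_ff_111_one (a b : ℕ) (hab : a ≤ b) :
    HasSeparated {2 * b + 4, 2 * a + 4} {1, 1, 1} 1 :=
  ⟨_, (((((realizes_zero.vOdd 0).midTop).uTopEven a (by omega) (by omega)).vTopLeaf).uTopEven b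
    (by omega) (by omega)).vTopLeaf,
    by simp only [Separated, Good, Weak, true_and, true_implies]; omega⟩

theorem hasSeparated_ff_111_even (a b q : ℕ) (hab : a ≤ b) :
    HasSeparated {2 * b + 4, 2 * a + 4} {1, 1, 1} (2 * q + 2) :=
  ⟨_, (((((realizes_zero.vOdd 0).midEvenHighV q).uEven (a + 1)).uTopEven b (by omega) (by
    omega)).vOdd 0).vTopLeaf,
    by simp only [Separated, Good, Weak, true_and, true_implies]; omega⟩

/-- With equal degrees and only odd legs, parity favours neither branch vertex, so labellings with
either of them as the larger one compete. -/
theorem hasGood_oo_oo_odd (a b c d q : ℕ) (hab : a ≤ b + 1) (hcd : c ≤ d + 1) :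
    HasGood {2 * b + 3, 2 * a + 1} {2 * d + 3, 2 * c + 1} (2 * q + 1) ∨
      HasGood {2 * d + 3, 2 * c + 1} {2 * b + 3, 2 * a + 1} (2 * q + 1) := by
  by_contra hn
  have g1 := Realizes.not_dominates (P := Good) (((((realizes_zero.uOdd a).uOdd (b + 1)).midHighU
    q).vOdd c).vTopOdd d (by omega) (by omega)) (fun h => hn (.inl h)) fun hlt => by
    dsimp only at hlt
    simp only [Good, Weak, true_and, true_implies]
    omega
  have g2 := Realizes.not_dominates (P := Good) (((((realizes_zero.vOdd c).uOdd a).vOdd (d +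
    1)).uOdd (b + 1)).midHighU q) (fun h => hn (.inl h)) fun hlt => by
    dsimp only at hlt
    simp only [Good, Weak, true_and, zero_ne_one, false_implies]
    omega
  have g3 := Realizes.not_dominates (P := Good) (((((realizes_zero.uOdd c).uOdd (d + 1)).midHighU
    q).vOdd a).vTopOdd b (by omega) (by omega)) (fun h => hn (.inr h)) fun hlt => by
    dsimp only at hlt
    simp only [Good, Weak, true_and, true_implies]
    omega
  have g4 := Realizes.not_dominates (P := Good) (((((realizes_zero.vOdd a).uOdd c).vOdd (b +
    1)).uOdd (d + 1)).midHighU q) (fun h => hn (.inr h)) fun hlt => by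
    dsimp only at hlt
    simp only [Good, Weak, true_and, zero_ne_one, false_implies]
    omega
  dsimp only at g1 g2 g3 g4
  omega

theorem hasGood_11_oo_odd (c d q : ℕ) :
    HasGood {1, 1} {2 * d + 3, 2 * c + 1} (2 * q + 1) ∨
      HasGood {2 * d + 3, 2 * c + 1} {1, 1} (2 * q + 1) := by
  by_contra hn
  have g1 := Realizes.not_dominates (P := Good) (((((realizes_zero.uOdd 0).uOdd 0).midHighU
    q).vOdd c).vTopOdd d (by omega) (by omega)) (fun h => hn (.inl h)) fun hlt => by
    dsimp only at hlt
    simp only [Good, Weak, true_and, true_implies]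
    omega
  have g2 := Realizes.not_dominates (P := Good) (((((realizes_zero.vOdd c).uOdd 0).vOdd (d +
    1)).uOdd 0).midHighU q) (fun h => hn (.inl h)) fun hlt => by
    dsimp only at hlt
    simp only [Good, Weak, true_and, zero_ne_one, false_implies]
    omega
  have g3 := Realizes.not_dominates (P := Good) (((((realizes_zero.vOdd 0).uOdd c).vOdd 0).uOdd
    (d + 1)).midHighU q) (fun h => hn (.inr h)) fun hlt => by
    dsimp only at hlt
    simp only [Good, Weak, true_and, zero_ne_one, false_implies]
    omega
  dsimp only at g1 g2 g3
  omega

theorem hasGood_11_11_odd (q : ℕ) :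
    HasGood {1, 1} {1, 1} (2 * q + 1) :=
  ⟨_, ((realizes_one_one.uOdd 0).uOdd 0).midHighU q,
    by simp only [Good, Weak, true_and, zero_ne_one, false_implies]; omega⟩

theorem hasGood_oo_oo_even (a b c d q : ℕ) (hab : a ≤ b + 1) (hcd : c ≤ d + 1) :
    HasGood {2 * b + 3, 2 * a + 1} {2 * d + 3, 2 * c + 1} (2 * q + 2) ∨
      HasGood {2 * d + 3, 2 * c + 1} {2 * b + 3, 2 * a + 1} (2 * q + 2) := by
  by_contra hn
  have g1 := Realizes.not_dominates (P := Good) ((((((realizes_zero.uOdd (b + 1)).uOdd a).vOdd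
    c).midEvenTopV q (by omega) (by omega)).vTopOdd d (by omega) (by omega)).of_eq
    (Multiset.cons_swap _ _ _) rfl rfl rfl) (fun h => hn (.inl h)) fun hlt => by
    dsimp only at hlt
    simp only [Good, Weak, true_and, true_implies]
    omega
  have g2 := Realizes.not_dominates (P := Good) (((((realizes_zero.uOdd a).vOdd c).uOdd (b +
    1)).midEvenTopV q (by omega) (by omega)).vTopOdd d (by omega) (by omega)) (fun h => hn (.inl
    h)) fun hlt => by
    dsimp only at hlt
    simp only [Good, Weak, true_and, true_implies]
    omega
  have g3 := Realizes.not_dominates (P := Good) (((((realizes_zero.uOdd a).uOdd (b + 1)).vOdd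
    c).vOdd (d + 1)).midEvenHighV q) (fun h => hn (.inl h)) fun hlt => by
    dsimp only at hlt
    simp only [Good, Weak, true_and, zero_ne_one, false_implies]
    omega
  have g4 := Realizes.not_dominates (P := Good) (((((realizes_zero.uOdd a).uOdd (b + 1)).vOdd
    c).vTopOdd d (by omega) (by omega)).midEvenTopV q (by omega) (by omega)) (fun h => hn (.inl
    h)) fun hlt => by
    dsimp only at hlt
    simp only [Good, Weak, true_and, true_implies]
    omega
  have g5 := Realizes.not_dominates (P := Good) ((((((realizes_zero.uOdd (d + 1)).uOdd c).vOdd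
    a).midEvenTopV q (by omega) (by omega)).vTopOdd b (by omega) (by omega)).of_eq
    (Multiset.cons_swap _ _ _) rfl rfl rfl) (fun h => hn (.inr h)) fun hlt => by
    dsimp only at hlt
    simp only [Good, Weak, true_and, true_implies]
    omega
  have g6 := Realizes.not_dominates (P := Good) (((((realizes_zero.uOdd c).vOdd a).uOdd (d +
    1)).midEvenTopV q (by omega) (by omega)).vTopOdd b (by omega) (by omega)) (fun h => hn (.inr
    h)) fun hlt => by
    dsimp only at hlt
    simp only [Good, Weak, true_and, true_implies]
    omega
  have g7 := Realizes.not_dominates (P := Good) (((((realizes_zero.uOdd c).uOdd (d + 1)).vOdd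
    a).vOdd (b + 1)).midEvenHighV q) (fun h => hn (.inr h)) fun hlt => by
    dsimp only at hlt
    simp only [Good, Weak, true_and, zero_ne_one, false_implies]
    omega
  have g8 := Realizes.not_dominates (P := Good) (((((realizes_zero.uOdd c).uOdd (d + 1)).vOdd
    a).vTopOdd b (by omega) (by omega)).midEvenTopV q (by omega) (by omega)) (fun h => hn (.inr
    h)) fun hlt => by
    dsimp only at hlt
    simp only [Good, Weak, true_and, true_implies]
    omega
  dsimp only at g1 g2 g3 g4 g5 g6 g7 g8
  omega

theorem hasGood_11_1o_even (d q : ℕ) :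
    HasGood {1, 1} {2 * d + 3, 1} (2 * q + 2) ∨ HasGood {2 * d + 3, 1} {1, 1} (2 * q + 2) := by
  by_contra hn
  have g1 := Realizes.not_dominates (P := Good) ((realizes_one_one_one.vOdd (d + 1)).midEvenHighV
    q) (fun h => hn (.inl h)) fun hlt => by
    dsimp only at hlt
    simp only [Good, Weak, true_and, zero_ne_one, false_implies]
    omega
  have g2 := Realizes.not_dominates (P := Good) ((((((realizes_zero.uOdd 0).uOdd 0).vOdd
    0).midEvenTopV q (by omega) (by omega)).vTopOdd d (by omega) (by omega)).of_eq
    (Multiset.cons_swap _ _ _) rfl rfl rfl) (fun h => hn (.inl h)) fun hlt => by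
    dsimp only at hlt
    simp only [Good, Weak, true_and, true_implies]
    omega
  have g3 := Realizes.not_dominates (P := Good) (((((realizes_zero.uOdd 0).vOdd 0).uOdd
    0).midEvenTopV q (by omega) (by omega)).vTopOdd d (by omega) (by omega)) (fun h => hn (.inl
    h)) fun hlt => by
    dsimp only at hlt
    simp only [Good, Weak, true_and, true_implies]
    omega
  have g4 := Realizes.not_dominates (P := Good) (((((realizes_zero.uOdd 0).uOdd 0).vOdd
    0).vTopOdd d (by omega) (by omega)).midEvenTopV q (by omega) (by omega)) (fun h => hn (.inl
    h)) fun hlt => by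
    dsimp only at hlt
    simp only [Good, Weak, true_and, true_implies]
    omega
  dsimp only at g1 g2 g3 g4
  omega

theorem hasGood_11_oo_even (c d q : ℕ) (hcd : c ≤ d) :
    HasGood {1, 1} {2 * d + 3, 2 * c + 3} (2 * q + 2) ∨
      HasGood {2 * d + 3, 2 * c + 3} {1, 1} (2 * q + 2) := by
  by_contra hn
  have g1 := Realizes.not_dominates (P := Good) ((((((realizes_zero.uOdd 0).uOdd 0).vOdd (c +
    1)).midEvenTopV q (by omega) (by omega)).vTopOdd d (by omega) (by omega)).of_eq
    (Multiset.cons_swap _ _ _) rfl rfl rfl) (fun h => hn (.inl h)) fun hlt => by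
    dsimp only at hlt
    simp only [Good, Weak, true_and, true_implies]
    omega
  have g2 := Realizes.not_dominates (P := Good) (((((realizes_zero.uOdd 0).vOdd (c + 1)).uOdd
    0).midEvenTopV q (by omega) (by omega)).vTopOdd d (by omega) (by omega)) (fun h => hn (.inl
    h)) fun hlt => by
    dsimp only at hlt
    simp only [Good, Weak, true_and, true_implies]
    omega
  have g3 := Realizes.not_dominates (P := Good) (((((realizes_zero.uOdd 0).uOdd 0).vOdd (c +
    1)).vOdd (d + 1)).midEvenHighV q) (fun h => hn (.inl h)) fun hlt => by
    dsimp only at hlt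
    simp only [Good, Weak, true_and, zero_ne_one, false_implies]
    omega
  have g4 := Realizes.not_dominates (P := Good) (((((realizes_zero.uOdd 0).uOdd 0).vOdd (c +
    1)).vTopOdd d (by omega) (by omega)).midEvenTopV q (by omega) (by omega)) (fun h => hn (.inl
    h)) fun hlt => by
    dsimp only at hlt
    simp only [Good, Weak, true_and, true_implies]
    omega
  have g5 := Realizes.not_dominates (P := Good) (((((realizes_zero.uOdd (c + 1)).uOdd (d +
    1)).vOdd 0).vOdd 0).midEvenHighV q) (fun h => hn (.inr h)) fun hlt => by
    dsimp only at hlt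
    simp only [Good, Weak, true_and, zero_ne_one, false_implies]
    omega
  dsimp only at g1 g2 g3 g4 g5
  omega

theorem hasGood_11_11_even (q : ℕ) :
    HasGood {1, 1} {1, 1} (2 * q + 2) :=
  ⟨_, ((realizes_one_one.swap.vOdd 0).vOdd 0).midEvenHighV q,
    by simp only [Good, Weak, true_and, zero_ne_one, false_implies]; omega⟩

end DoubleSpider

/-! ### Induction on the legs. -/

namespace DoubleSpider

variable {A B : Multiset ℕ} {p : ℕ}

theorem exists_odd_even_form {n : ℕ} (hn : 1 ≤ n) : ∃ k, n = 2 * k + 1 ∨ n = 2 * k + 2 :=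
  ⟨(n - 1) / 2, by omega⟩

theorem pair_cases (hA : A.card = 2) (h : ∀ a ∈ A, 1 ≤ a) :
    (∃ k l, k ≤ l ∧ A = {2 * l + 1, 2 * k + 1}) ∨ (∃ k l, A = {2 * l + 2, 2 * k + 1}) ∨
      ∃ k l, k ≤ l ∧ A = {2 * l + 2, 2 * k + 2} := by
  obtain ⟨a, b, rfl⟩ := Multiset.card_eq_two.1 hA
  obtain ⟨k, hk⟩ := exists_odd_even_form (h a (by simp))
  obtain ⟨l, hl⟩ := exists_odd_even_form (h b (by simp))
  rcases hk with rfl | rfl <;> rcases hl with rfl | rfl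
  · rcases le_total k l with hkl | hkl
    · exact .inl ⟨k, l, hkl, Multiset.pair_comm _ _⟩
    · exact .inl ⟨l, k, hkl, rfl⟩
  · exact .inr (.inl ⟨k, l, Multiset.pair_comm _ _⟩)
  · exact .inr (.inl ⟨l, k, rfl⟩)
  · rcases le_total k l with hkl | hkl
    · exact .inr (.inr ⟨k, l, hkl, Multiset.pair_comm _ _⟩)
    · exact .inr (.inr ⟨l, k, hkl, rfl⟩)

theorem odd_triple (hB : B.card = 3) (h : ∀ b ∈ B, b % 2 = 1) :
    ∃ c d e, c ≤ d ∧ d ≤ e ∧ B = {2 * e + 1, 2 * d + 1, 2 * c + 1} := by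
  obtain ⟨b, hb, hmax⟩ : ∃ b ∈ B, ∀ x ∈ B, x ≤ b := by
    obtain ⟨b, hb, h⟩ := B.toFinset.exists_max_image id
      (by rw [Multiset.toFinset_nonempty]; rintro rfl; simp at hB)
    exact ⟨b, by simpa using hb, fun x hx => h x (by simpa using hx)⟩
  obtain ⟨B, rfl⟩ := Multiset.exists_cons_of_mem hb
  have hpos : ∀ a ∈ B, 1 ≤ a := fun a ha => by
    have := h a (Multiset.mem_cons_of_mem ha)
    omega
  have hb1 := h b (by simp)
  rcases pair_cases (by simpa using hB) hpos with ⟨k, l, hkl, rfl⟩ | ⟨k, l, rfl⟩ | ⟨k, l, hkl, rfl⟩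
  · have := hmax (2 * l + 1) (by simp)
    refine ⟨k, l, b / 2, hkl, by omega, ?_⟩
    rw [show 2 * (b / 2) + 1 = b by omega]
    rfl
  · have := h (2 * l + 2) (by simp)
    omega
  · have := h (2 * l + 2) (by simp)
    omega

/-- The last case isolates two even lengths and leaves `b` of any parity: such a triple is reached
from two even legs by adding `b`. -/
theorem triple_cases (hB : B.card = 3) (h : ∀ b ∈ B, 1 ≤ b) :
    (∃ c d e, c ≤ d ∧ d ≤ e ∧ B = {2 * e + 1, 2 * d + 1, 2 * c + 1}) ∨
      (∃ c d e, c ≤ d ∧ B = {2 * e + 2, 2 * d + 1, 2 * c + 1}) ∨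
      ∃ b k l, 1 ≤ b ∧ k ≤ l ∧ B = b ::ₘ {2 * l + 2, 2 * k + 2} := by
  by_cases hodd : ∀ b ∈ B, b % 2 = 1
  · exact .inl (odd_triple hB hodd)
  right
  push Not at hodd
  obtain ⟨b, hb, hb2⟩ := hodd
  have hb1 := h b hb
  obtain ⟨B, rfl⟩ := Multiset.exists_cons_of_mem hb
  obtain ⟨e, rfl⟩ : ∃ e, b = 2 * e + 2 := ⟨b / 2 - 1, by omega⟩
  rcases pair_cases (by simpa using hB) (fun a ha => h a (Multiset.mem_cons_of_mem ha)) with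
    ⟨k, l, hkl, rfl⟩ | ⟨k, l, rfl⟩ | ⟨k, l, hkl, rfl⟩
  · exact .inl ⟨k, l, e, hkl, rfl⟩
  · rcases le_total e l with hel | hel
    · refine .inr ⟨2 * k + 1, e, l, by omega, hel, ?_⟩
      simp only [Multiset.insert_eq_cons, ← Multiset.singleton_add]
      abel
    · refine .inr ⟨2 * k + 1, l, e, by omega, hel, ?_⟩
      simp only [Multiset.insert_eq_cons, ← Multiset.singleton_add]
      abel
  · exact .inr ⟨2 * e + 2, k, l, by omega, hkl, rfl⟩

theorem HasGood.cons_right (h : HasGood A B p) {b : ℕ} (hb : 1 ≤ b) : HasGood A (b ::ₘ B) p := by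
  obtain ⟨k, rfl | rfl⟩ := exists_odd_even_form hb
  · exact h.vOdd k
  · exact h.vEven k

theorem HasGood.cons_cons_odd (h : HasGood A B p) {a b : ℕ} (ha : a % 2 = 1) (hb : 1 ≤ b) :
    HasGood (a ::ₘ A) (b ::ₘ B) p := by
  obtain ⟨k, rfl⟩ : ∃ k, a = 2 * k + 1 := ⟨a / 2, by omega⟩
  obtain ⟨j, rfl | rfl⟩ := exists_odd_even_form hb
  · exact h.odd_odd k j
  · exact h.odd_even k j

theorem HasGood.cons_cons_even (h : HasGood A B p) {a b : ℕ} (ha : a % 2 = 0) (hb : b % 2 = 0)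
    (ha1 : 1 ≤ a) (hb1 : 1 ≤ b) : HasGood (a ::ₘ A) (b ::ₘ B) p := by
  obtain ⟨k, rfl⟩ : ∃ k, a = 2 * k + 2 := ⟨a / 2 - 1, by omega⟩
  obtain ⟨j, rfl⟩ : ∃ k, b = 2 * k + 2 := ⟨b / 2 - 1, by omega⟩
  exact h.even_even k j


/-- Even legs ordinarily hand out middle labels, so the vertex with fewer odd legs is made the
larger one, `v`. The parity hypotheses leave five combinations, each with a path of either parity.
-/
theorem hasGood_two_two (hp : 1 ≤ p) (hA : A.card = 2) (hB : B.card = 2) (hA1 : ∀ a ∈ A, 1 ≤ a)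
    (hB1 : ∀ b ∈ B, 1 ≤ b) (h : B.countP (fun n => n % 2 = 1) ≤ A.countP (fun n => n % 2 = 1))
    (h' : B.countP (fun n => n % 2 = 1) < 2) : HasGood A B p := by
  rcases pair_cases hA hA1 with ⟨a, b, hab, rfl⟩ | ⟨a, b, rfl⟩ | ⟨a, b, hab, rfl⟩ <;>
  rcases pair_cases hB hB1 with ⟨c, d, hcd, rfl⟩ | ⟨c, d, rfl⟩ | ⟨c, d, hcd, rfl⟩ <;>
  simp [← Multiset.cons_zero, Nat.add_mod] at h h' <;>
  obtain ⟨q, rfl | rfl⟩ := exists_odd_even_form hp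
  · cases b with
    | zero =>
      obtain rfl : a = 0 := by omega
      exact hasGood_11_oe_odd c d q
    | succ b => exact hasGood_oo_oe_odd a b c d q
  · cases b with
    | zero =>
      obtain rfl : a = 0 := by omega
      exact hasGood_11_oe_even c d q
    | succ b => exact hasGood_oo_oe_even a b c d q hab
  · exact hasGood_oo_ee_odd a b c d q hab hcd
  · exact hasGood_oo_ee_even a b c d q hab hcd
  · exact hasGood_oe_oe_odd a b c d q
  · exact hasGood_oe_oe_even a b c d q
  · exact hasGood_oe_ee_odd a b c d q hcd
  · exact hasGood_oe_ee_even a b c d q hcd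
  · exact hasGood_ee_ee_odd a b c d q hab hcd
  · exact hasGood_ee_ee_even a b c d q hab hcd

theorem hasGood_two_two_odd (hp : 1 ≤ p) (hA : A.card = 2) (hB : B.card = 2)
    (hA1 : ∀ a ∈ A, a % 2 = 1) (hB1 : ∀ b ∈ B, b % 2 = 1) : HasGood A B p ∨ HasGood B A p := by
  have pos : ∀ {C : Multiset ℕ}, (∀ a ∈ C, a % 2 = 1) → ∀ a ∈ C, 1 ≤ a := fun h a ha => by
    have := h a ha
    omega
  have key : ∀ {C : Multiset ℕ}, C.card = 2 → (∀ a ∈ C, a % 2 = 1) →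
      ∃ k l, k ≤ l ∧ C = {2 * l + 1, 2 * k + 1} := by
    intro C hC h
    rcases pair_cases hC (pos h) with h1 | ⟨k, l, rfl⟩ | ⟨k, l, -, rfl⟩
    · exact h1
    · have := h (2 * l + 2) (by simp)
      omega
    · have := h (2 * l + 2) (by simp)
      omega
  -- The general lemmas need a leg of length at least 3 at both branch vertices, so two leaves at
  -- one of them are treated apart.
  have one : ∀ {C : Multiset ℕ}, C.card = 2 → (∀ a ∈ C, a % 2 = 1) →
      HasGood {1, 1} C p ∨ HasGood C {1, 1} p := by
    intro C hC h
    obtain ⟨c, d, hcd, rfl⟩ := key hC h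
    obtain ⟨q, rfl | rfl⟩ := exists_odd_even_form hp
    · cases d with
      | zero =>
        obtain rfl : c = 0 := by omega
        exact .inl (hasGood_11_11_odd q)
      | succ d => exact hasGood_11_oo_odd c d q
    · cases d with
      | zero =>
        obtain rfl : c = 0 := by omega
        exact .inl (hasGood_11_11_even q)
      | succ d =>
        cases c with
        | zero => exact hasGood_11_1o_even d q
        | succ c => exact hasGood_11_oo_even c d q (by omega)
  obtain ⟨a, b, hab, rfl⟩ := key hA hA1
  obtain ⟨c, d, hcd, rfl⟩ := key hB hB1
  cases b with
  | zero =>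
    obtain rfl : a = 0 := by omega
    exact one hB hB1
  | succ b =>
    cases d with
    | zero =>
      obtain rfl : c = 0 := by omega
      exact (one hA hA1).symm
    | succ d =>
      obtain ⟨q, rfl | rfl⟩ := exists_odd_even_form hp
      exacts [hasGood_oo_oo_odd a b c d q hab hcd, hasGood_oo_oo_even a b c d q hab hcd]

theorem exists_mem_of_two_le {C : Multiset ℕ} (h : 1 ≤ C.card) : ∃ a, a ∈ C :=
  Multiset.card_pos_iff_exists_mem.1 h

theorem countP_odd_eq_zero {C : Multiset ℕ} :
    C.countP (fun n => n % 2 = 1) = 0 ↔ ∀ a ∈ C, a % 2 = 0 := by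
  rw [Multiset.countP_eq_zero]
  exact forall₂_congr fun a _ => by omega

/-- Two branch vertices of the same degree, not all legs being odd. -/
theorem hasGood_of_card_eq (hp : 1 ≤ p) (n : ℕ) (hn : 2 ≤ n) : ∀ A B : Multiset ℕ, A.card = n →
    B.card = n → (∀ a ∈ A, 1 ≤ a) → (∀ b ∈ B, 1 ≤ b) →
    B.countP (fun n => n % 2 = 1) ≤ A.countP (fun n => n % 2 = 1) →
    B.countP (fun n => n % 2 = 1) < n → HasGood A B p := by
  induction n, hn using Nat.le_induction with
  | base => exact fun A B hA hB hA1 hB1 h h' => hasGood_two_two hp hA hB hA1 hB1 h h'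
  | succ n hn ih =>
    intro A B hA hB hA1 hB1 h h'
    by_cases hAo : ∃ a ∈ A, a % 2 = 1
    · obtain ⟨a, ha, ha2⟩ := hAo
      obtain ⟨A, rfl⟩ := Multiset.exists_cons_of_mem ha
      -- Removing an odd leg on both sides keeps the comparison of the numbers of odd legs. If no
      -- leg of `B` is odd, any leg of `B` may go.
      by_cases hBo : ∃ b ∈ B, b % 2 = 1
      · obtain ⟨b, hb, hb2⟩ := hBo
        obtain ⟨B, rfl⟩ := Multiset.exists_cons_of_mem hb
        simp only [Multiset.card_cons, Multiset.countP_cons, Multiset.forall_mem_cons, ha2, hb2,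
          if_true] at hA hB hA1 hB1 h h'
        exact (ih A B (by omega) (by omega) hA1.2 hB1.2 (by omega) (by omega)).cons_cons_odd
          ha2 hB1.1
      · obtain ⟨b, hb⟩ := exists_mem_of_two_le (C := B) (by omega)
        have hBe : B.countP (fun n => n % 2 = 1) = 0 := by
          push Not at hBo
          rw [countP_odd_eq_zero]
          intro b hb
          have := hBo b hb
          omega
        obtain ⟨B, rfl⟩ := Multiset.exists_cons_of_mem hb
        simp only [Multiset.card_cons, Multiset.countP_cons, Multiset.forall_mem_cons, ha2,
          if_true] at hA hB hA1 hB1 h h' hBe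
        exact (ih A B (by omega) (by omega) hA1.2 hB1.2 (by omega) (by omega)).cons_cons_odd
          ha2 hB1.1
    · have hAe : A.countP (fun n => n % 2 = 1) = 0 := by
        push Not at hAo
        rw [countP_odd_eq_zero]
        intro b hb
        have := hAo b hb
        omega
      have hBe := countP_odd_eq_zero.1 (Nat.le_zero.1 (h.trans hAe.le))
      have hAe' := countP_odd_eq_zero.1 hAe
      obtain ⟨a, ha⟩ := exists_mem_of_two_le (C := A) (by omega)
      obtain ⟨b, hb⟩ := exists_mem_of_two_le (C := B) (by omega)
      obtain ⟨A, rfl⟩ := Multiset.exists_cons_of_mem ha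
      obtain ⟨B, rfl⟩ := Multiset.exists_cons_of_mem hb
      simp only [Multiset.card_cons, Multiset.countP_cons, Multiset.forall_mem_cons] at *
      exact (ih A B (by omega) (by omega) hA1.2 hB1.2 (by omega) (by omega)).cons_cons_even
        hAe'.1 hBe.1 hA1.1 hB1.1

/-- Two branch vertices of the same degree, all legs being odd. -/
theorem hasGood_of_card_eq_odd (hp : 1 ≤ p) (n : ℕ) (hn : 2 ≤ n) : ∀ A B : Multiset ℕ,
    A.card = n → B.card = n → (∀ a ∈ A, a % 2 = 1) → (∀ b ∈ B, b % 2 = 1) →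
    HasGood A B p ∨ HasGood B A p := by
  induction n, hn using Nat.le_induction with
  | base => exact fun A B hA hB hA1 hB1 => hasGood_two_two_odd hp hA hB hA1 hB1
  | succ n hn ih =>
    intro A B hA hB hA1 hB1
    obtain ⟨a, ha⟩ := exists_mem_of_two_le (C := A) (by omega)
    obtain ⟨b, hb⟩ := exists_mem_of_two_le (C := B) (by omega)
    obtain ⟨A, rfl⟩ := Multiset.exists_cons_of_mem ha
    obtain ⟨B, rfl⟩ := Multiset.exists_cons_of_mem hb
    simp only [Multiset.card_cons, Multiset.forall_mem_cons] at *
    exact (ih A B (by omega) (by omega) hA1.2 hB1.2).imp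
      (fun h => h.cons_cons_odd hA1.1 (by omega)) (fun h => h.cons_cons_odd hB1.1 (by omega))

/-- The top label is carried by an odd leg at `v` of length at least 3 or by a path of odd length at
least 3. The exception lists the configurations that have neither. -/
theorem hasStrict_two_three (hp : 1 ≤ p) (hA : A.card = 2) (hB : B.card = 3) (hA1 : ∀ a ∈ A, 1 ≤ a)
    (hA2 : ∀ a ∈ A, a % 2 = 0) (hB2 : ∀ b ∈ B, b % 2 = 1) :
    HasStrict A B p ∨ (B = {1, 1, 1} ∧ (p = 1 ∨ p % 2 = 0)) := by
  obtain ⟨a, b, hab, rfl⟩ : ∃ k l, k ≤ l ∧ A = {2 * l + 2, 2 * k + 2} := by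
    rcases pair_cases hA hA1 with ⟨k, l, -, rfl⟩ | ⟨k, l, rfl⟩ | h
    · have := hA2 (2 * l + 1) (by simp)
      omega
    · have := hA2 (2 * k + 1) (by simp)
      omega
    · exact h
  obtain ⟨c, d, e, hcd, hde, rfl⟩ := odd_triple hB hB2
  obtain ⟨q, rfl | rfl⟩ := exists_odd_even_form hp
  · cases q with
    | zero =>
      cases e with
      | zero =>
        obtain rfl : d = 0 := by omega
        obtain rfl : c = 0 := by omega
        exact .inr ⟨rfl, .inl rfl⟩
      | succ e => exact .inl (hasStrict_ee_ooo_one a b c d e hab hcd hde)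
    | succ q => exact .inl (hasStrict_ee_ooo_of_three_le a b c d e q hab hcd)
  · cases e with
    | zero =>
      obtain rfl : d = 0 := by omega
      obtain rfl : c = 0 := by omega
      exact .inr ⟨rfl, .inr (by omega)⟩
    | succ e => exact .inl (hasStrict_ee_ooo_even a b c d e q hab hcd)

theorem hasStrict_of_three_le (hp : 1 ≤ p) (n : ℕ) (hn : 2 ≤ n) : ∀ A B : Multiset ℕ,
    A.card = n → B.card = n + 1 → (∀ a ∈ A, 1 ≤ a) → (∀ a ∈ A, a % 2 = 0) →
    (∀ b ∈ B, b % 2 = 1) → (∀ b ∈ B, b ≠ 1) → HasStrict A B p := by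
  induction n, hn using Nat.le_induction with
  | base =>
    intro A B hA hB hA1 hA2 hB2 hB1
    rcases hasStrict_two_three hp hA hB hA1 hA2 hB2 with h | ⟨rfl, -⟩
    · exact h
    · exact absurd rfl (hB1 1 (by simp))
  | succ n hn ih =>
    intro A B hA hB hA1 hA2 hB2 hB1
    obtain ⟨a, ha⟩ := exists_mem_of_two_le (C := A) (by omega)
    obtain ⟨b, hb⟩ := exists_mem_of_two_le (C := B) (by omega)
    obtain ⟨A, rfl⟩ := Multiset.exists_cons_of_mem ha
    obtain ⟨B, rfl⟩ := Multiset.exists_cons_of_mem hb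
    simp only [Multiset.card_cons, Multiset.forall_mem_cons] at *
    have := (ih A B (by omega) (by omega) hA1.2 hA2.2 hB2.2 hB1.2).even_odd (a / 2 - 1) (b / 2 - 1)
    rwa [show 2 * (a / 2 - 1) + 2 = a by omega, show 2 * (b / 2 - 1) + 3 = b by omega] at this

/-- A leg of length 1 at `v` is paired with one of length at least 4 at `u` by `even_one`. Once no
such leg is left at `v`, the stronger `HasStrict` is available. -/
theorem hasSeparated_of_four_le (hp : 1 ≤ p) (n : ℕ) (hn : 2 ≤ n) : ∀ A B : Multiset ℕ,
    A.card = n → B.card = n + 1 → (∀ a ∈ A, 3 ≤ a) → (∀ a ∈ A, a % 2 = 0) →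
    (∀ b ∈ B, b % 2 = 1) → HasSeparated A B p := by
  induction n, hn using Nat.le_induction with
  | base =>
    intro A B hA hB hA1 hA2 hB2
    have hA3 : ∀ a ∈ A, 1 ≤ a := fun a ha => by have := hA1 a ha; omega
    rcases hasStrict_two_three hp hA hB hA3 hA2 hB2 with h | ⟨rfl, h⟩
    · exact h.separated
    rcases pair_cases hA hA3 with ⟨k, l, -, rfl⟩ | ⟨k, l, rfl⟩ | ⟨k, l, hkl, rfl⟩
    · have := hA2 (2 * l + 1) (by simp)
      omega
    · have := hA2 (2 * k + 1) (by simp)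
      omega
    have h1 := hA1 (2 * l + 2) (by simp)
    have h2 := hA1 (2 * k + 2) (by simp)
    obtain ⟨k, rfl⟩ : ∃ k', k = k' + 1 := ⟨k - 1, by omega⟩
    obtain ⟨l, rfl⟩ : ∃ k', l = k' + 1 := ⟨l - 1, by omega⟩
    rcases h with rfl | h
    · exact hasSeparated_ff_111_one k l (by omega)
    · obtain ⟨q, rfl⟩ : ∃ q, p = 2 * q + 2 := ⟨p / 2 - 1, by omega⟩
      exact hasSeparated_ff_111_even k l q (by omega)
  | succ n hn ih =>
    intro A B hA hB hA1 hA2 hB2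
    by_cases h : 1 ∈ B
    · obtain ⟨a, ha⟩ := exists_mem_of_two_le (C := A) (by omega)
      obtain ⟨A, rfl⟩ := Multiset.exists_cons_of_mem ha
      obtain ⟨B, rfl⟩ := Multiset.exists_cons_of_mem h
      simp only [Multiset.card_cons, Multiset.forall_mem_cons] at *
      have := (ih A B (by omega) (by omega) hA1.2 hA2.2 hB2.2).even_one (a / 2 - 2)
      rwa [show 2 * (a / 2 - 2) + 4 = a by omega] at this
    · refine (hasStrict_of_three_le hp (n + 1) (by omega) A B hA hB (fun a ha => ?_) hA2 hB2
        fun b hb hb1 => h (hb1 ▸ hb)).separated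
      have := hA1 a ha
      omega

theorem hasGood_two_three (hp : 1 ≤ p) (hA : A.card = 2) (hB : B.card = 3) (hA1 : ∀ a ∈ A, 1 ≤ a)
    (hB1 : ∀ b ∈ B, 1 ≤ b) (h : ¬ (A = {2, 2} ∧ p = 1 ∧ ∀ b ∈ B, b = 1)) : HasGood A B p := by
  rcases triple_cases hB hB1 with ⟨c, d, e, hcd, hde, rfl⟩ | ⟨c, d, e, hcd, rfl⟩ |
    ⟨b, k, l, hb, hkl, rfl⟩
  · rcases pair_cases hA hA1 with ⟨a, b, hab, rfl⟩ | ⟨a, b, rfl⟩ | ⟨a, b, hab, rfl⟩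
    · obtain ⟨q, rfl | rfl⟩ := exists_odd_even_form hp <;> cases e with
      | zero =>
        obtain rfl : d = 0 := by omega
        obtain rfl : c = 0 := by omega
        first | exact hasGood_oo_111_odd a b q hab | exact hasGood_oo_111_even a b q hab
      | succ e =>
        first
        | exact hasGood_oo_ooo_odd a b c d e q hab hcd hde
        | exact hasGood_oo_ooo_even a b c d e q hab hcd hde
    · obtain ⟨q, rfl | rfl⟩ := exists_odd_even_form hp
      · cases e with
        | zero =>
          obtain rfl : d = 0 := by omega
          obtain rfl : c = 0 := by omega
          exact hasGood_oe_111_odd a b q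
        | succ e => exact hasGood_oe_ooo_odd a b c d e q hcd
      · exact hasGood_oe_ooo_even a b c d e q hcd hde
    · rcases hasStrict_two_three (p := p) hp hA hB hA1 (by simp) (by simp)
        with h1 | ⟨h1, h2⟩
      · exact h1.separated.good
      rw [h1] at h ⊢
      rcases h2 with rfl | h2
      · cases b with
        | zero =>
          obtain rfl : a = 0 := by omega
          simp at h
        | succ b => exact hasGood_ef_111_one a b hab
      · obtain ⟨q, rfl⟩ : ∃ q, p = 2 * q + 2 := ⟨p / 2 - 1, by omega⟩
        exact hasGood_ee_111_even a b q hab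
  · have key : 1 ≤ A.countP (fun n => n % 2 = 1) →
        HasGood A {2 * e + 2, 2 * d + 1, 2 * c + 1} p := by
      intro h1
      have : HasGood A ((2 * c + 1) ::ₘ {2 * e + 2, 2 * d + 1}) p := by
        refine (hasGood_two_two hp hA (by simp) hA1 ?_ ?_ ?_).cons_right (by omega)
        · simp
        all_goals simp [← Multiset.cons_zero, Nat.add_mod, h1]
      convert this using 1
      simp only [Multiset.insert_eq_cons, ← Multiset.singleton_add]
      abel
    rcases pair_cases hA hA1 with ⟨a, b, hab, rfl⟩ | ⟨a, b, rfl⟩ | ⟨a, b, hab, rfl⟩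
    · exact key (by simp [← Multiset.cons_zero, Nat.add_mod])
    · exact key (by simp [← Multiset.cons_zero, Nat.add_mod])
    · obtain ⟨q, rfl | rfl⟩ := exists_odd_even_form hp
      exacts [hasGood_ee_ooe_odd a b c d e q hcd, hasGood_ee_ooe_even a b c d e q hab hcd]
  · refine (hasGood_two_two hp hA (by simp) hA1 ?_ ?_ ?_).cons_right hb
    · simp
    all_goals simp [← Multiset.cons_zero]

theorem hasGood_two (hp : 1 ≤ p) (hA : A.card = 2) (hA1 : ∀ a ∈ A, 1 ≤ a) (n : ℕ) (hn : 3 ≤ n) :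
    ∀ B : Multiset ℕ, B.card = n → (∀ b ∈ B, 1 ≤ b) → ¬ (A = {2, 2} ∧ p = 1 ∧ ∀ b ∈ B, b = 1) →
      HasGood A B p := by
  induction n, hn using Nat.le_induction with
  | base => exact fun B hB hB1 h => hasGood_two_three hp hA hB hA1 hB1 h
  | succ n hn ih =>
    intro B hB hB1 h
    -- The removed leg must not leave the exceptional configuration behind, so a leg of length
    -- different from 1, if there is one, is kept.
    obtain ⟨b, C, rfl, hC⟩ : ∃ b C, B = b ::ₘ C ∧ ¬ (A = {2, 2} ∧ p = 1 ∧ ∀ b ∈ C, b = 1) := by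
      by_cases h1 : ∀ b ∈ B, b = 1
      · obtain ⟨b, hb⟩ := exists_mem_of_two_le (C := B) (by omega)
        obtain ⟨C, rfl⟩ := Multiset.exists_cons_of_mem hb
        exact ⟨b, C, rfl, fun h2 => h ⟨h2.1, h2.2.1, h1⟩⟩
      · push Not at h1
        obtain ⟨x, hx, hx1⟩ := h1
        obtain ⟨B, rfl⟩ := Multiset.exists_cons_of_mem hx
        rw [Multiset.card_cons] at hB
        obtain ⟨b, hb⟩ := exists_mem_of_two_le (C := B) (by omega)
        obtain ⟨C, rfl⟩ := Multiset.exists_cons_of_mem hb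
        exact ⟨b, x ::ₘ C, Multiset.cons_swap _ _ _, fun h2 => hx1 (h2.2.2 x (by simp))⟩
    simp only [Multiset.card_cons, Multiset.forall_mem_cons] at hB hB1
    exact (ih C (by omega) hB1.2 hC).cons_right hB1.1

/-- An odd leg at `u` can be paired with any leg at `v`, and an even one with an even one. When
neither pairing exists, all legs at `u` are even and all at `v` odd; then either no leg at `v` is a
leaf, or every leg at `u` has length at least 4. -/
theorem hasGood_of_card_add_one (hp : 1 ≤ p) (n : ℕ) (hn : 2 ≤ n) : ∀ A B : Multiset ℕ,
    A.card = n → B.card = n + 1 → (∀ a ∈ A, 1 ≤ a) → (∀ b ∈ B, 1 ≤ b) → ¬ (2 ∈ A ∧ 1 ∈ B) →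
    HasGood A B p := by
  induction n, hn using Nat.le_induction with
  | base =>
    intro A B hA hB hA1 hB1 h
    refine hasGood_two_three hp hA hB hA1 hB1 ?_
    rintro ⟨rfl, -, h2⟩
    obtain ⟨b, hb⟩ := exists_mem_of_two_le (C := B) (by omega)
    exact h ⟨by simp, h2 b hb ▸ hb⟩
  | succ n hn ih =>
    intro A B hA hB hA1 hB1 h
    by_cases hAo : ∃ a ∈ A, a % 2 = 1
    · obtain ⟨a, ha, ha2⟩ := hAo
      obtain ⟨b, hb⟩ := exists_mem_of_two_le (C := B) (by omega)
      obtain ⟨A, rfl⟩ := Multiset.exists_cons_of_mem ha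
      obtain ⟨B, rfl⟩ := Multiset.exists_cons_of_mem hb
      simp only [Multiset.card_cons, Multiset.forall_mem_cons] at *
      exact (ih A B (by omega) (by omega) hA1.2 hB1.2 fun h1 =>
        h ⟨Multiset.mem_cons_of_mem h1.1, Multiset.mem_cons_of_mem h1.2⟩).cons_cons_odd ha2 hB1.1
    have hAe : ∀ a ∈ A, a % 2 = 0 := fun a ha => by
      by_contra h1
      exact hAo ⟨a, ha, by omega⟩
    by_cases hBe : ∃ b ∈ B, b % 2 = 0
    · obtain ⟨b, hb, hb2⟩ := hBe
      obtain ⟨a, ha⟩ := exists_mem_of_two_le (C := A) (by omega)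
      obtain ⟨A, rfl⟩ := Multiset.exists_cons_of_mem ha
      obtain ⟨B, rfl⟩ := Multiset.exists_cons_of_mem hb
      simp only [Multiset.card_cons, Multiset.forall_mem_cons] at *
      exact (ih A B (by omega) (by omega) hA1.2 hB1.2 fun h1 =>
        h ⟨Multiset.mem_cons_of_mem h1.1, Multiset.mem_cons_of_mem h1.2⟩).cons_cons_even hAe.1 hb2
        hA1.1 hB1.1
    have hBo : ∀ b ∈ B, b % 2 = 1 := fun b hb => by
      by_contra h1
      exact hBe ⟨b, hb, by omega⟩
    by_cases h1 : 1 ∈ B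
    · refine (hasSeparated_of_four_le hp (n + 1) (by omega) A B hA hB (fun a ha => ?_) hAe hBo).good
      have h2 := hA1 a ha
      have h3 := hAe a ha
      have h4 : a ≠ 2 := fun h4 => h ⟨h4 ▸ ha, h1⟩
      omega
    · exact (hasStrict_of_three_le hp (n + 1) (by omega) A B hA hB hA1 hAe hBo
        fun b hb hb1 => h1 (hb1 ▸ hb)).separated.good

theorem hasGood_of_card_lt (hp : 1 ≤ p) (hA : 2 ≤ A.card) (hA1 : ∀ a ∈ A, 1 ≤ a) (n : ℕ)
    (hn : A.card + 1 ≤ n) : ∀ B : Multiset ℕ, B.card = n → (∀ b ∈ B, 1 ≤ b) →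
      ¬ (2 ∈ A ∧ 1 ∈ B) → HasGood A B p := by
  induction n, hn using Nat.le_induction with
  | base => exact fun B hB hB1 h => hasGood_of_card_add_one hp _ hA A B rfl hB hA1 hB1 h
  | succ n hn ih =>
    intro B hB hB1 h
    obtain ⟨b, hb⟩ := exists_mem_of_two_le (C := B) (by omega)
    obtain ⟨B, rfl⟩ := Multiset.exists_cons_of_mem hb
    simp only [Multiset.card_cons, Multiset.forall_mem_cons] at *
    exact (ih B (by omega) hB1.2 fun h1 => h ⟨h1.1, Multiset.mem_cons_of_mem h1.2⟩).cons_right hB1.1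

/-- The configuration excluded in `hasGood_two_three`. For three leaves all eight labels count as
low; the sums are 9 and 11 at degree two, 15 at `u` and 16 at `v`. Each further leaf is added by
`HasWeak.one`. -/
theorem hasWeak_two_two_ones (n : ℕ) (hn : 3 ≤ n) :
    HasWeak {2, 2} (Multiset.replicate n 1) 1 := by
  induction n, hn using Nat.le_induction with
  | base =>
    refine ⟨⟨8, 8, 8, 11, 0, 0, 0, 0, 0, 3, 0, 0, 15, 4, 0, 0, 16⟩,
      ⟨⟨[[6, 3], [7, 4]], [[1], [2], [5]], [8]⟩, rfl, rfl, rfl, le_rfl, ?_, ?_⟩, ?_⟩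
    · simp [IsLabels, Spider.edges]
    · refine ⟨le_rfl, Nat.zero_le _, Nat.zero_le _, Nat.zero_le _, by simp, ?_, ?_, ?_, ?_, ?_⟩
      · simp [Spider.leaves]
      · intro d hd
        simp [Spider.pairs] at hd
        rcases hd with rfl | rfl <;> constructor <;> simp [above]
      · intro d hd e he
        simp [Spider.pairs] at hd he
        rcases hd with rfl | rfl <;> rcases he with rfl | rfl <;> simp [Sep, above]
      · simp [Spider.atU, Stats]
      · simp [Spider.atV, Stats]
    · simp [Weak]
  | succ n hn ih =>
    rw [Multiset.replicate_succ]
    exact ih.one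

/-- Adding legs 2 and 1 by `twoOne` destroys `g = 1`, so it must come last in the construction;
accordingly such pairs are stripped off first, until none is left or `u` has two legs. -/
theorem hasWeak_of_card_lt (hp : 1 ≤ p) (n : ℕ) (hn : 2 ≤ n) : ∀ A B : Multiset ℕ,
    A.card = n → n < B.card → (∀ a ∈ A, 1 ≤ a) → (∀ b ∈ B, 1 ≤ b) → HasWeak A B p := by
  induction n, hn using Nat.le_induction with
  | base =>
    intro A B hA hB hA1 hB1
    by_cases h : A = {2, 2} ∧ p = 1 ∧ ∀ b ∈ B, b = 1
    · obtain ⟨rfl, rfl, h⟩ := h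
      rw [Multiset.eq_replicate_of_mem h]
      exact hasWeak_two_two_ones _ hB
    · exact (hasGood_two hp hA hA1 _ hB B rfl hB1 h).weak
  | succ n hn ih =>
    intro A B hA hB hA1 hB1
    by_cases h : 2 ∈ A ∧ 1 ∈ B
    · obtain ⟨A, rfl⟩ := Multiset.exists_cons_of_mem h.1
      obtain ⟨B, rfl⟩ := Multiset.exists_cons_of_mem h.2
      simp only [Multiset.card_cons, Multiset.forall_mem_cons] at *
      exact (ih A B (by omega) (by omega) hA1.2 hB1.2).two_one
    · exact (hasGood_of_card_lt hp (by omega) hA1 _ (by omega) B rfl hB1 h).weak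

/-- Every double spider has a suitable labelling, up to exchanging its branch vertices. -/
theorem hasWeak_or (hp : 1 ≤ p) (hA : 2 ≤ A.card) (hB : 2 ≤ B.card) (hA1 : ∀ a ∈ A, 1 ≤ a)
    (hB1 : ∀ b ∈ B, 1 ≤ b) :
    (A.card ≤ B.card ∧ HasWeak A B p) ∨ (B.card ≤ A.card ∧ HasWeak B A p) := by
  rcases lt_trichotomy A.card B.card with h | h | h
  · exact .inl ⟨h.le, hasWeak_of_card_lt hp _ hA A B rfl h hA1 hB1⟩
  · by_cases hA2 : ∀ a ∈ A, a % 2 = 1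
    · by_cases hB2 : ∀ b ∈ B, b % 2 = 1
      · exact (hasGood_of_card_eq_odd hp _ hA A B rfl h.symm hA2 hB2).imp
          (fun h1 => ⟨h.le, h1.weak⟩) fun h1 => ⟨h.ge, h1.weak⟩
      · left
        refine ⟨h.le, (hasGood_of_card_eq hp _ hA A B rfl h.symm hA1 hB1 ?_ ?_).weak⟩
        · rw [Multiset.countP_eq_card.2 hA2, h]
          exact Multiset.countP_le_card _ _
        · rw [h]
          exact lt_of_le_of_ne (Multiset.countP_le_card _ _) fun h1 =>
            hB2 (Multiset.countP_eq_card.1 h1)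
    · have hlt : A.countP (fun n => n % 2 = 1) < A.card :=
        lt_of_le_of_ne (Multiset.countP_le_card _ _) fun h1 => hA2 (Multiset.countP_eq_card.1 h1)
      rcases le_total (B.countP (fun n => n % 2 = 1)) (A.countP (fun n => n % 2 = 1)) with h1 | h1
      · exact .inl ⟨h.le, (hasGood_of_card_eq hp _ hA A B rfl h.symm hA1 hB1 h1 (by omega)).weak⟩
      · exact .inr ⟨h.ge, (hasGood_of_card_eq hp _ hA B A h.symm rfl hB1 hA1 h1 hlt).weak⟩
  · exact .inr ⟨h.le, hasWeak_of_card_lt hp _ hB B A rfl h hB1 hA1⟩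

end DoubleSpider

/-! ### From a rooted tree to lists of legs. -/

namespace DoubleSpider

theorem mem_adj_append {α : Type*} {l : List α} {d : α × α} (h : d ∈ adj l) (r : List α) :
    d ∈ adj (l ++ r) := by
  obtain ⟨x, y⟩ := d
  obtain ⟨l₁, l₂, rfl⟩ := mem_adj_iff.1 h
  exact mem_adj_iff.2 ⟨l₁, l₂ ++ r, by simp⟩

theorem mem_adj_concat {α : Type*} {l : List α} {x : α} (h : l.reverse.take 1 = [x]) (y : α) :
    (x, y) ∈ adj (l ++ [y]) := by
  obtain rfl | ⟨l, z, rfl⟩ := l.eq_nil_or_concat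
  · simp at h
  · simp at h
    subst h
    exact mem_adj_iff.2 ⟨l, [], by simp⟩

theorem take_one_append {α : Type*} {l r : List α} {x : α} (h : l.take 1 = [x]) :
    (l ++ r).take 1 = [x] := by
  cases l with
  | nil => simp at h
  | cons a l => simpa using h

/-- `z` lies in the subtree below `x`; `d` is the depth and `par` the parent function. -/
def Below {V : Type*} (par : V → V) (d : V → ℕ) (x z : V) : Prop :=
  d x ≤ d z ∧ par^[d z - d x] z = x

section Below

variable {V : Type*} {par : V → V} {d : V → ℕ} {u : V}

theorem Below.refl (x : V) : Below par d x x := ⟨le_rfl, by simp⟩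

theorem Below.trans {x y z : V} (h : Below par d x y) (h' : Below par d y z) :
    Below par d x z := by
  refine ⟨h.1.trans h'.1, ?_⟩
  have h1 := h.1
  have h2 := h'.1
  rw [show d z - d x = (d y - d x) + (d z - d y) by omega, Function.iterate_add_apply, h'.2, h.2]

theorem Below.eq {x y z : V} (h : Below par d x z) (h' : Below par d y z) (hxy : d x = d y) :
    x = y := by
  rw [← h.2, ← h'.2, hxy]

variable (hd : ∀ x, x ≠ u → d (par x) + 1 = d x)
include hd

theorem below_par {x : V} (hx : x ≠ u) : Below par d (par x) x := by
  have := hd x hx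
  exact ⟨by omega, by rw [show d x - d (par x) = 1 by omega]; rfl⟩

/-- If every vertex below `x` has at most one child, the subtree at `x` is a path. It is listed from
its leaf up to `x` by appending each parent at the end. -/
theorem exists_leg {N : ℕ} (hN : ∀ x, d x ≤ N) (n : ℕ) : ∀ x, N - d x ≤ n →
    (∀ z, Below par d x z → ∀ y y', y ≠ u → y' ≠ u → par y = z → par y' = z → y = y') →
    ∃ l : List V, l.reverse.take 1 = [x] ∧ l.Nodup ∧ (∀ z ∈ l, Below par d x z) ∧
      ∀ z ∈ l, (l.take 1 = [z] ∧ ∀ y, y ≠ u → par y ≠ z) ∨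
        ∃ y ∈ l, y ≠ u ∧ par y = z ∧ (y, z) ∈ adj l := by
  induction n with
  | zero =>
    intro x hx _
    refine ⟨[x], rfl, by simp, by simpa using Below.refl x, ?_⟩
    intro z hz
    obtain rfl := List.mem_singleton.1 hz
    refine .inl ⟨rfl, fun y hy hyz => ?_⟩
    have h1 := hd y hy
    have h2 := hN y
    rw [hyz] at h1
    omega
  | succ n ih =>
    intro x hx huniq
    by_cases hc : ∃ y, y ≠ u ∧ par y = x
    · obtain ⟨y, hy, rfl⟩ := hc
      have h1 := hd y hy
      have hb := below_par hd hy
      obtain ⟨l, hl1, hl2, hl3, hl4⟩ := ih y (by omega) fun z hz => huniq z (hb.trans hz)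
      refine ⟨l ++ [par y], by simp, ?_, ?_, ?_⟩
      · refine hl2.append (by simp) ?_
        intro z hz hz'
        obtain rfl := List.mem_singleton.1 hz'
        have := (hl3 _ hz).1
        omega
      · intro z hz
        rcases List.mem_append.1 hz with hz | hz
        · exact hb.trans (hl3 z hz)
        · obtain rfl := List.mem_singleton.1 hz
          exact Below.refl _
      · intro z hz
        rcases List.mem_append.1 hz with hz | hz
        · rcases hl4 z hz with h | ⟨w, hw, h2, h3, h4⟩
          · exact .inl ⟨take_one_append h.1, h.2⟩
          · exact .inr ⟨w, List.mem_append_left _ hw, h2, h3, mem_adj_append h4 _⟩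
        · obtain rfl := List.mem_singleton.1 hz
          refine .inr ⟨y, List.mem_append_left _ ?_, hy, rfl, mem_adj_concat hl1 _⟩
          have : y ∈ l.reverse.take 1 := by simp [hl1]
          exact List.mem_reverse.1 (List.mem_of_mem_take this)
    · push Not at hc
      refine ⟨[x], rfl, by simp, by simpa using Below.refl x, ?_⟩
      intro z hz
      obtain rfl := List.mem_singleton.1 hz
      exact .inl ⟨rfl, hc⟩

/-- Climbing from `x` ends at a child `w` of the root. The list runs downwards from `w` to `x`, the
direction from `u` to `v` required of the middle path. -/
theorem exists_path (n : ℕ) : ∀ x, x ≠ u → d x ≤ n →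
    ∃ (l : List V) (w : V), l.reverse.take 1 = [x] ∧ l.take 1 = [w] ∧ w ≠ u ∧ par w = u ∧ l.Nodup ∧
      (∀ z ∈ l, z ≠ u ∧ Below par d z x) ∧
      ∀ z ∈ l, z = x ∨ ∃ y ∈ l, y ≠ u ∧ par y = z ∧ (z, y) ∈ adj l := by
  induction n with
  | zero =>
    intro x hx h
    have := hd x hx
    omega
  | succ n ih =>
    intro x hx h
    by_cases hp : par x = u
    · exact ⟨[x], x, rfl, rfl, hx, hp, by simp, by simpa using ⟨hx, Below.refl x⟩, by simp⟩
    · have h1 := hd x hx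
      obtain ⟨l, w, hl1, hl2, hw1, hw2, hl3, hl4, hl5⟩ := ih (par x) hp (by omega)
      refine ⟨l ++ [x], w, by simp, take_one_append hl2, hw1, hw2, ?_, ?_, ?_⟩
      · refine hl3.append (by simp) ?_
        intro z hz hz'
        obtain rfl := List.mem_singleton.1 hz'
        have := (hl4 _ hz).2.1
        omega
      · intro z hz
        rcases List.mem_append.1 hz with hz | hz
        · exact ⟨(hl4 z hz).1, (hl4 z hz).2.trans (below_par hd hx)⟩
        · obtain rfl := List.mem_singleton.1 hz
          exact ⟨hx, Below.refl _⟩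
      · intro z hz
        rcases List.mem_append.1 hz with hz | hz
        · rcases hl5 z hz with rfl | ⟨y, hy, h2, h3, h4⟩
          · exact .inr ⟨x, by simp, hx, rfl, mem_adj_concat hl1 _⟩
          · exact .inr ⟨y, List.mem_append_left _ hy, h2, h3, mem_adj_append h4 _⟩
        · exact .inl (List.mem_singleton.1 hz)

end Below

theorem mem_of_take_reverse {α : Type*} {l : List α} {x : α} (h : l.reverse.take 1 = [x]) :
    x ∈ l :=
  List.mem_reverse.1 (List.mem_of_mem_take (show x ∈ l.reverse.take 1 by simp [h]))

theorem mem_of_take {α : Type*} {l : List α} {x : α} (h : l.take 1 = [x]) : x ∈ l :=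
  List.mem_of_mem_take (show x ∈ l.take 1 by simp [h])

/-- `T` lists the vertices other than `u` of a tree with root `u` whose vertices other than `u` and
`v` have at most one child. -/
structure Lists {V : Type*} (par : V → V) (u v : V) (T : Spider V) : Prop where
  nodup : T.edges.Nodup
  mem : ∀ x, x ∈ T.edges ↔ x ≠ u
  nodup_atU : T.atU.Nodup
  nodup_atV : T.atV.Nodup
  atU : ∀ y, y ∈ T.atU ↔ y ≠ u ∧ par y = u
  atV : ∀ y, y ∈ T.atV ↔ y = v ∨ (y ≠ u ∧ par y = v)
  other : ∀ z, z ≠ u → z ≠ v → (z ∈ T.leaves ∧ ∀ y, y ≠ u → par y ≠ z) ∨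
    ∃ y, y ≠ u ∧ par y = z ∧ ((y, z) ∈ T.pairs ∨ (z, y) ∈ T.pairs)
  us_pos : ∀ l ∈ T.us, 1 ≤ l.length
  vs_pos : ∀ l ∈ T.vs, 1 ≤ l.length
  mid_pos : 1 ≤ T.mid.length
  atU_length : T.atU.length = T.us.length + 1
  atV_length : T.atV.length = T.vs.length + 1

theorem flatMap_last {α : Type*} {f : α → List α} {L : List α}
    (h : ∀ x ∈ L, (f x).reverse.take 1 = [x]) :
    (L.map f).flatMap (fun l => l.reverse.take 1) = L := by
  induction L with
  | nil => rfl
  | cons a L ih =>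
    rw [List.map_cons, List.flatMap_cons, h a (by simp), ih fun x hx => h x (by simp [hx])]
    rfl

/-- The middle path consists of the vertices from a child `w` of `u` down to `v`. The legs at `u`
are the subtrees of its other children, those at `v` the subtrees of all its children. -/
theorem exists_lists {V : Type*} [Fintype V] {par : V → V} {d : V → ℕ} {u v : V} (hu : d u = 0)
    (hd : ∀ x, x ≠ u → d (par x) + 1 = d x) (hv : v ≠ u)
    (huniq : ∀ z, z ≠ u → z ≠ v → ∀ y y', y ≠ u → y' ≠ u → par y = z → par y' = z → y = y') :
    ∃ T : Spider V, Lists par u v T := by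
  classical
  obtain ⟨mid, w, hm1, hm2, hw1, hw2, hm3, hm4, hm5⟩ := exists_path hd (d v) v hv le_rfl
  have hwmid := mem_of_take hm2
  have hvmid := mem_of_take_reverse hm1
  have leg : ∀ x, x ≠ u ∧ ¬ Below par d x v → ∃ l : List V, l.reverse.take 1 = [x] ∧ l.Nodup ∧
      (∀ z ∈ l, Below par d x z) ∧
      ∀ z ∈ l, (l.take 1 = [z] ∧ ∀ y, y ≠ u → par y ≠ z) ∨
        ∃ y ∈ l, y ≠ u ∧ par y = z ∧ (y, z) ∈ adj l := by
    rintro x ⟨hx, hxv⟩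
    -- Neither branch vertex lies below `x`: the root is too shallow, and `v` is excluded by
    -- hypothesis. So children are unique throughout the subtree.
    refine exists_leg hd (N := Finset.univ.sup d) (fun x => Finset.le_sup (Finset.mem_univ x)) _ x
      le_rfl fun z hz => huniq z ?_ ?_
    · rintro rfl
      have h1 := hz.1
      have h2 := hd x hx
      omega
    · rintro rfl
      exact hxv hz
  choose! leg hl1 hl2 hl3 hl4 using leg
  have hwv : Below par d w v := (hm4 w hwmid).2
  let CU : Finset V := Finset.univ.filter fun y => y ≠ u ∧ par y = u ∧ y ≠ w
  let CV : Finset V := Finset.univ.filter fun y => y ≠ u ∧ par y = v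
  have memU : ∀ {y}, y ∈ CU.toList ↔ y ≠ u ∧ par y = u ∧ y ≠ w := by simp [CU]
  have memV : ∀ {y}, y ∈ CV.toList ↔ y ≠ u ∧ par y = v := by simp [CV]
  have depthU : ∀ {y}, y ≠ u → par y = u → d y = d w := by
    intro y hy hyu
    have h1 := hd y hy
    have h2 := hd w hw1
    rw [hyu] at h1
    rw [hw2] at h2
    omega
  have depthV : ∀ {y}, y ∈ CV.toList → d y = d v + 1 := by
    intro y hy
    obtain ⟨h1, h2⟩ := memV.1 hy
    rw [← hd y h1, h2]
  have goodU : ∀ {y}, y ∈ CU.toList → y ≠ u ∧ ¬ Below par d y v := by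
    intro y hy
    obtain ⟨h1, h2, h3⟩ := memU.1 hy
    exact ⟨h1, fun h4 => h3 (h4.eq hwv (depthU h1 h2))⟩
  have goodV : ∀ {y}, y ∈ CV.toList → y ≠ u ∧ ¬ Below par d y v := by
    intro y hy
    have h1 := depthV hy
    exact ⟨(memV.1 hy).1, fun h2 => by have := h2.1; omega⟩
  -- What lies below a child of `v` lies below `w`, hence below no other child of `u`.
  have cross : ∀ {x y z}, x ∈ CU.toList → y ∈ CV.toList → Below par d x z → Below par d y z →
      False := by
    intro x y z hx hy hxz hyz
    obtain ⟨h1, h2, h3⟩ := memU.1 hx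
    obtain ⟨h4, h5⟩ := memV.1 hy
    have h6 : Below par d v y := h5 ▸ below_par hd h4
    exact h3 (hxz.eq (hwv.trans (h6.trans hyz)) (depthU h1 h2))
  have good : ∀ y ∈ CU.toList ++ CV.toList, y ≠ u ∧ ¬ Below par d y v := by
    intro y hy
    rcases List.mem_append.1 hy with hy | hy
    exacts [goodU hy, goodV hy]
  have disj : ∀ x ∈ CU.toList ++ CV.toList, ∀ y ∈ CU.toList ++ CV.toList, ∀ z, Below par d x z →
      Below par d y z → x = y := by
    intro x hx y hy z hxz hyz
    rcases List.mem_append.1 hx with hx | hx <;> rcases List.mem_append.1 hy with hy | hy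
    · obtain ⟨h1, h2, -⟩ := memU.1 hx
      obtain ⟨h3, h4, -⟩ := memU.1 hy
      exact hxz.eq hyz ((depthU h1 h2).trans (depthU h3 h4).symm)
    · exact (cross hx hy hxz hyz).elim
    · exact (cross hy hx hyz hxz).elim
    · exact hxz.eq hyz ((depthV hx).trans (depthV hy).symm)
  have nodupX : (CU.toList ++ CV.toList).Nodup :=
    CU.nodup_toList.append CV.nodup_toList fun x hx hy =>
      cross hx hy (Below.refl x) (Below.refl x)
  let T : Spider V := ⟨CU.toList.map leg, CV.toList.map leg, mid⟩
  have edges : T.edges = mid ++ ((CU.toList ++ CV.toList).map leg).flatten := by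
    simp [T, Spider.edges]
  have memE : ∀ {z}, z ∈ T.edges ↔ z ∈ mid ∨ ∃ x ∈ CU.toList ++ CV.toList, z ∈ leg x := by
    intro z
    rw [edges, List.mem_append, List.mem_flatten]
    simp only [List.mem_map, exists_exists_and_eq_and]
  have hatU : T.atU = w :: CU.toList := by
    simp only [T, Spider.atU, hm2]
    rw [flatMap_last fun x hx => hl1 x (goodU hx)]
    rfl
  have hatV : T.atV = v :: CV.toList := by
    simp only [T, Spider.atV, hm1]
    rw [flatMap_last fun x hx => hl1 x (goodV hx)]
    rfl
  have pos : ∀ l ∈ (CU.toList ++ CV.toList).map leg, 1 ≤ l.length := by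
    intro l hl
    obtain ⟨x, hx, rfl⟩ := List.mem_map.1 hl
    exact List.length_pos_of_mem (mem_of_take_reverse (hl1 x (good x hx)))
  have memT : ∀ x, x ∈ T.edges ↔ x ≠ u := by
    intro x
    constructor
    · intro hx
      rcases memE.1 hx with h | ⟨y, hy, h⟩
      · exact (hm4 x h).1
      · rintro rfl
        have h1 := (hl3 y (good y hy) x h).1
        have h2 := hd y (good y hy).1
        omega
    -- By induction on the depth: the parent of `x` is listed, and unless it is `v` its only child
    -- is listed with it. Children of `u` and `v` are listed by construction.
    · suffices ∀ n x, d x ≤ n → x ≠ u → x ∈ T.edges from this (d x) x le_rfl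
      intro n
      induction n with
      | zero =>
        intro x hx hxu
        have := hd x hxu
        omega
      | succ n ih =>
        intro x hx hxu
        have h1 := hd x hxu
        have atTop : ∀ y ∈ CU.toList ++ CV.toList, y ∈ T.edges := fun y hy =>
          memE.2 (.inr ⟨y, hy, mem_of_take_reverse (hl1 y (good y hy))⟩)
        by_cases hxp : par x = u
        · by_cases hxw : x = w
          · exact memE.2 (.inl (hxw ▸ hwmid))
          · exact atTop x (List.mem_append_left _ (memU.2 ⟨hxu, hxp, hxw⟩))
        · by_cases hxv : par x = v
          · exact atTop x (List.mem_append_right _ (memV.2 ⟨hxu, hxv⟩))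
          rcases memE.1 (ih (par x) (by omega) hxp) with h | ⟨y, hy, h⟩
          · rcases hm5 _ h with h2 | ⟨y, hy, h3, h4, -⟩
            · exact absurd h2 hxv
            · rw [huniq _ hxp hxv x y hxu h3 rfl h4]
              exact memE.2 (.inl hy)
          · rcases hl4 y (good y hy) _ h with h2 | ⟨y', hy', h3, h4, -⟩
            · exact absurd rfl (h2.2 x hxu)
            · rw [huniq _ hxp hxv x y' hxu h3 rfl h4]
              exact memE.2 (.inr ⟨y, hy, hy'⟩)
  refine ⟨T, ?_, ?_, ?_, ?_, ?_, ?_, ?_, ?_, ?_, ?_, ?_, ?_⟩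
  · rw [edges]
    refine hm3.append (List.nodup_flatten.2 ⟨?_, ?_⟩) ?_
    · intro l hl
      obtain ⟨x, hx, rfl⟩ := List.mem_map.1 hl
      exact hl2 x (good x hx)
    · rw [List.pairwise_map]
      refine nodupX.imp_of_mem fun hx hy hxy z hzx hzy => hxy ?_
      exact disj _ hx _ hy z (hl3 _ (good _ hx) z hzx) (hl3 _ (good _ hy) z hzy)
    · intro z hz hz'
      obtain ⟨l, hl, hzl⟩ := List.mem_flatten.1 hz'
      obtain ⟨x, hx, rfl⟩ := List.mem_map.1 hl
      exact (good x hx).2 ((hl3 x (good x hx) z hzl).trans (hm4 z hz).2)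
  · exact memT
  · rw [hatU]
    exact List.nodup_cons.2 ⟨fun h => (memU.1 h).2.2 rfl, CU.nodup_toList⟩
  · rw [hatV]
    refine List.nodup_cons.2 ⟨fun h => ?_, CV.nodup_toList⟩
    have := depthV h
    omega
  · intro y
    rw [hatU, List.mem_cons, memU]
    constructor
    · rintro (rfl | h)
      exacts [⟨hw1, hw2⟩, ⟨h.1, h.2.1⟩]
    · intro h
      by_cases hyw : y = w
      exacts [.inl hyw, .inr ⟨h.1, h.2, hyw⟩]
  · intro y
    rw [hatV, List.mem_cons, memV]
  · intro z hzu hzv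
    rcases memE.1 ((memT z).2 hzu) with h | ⟨x, hx, h⟩
    · rcases hm5 z h with h1 | ⟨y, hy, h2, h3, h4⟩
      · exact absurd h1 hzv
      · refine .inr ⟨y, h2, h3, .inr ?_⟩
        exact List.mem_append_left _ h4
    · have hsub : leg x ∈ T.us ∨ leg x ∈ T.vs :=
        (List.mem_append.1 hx).imp (fun h => List.mem_map_of_mem h) fun h => List.mem_map_of_mem h
      rcases hl4 x (good x hx) z h with ⟨h1, h2⟩ | ⟨y, hy, h2, h3, h4⟩
      · refine .inl ⟨List.mem_append.2 ?_, h2⟩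
        exact hsub.imp (fun h => List.mem_flatMap.2 ⟨_, h, by simp [h1]⟩)
          fun h => List.mem_flatMap.2 ⟨_, h, by simp [h1]⟩
      · refine .inr ⟨y, h2, h3, .inl (List.mem_append_right _ (List.mem_append.2 ?_))⟩
        exact hsub.imp (fun h => List.mem_flatMap.2 ⟨_, h, h4⟩)
          fun h => List.mem_flatMap.2 ⟨_, h, h4⟩
  · exact fun l hl => pos l (by rw [List.map_append]; exact List.mem_append_left _ hl)
  · exact fun l hl => pos l (by rw [List.map_append]; exact List.mem_append_right _ hl)
  · exact List.length_pos_of_mem hvmid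
  · rw [hatU]
    simp [T]
  · rw [hatV]
    simp [T]

end DoubleSpider

/-! ### Copying a labelling onto the tree and comparing the vertex sums. -/

namespace DoubleSpider

theorem Valid.of_perm {us vs us' vs' : List (List ℕ)} {mid : List ℕ} {S : Summary}
    (h : Valid ⟨us, vs, mid⟩ S) (hu : us'.Perm us) (hv : vs'.Perm vs) :
    Valid ⟨us', vs', mid⟩ S := by
  have hc := h.core
  refine ⟨h.t_le, h.labels.perm ((List.Perm.refl _).append (hu.flatten.append hv.flatten)),
    hc.Y_le, hc.g_le, hc.c_le, hc.x_le, hc.Y_le_ML, ?_, ?_, ?_, ?_, ?_⟩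
  · intro x hx
    exact hc.leaf x (((hu.flatMap_right _).append (hv.flatMap_right _)).mem_iff.1 hx)
  all_goals
    have hp : ∀ d ∈ (Spider.mk us' vs' mid).pairs, d ∈ (Spider.mk us vs mid).pairs := fun d hd =>
      ((List.Perm.refl _).append ((hu.flatMap_right _).append (hv.flatMap_right _))).mem_iff.1 hd
  · exact fun d hd => hc.pair d (hp d hd)
  · exact fun d hd e he => hc.sep d (hp d hd) e (hp e he)
  · exact hc.statU.perm ((List.Perm.refl _).append (hu.flatMap_right _))
  · exact hc.statW.perm ((List.Perm.refl _).append (hv.flatMap_right _))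

theorem exists_perm_map_eq {α β : Type*} {f : α → β} {M : List β} {L : List α}
    (h : M.Perm (L.map f)) : ∃ L' : List α, L'.Perm L ∧ L'.map f = M := by
  induction M generalizing L with
  | nil => exact ⟨[], by simpa using h, rfl⟩
  | cons b M ih =>
    have hb : b ∈ L.map f := h.mem_iff.1 (by simp)
    obtain ⟨a, ha, rfl⟩ := List.mem_map.1 hb
    obtain ⟨l₁, l₂, rfl⟩ := List.append_of_mem ha
    have h1 : M.Perm ((l₁ ++ l₂).map f) := by
      refine (List.perm_cons (f a)).1 (h.trans ?_)
      simp only [List.map_append, List.map_cons]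
      exact List.perm_middle
    obtain ⟨L', h2, h3⟩ := ih h1
    exact ⟨a :: L', (h2.cons a).trans List.perm_middle.symm, by simp [h3]⟩

/-- Two lists of the same length, the first without repetitions, are related by a function. -/
theorem exists_map_eq {α β : Type*} [Inhabited β] {l : List α} (hl : l.Nodup) {r : List β}
    (h : l.length = r.length) : ∃ f : α → β, l.map f = r := by
  classical
  refine ⟨fun x => r.getD (l.idxOf x) default, List.ext_getElem (by simpa) fun i h1 h2 => ?_⟩
  simp [hl.idxOf_getElem, h2]

/-- Only the leg lengths matter: once the labelled legs are permuted so that their lengths match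
those of `T`, the labels are copied position by position along the list of edges. -/
theorem exists_valid_map {V : Type*} {T : Spider V} (hT : T.edges.Nodup) {S : Summary}
    (h : Realizes (T.us.map List.length : Multiset ℕ) (T.vs.map List.length : Multiset ℕ)
      T.mid.length S) : ∃ f : V → ℕ, Valid (T.map f) S := by
  obtain ⟨⟨us, vs, mid⟩, hu, hv, hm, hR⟩ := h
  obtain ⟨us', pu, hu'⟩ := exists_perm_map_eq (Multiset.coe_eq_coe.1 hu.symm)
  obtain ⟨vs', pv, hv'⟩ := exists_perm_map_eq (Multiset.coe_eq_coe.1 hv.symm)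
  have hR' := hR.of_perm pu pv
  have lu : us'.flatten.length = T.us.flatten.length := by simp [List.length_flatten, hu']
  have lv : vs'.flatten.length = T.vs.flatten.length := by simp [List.length_flatten, hv']
  have hl : T.edges.length = (mid ++ (us'.flatten ++ vs'.flatten)).length := by
    simp only [Spider.edges, List.length_append, lu, lv, hm]
  obtain ⟨f, hf⟩ := exists_map_eq hT hl
  refine ⟨f, ?_⟩
  simp only [Spider.edges, List.map_append] at hf
  obtain ⟨h1, h2⟩ := List.append_inj hf (by simp [hm])
  obtain ⟨h3, h4⟩ := List.append_inj h2 (by rw [List.length_map, lu])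
  have h5 : T.map f = ⟨us', vs', mid⟩ := by
    simp only [Spider.map, Spider.mk.injEq]
    -- A list of legs is determined by its concatenation together with the lengths of its entries.
    refine ⟨List.eq_iff_flatten_eq.2 ⟨?_, ?_⟩, List.eq_iff_flatten_eq.2 ⟨?_, ?_⟩, h1⟩
    · rw [← h3, List.map_flatten]
    · simp [hu', Function.comp_def]
    · rw [← h4, List.map_flatten]
    · simp [hv', Function.comp_def]
  rwa [h5]

/-- The vertex sums of the branch vertices exceed all others and respect the degrees. -/
structure Apart (S : Summary) : Prop where
  three_le_du : 3 ≤ S.du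
  three_le_dv : 3 ≤ S.dv
  lt_fu : max S.Y (max S.ML S.MH) < S.fu
  lt_fv : max S.Y (max S.ML S.MH) < S.fv
  ne : S.fu ≠ S.fv
  lt : S.du < S.dv → S.fu < S.fv
  gt : S.dv < S.du → S.fv < S.fu

theorem Apart.swap {S : Summary} (h : Apart S) : Apart S.swap :=
  ⟨h.three_le_dv, h.three_le_du, h.lt_fv, h.lt_fu, h.ne.symm, h.gt, h.lt⟩

theorem Weak.apart {S : Summary} (h : Weak S) : Apart S := by
  obtain ⟨h1, h2, h3, h4, h5, h6, h7⟩ := h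
  constructor <;> omega

theorem exists_apart_map {V : Type*} {par : V → V} {u v : V} {T : Spider V} (h : Lists par u v T)
    (hu : 3 ≤ T.atU.length) (hv : 3 ≤ T.atV.length) :
    ∃ (f : V → ℕ) (S : Summary), Valid (T.map f) S ∧ Apart S := by
  have h1 := h.atU_length
  have h2 := h.atV_length
  rcases hasWeak_or (A := (T.us.map List.length : Multiset ℕ))
    (B := (T.vs.map List.length : Multiset ℕ)) h.mid_pos (by simp; omega) (by simp; omega)
    (by simpa using h.us_pos) (by simpa using h.vs_pos) with ⟨-, S, hS, hw⟩ | ⟨-, S, hS, hw⟩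
  · obtain ⟨f, hf⟩ := exists_valid_map h.nodup hS
    exact ⟨f, S, hf, hw.apart⟩
  · obtain ⟨f, hf⟩ := exists_valid_map h.nodup hS.swap
    exact ⟨f, _, hf, hw.apart.swap⟩

variable {V : Type*} {par : V → V} {d : V → ℕ} {u v : V} {T : Spider V} {f : V → ℕ} {S : Summary}

theorem injOn_of_valid (h : Lists par u v T) (hV : Valid (T.map f) S) :
    Set.InjOn f {x | x ≠ u} := by
  have h1 := hV.labels.1
  rw [Spider.edges_map] at h1
  exact fun x hx y hy hxy =>
    List.inj_on_of_nodup_map h1 ((h.mem x).2 hx) ((h.mem y).2 hy) hxy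

/-- The pair of labels at a vertex of degree two. -/
theorem exists_pair (hV : Valid (T.map f) S) {y z : V}
    (h : (y, z) ∈ T.pairs ∨ (z, y) ∈ T.pairs) :
    ∃ p ∈ (T.map f).pairs, (p = (f y, f z) ∨ p = (f z, f y)) ∧
      S.Y < f y + f z ∧ f y + f z ≤ max S.ML S.MH := by
  have key : ∀ p ∈ (T.map f).pairs, S.Y < p.1 + p.2 ∧ p.1 + p.2 ≤ max S.ML S.MH := by
    intro p hp
    have h1 := hV.core.pair p hp
    have h2 := h1.lt_sum
    refine ⟨by omega, ?_⟩
    rcases (above_le_two S.Y p).lt_or_eq with h3 | h3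
    · exact (h1.light (by omega)).2.trans (le_max_left _ _)
    · exact (h1.heavy h3).2.2.2.trans (le_max_right _ _)
  rw [Spider.pairs_map] at *
  rcases h with h | h
  · have := List.mem_map_of_mem (f := fun d : V × V => (f d.1, f d.2)) h
    exact ⟨_, this, .inl rfl, key _ this⟩
  · have := List.mem_map_of_mem (f := fun d : V × V => (f d.1, f d.2)) h
    exact ⟨_, this, .inr rfl, by simpa only [add_comm (f y)] using key _ this⟩

/-- The children of `z`, together with `z` unless it is the root: each vertex other than the root
stands for the edge to its parent. -/
def star [Fintype V] [DecidableEq V] (par : V → V) (u z : V) : Finset V :=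
  Finset.univ.filter fun y => y ≠ u ∧ (y = z ∨ par y = z)

variable [Fintype V] [DecidableEq V]

theorem Lists.star_u (h : Lists par u v T) : star par u u = T.atU.toFinset := by
  ext y
  simp only [star, Finset.mem_filter, Finset.mem_univ, true_and, List.mem_toFinset, h.atU]
  tauto

theorem Lists.star_v (h : Lists par u v T) (hv : v ≠ u) : star par u v = T.atV.toFinset := by
  ext y
  simp only [star, Finset.mem_filter, Finset.mem_univ, true_and, List.mem_toFinset, h.atV]
  constructor
  · tauto
  · rintro (rfl | h)
    exacts [⟨hv, .inl rfl⟩, ⟨h.1, .inr h.2⟩]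

theorem sum_star_u (h : Lists par u v T) (hV : Valid (T.map f) S) :
    (star par u u).card = S.du ∧ ∑ y ∈ star par u u, f y = S.fu := by
  obtain ⟨h1, -, -, h2⟩ := hV.core.statU
  rw [Spider.atU_map] at h1 h2
  rw [h.star_u, List.toFinset_card_of_nodup h.nodup_atU, List.sum_toFinset _ h.nodup_atU]
  exact ⟨by simpa using h1, h2⟩

theorem sum_star_v (h : Lists par u v T) (hv : v ≠ u) (hV : Valid (T.map f) S) :
    (star par u v).card = S.dv ∧ ∑ y ∈ star par u v, f y = S.fv := by
  obtain ⟨h1, -, -, h2⟩ := hV.core.statW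
  rw [Spider.atV_map] at h1 h2
  rw [h.star_v hv, List.toFinset_card_of_nodup h.nodup_atV, List.sum_toFinset _ h.nodup_atV]
  exact ⟨by simpa using h1, h2⟩

/-- A vertex other than the branch vertices is a leaf, or has one child. -/
theorem star_other (h : Lists par u v T) (hd : ∀ x, x ≠ u → d (par x) + 1 = d x)
    (huniq : ∀ z, z ≠ u → z ≠ v → ∀ y y', y ≠ u → y' ≠ u → par y = z → par y' = z → y = y')
    (hV : Valid (T.map f) S) {z : V} (hzu : z ≠ u) (hzv : z ≠ v) :
    ((star par u z).card = 1 ∧ ∑ y ∈ star par u z, f y = f z ∧ f z ≤ S.Y) ∨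
    ∃ y, y ≠ u ∧ par y = z ∧ (star par u z).card = 2 ∧ ∑ y ∈ star par u z, f y = f y + f z ∧
      ((y, z) ∈ T.pairs ∨ (z, y) ∈ T.pairs) := by
  rcases h.other z hzu hzv with ⟨h1, h2⟩ | ⟨y, h1, h2, h3⟩
  · left
    have : star par u z = {z} := by
      ext y
      simp only [star, Finset.mem_filter, Finset.mem_univ, true_and, Finset.mem_singleton]
      constructor
      · rintro ⟨h3, rfl | h4⟩
        exacts [rfl, absurd h4 (h2 y h3)]
      · rintro rfl
        exact ⟨hzu, .inl rfl⟩
    rw [this]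
    refine ⟨rfl, by simp, hV.core.leaf _ ?_⟩
    rw [Spider.leaves_map]
    exact List.mem_map_of_mem h1
  · right
    have hyz : y ≠ z := by
      rintro rfl
      have := hd y h1
      rw [h2] at this
      omega
    have : star par u z = {y, z} := by
      ext w
      simp only [star, Finset.mem_filter, Finset.mem_univ, true_and, Finset.mem_insert,
        Finset.mem_singleton]
      constructor
      · rintro ⟨h4, rfl | h5⟩
        exacts [.inr rfl, .inl (huniq z hzu hzv w y h4 h1 h5 h2)]
      · rintro (rfl | rfl)
        exacts [⟨h1, .inr h2⟩, ⟨hzu, .inl rfl⟩]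
    exact ⟨y, h1, h2, by rw [this, Finset.card_pair hyz], by rw [this, Finset.sum_pair hyz], h3⟩

theorem sum_star_other (h : Lists par u v T) (hd : ∀ x, x ≠ u → d (par x) + 1 = d x)
    (huniq : ∀ z, z ≠ u → z ≠ v → ∀ y y', y ≠ u → y' ≠ u → par y = z → par y' = z → y = y')
    (hV : Valid (T.map f) S) {z : V} (hzu : z ≠ u) (hzv : z ≠ v) :
    (star par u z).card ≤ 2 ∧ ∑ y ∈ star par u z, f y ≤ max S.Y (max S.ML S.MH) := by
  rcases star_other h hd huniq hV hzu hzv with ⟨h1, h2, h3⟩ | ⟨y, -, -, h1, h2, h3⟩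
  · exact ⟨by omega, by rw [h2]; exact h3.trans (le_max_left _ _)⟩
  · obtain ⟨-, -, -, -, h4⟩ := exists_pair hV h3
    exact ⟨h1.le, by rw [h2]; exact h4.trans (le_max_right _ _)⟩

theorem sum_star_other_other (h : Lists par u v T) (hd : ∀ x, x ≠ u → d (par x) + 1 = d x)
    (huniq : ∀ z, z ≠ u → z ≠ v → ∀ y y', y ≠ u → y' ≠ u → par y = z → par y' = z → y = y')
    (hV : Valid (T.map f) S) {z z' : V} (hzu : z ≠ u) (hzv : z ≠ v) (hzu' : z' ≠ u)
    (hzv' : z' ≠ v) :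
    (∑ y ∈ star par u z, f y = ∑ y ∈ star par u z', f y → z = z') ∧
    ((star par u z).card < (star par u z').card →
      ∑ y ∈ star par u z, f y < ∑ y ∈ star par u z', f y) := by
  have inj := injOn_of_valid h hV
  rcases star_other h hd huniq hV hzu hzv with ⟨h1, h2, h3⟩ | ⟨y, hy, h0, h1, h2, h3⟩ <;>
    rcases star_other h hd huniq hV hzu' hzv' with ⟨g1, g2, g3⟩ | ⟨y', hy', g0, g1, g2, g3⟩ <;>
    rw [h1, h2, g1, g2]
  · exact ⟨fun h => inj hzu hzu' h, by omega⟩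
  · obtain ⟨-, -, -, h4, -⟩ := exists_pair hV g3
    exact ⟨by omega, by omega⟩
  · obtain ⟨-, -, -, h4, -⟩ := exists_pair hV h3
    exact ⟨by omega, by omega⟩
  · obtain ⟨p, hp, h4, -, -⟩ := exists_pair hV h3
    obtain ⟨q, hq, g4, -, -⟩ := exists_pair hV g3
    refine ⟨fun heq => ?_, by omega⟩
    have hpq : p = q ∨ p = q.swap := (hV.core.sep p hp q hq).1 (by
      rcases h4 with rfl | rfl <;> rcases g4 with rfl | rfl <;> simp <;> omega)
    have hcases : (f y = f y' ∧ f z = f z') ∨ (f y = f z' ∧ f z = f y') := by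
      rcases h4 with rfl | rfl <;> rcases g4 with rfl | rfl <;>
        simp only [Prod.swap_prod_mk, Prod.mk.injEq] at hpq <;> tauto
    rcases hcases with ⟨-, h5⟩ | ⟨h5, h6⟩
    · exact inj hzu hzu' h5
    -- In the crossed case `z'` is the child of `z` and `z` the child of `z'`, which the depth
    -- forbids.
    · have e1 := inj hy hzu' h5
      have e2 := inj hzu hy' h6
      have e3 := hd y hy
      have e4 := hd y' hy'
      rw [h0, e2] at e3
      rw [g0, ← e1] at e4
      omega

theorem star_sums (h : Lists par u v T) (hd : ∀ x, x ≠ u → d (par x) + 1 = d x) (hv : v ≠ u)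
    (huniq : ∀ z, z ≠ u → z ≠ v → ∀ y y', y ≠ u → y' ≠ u → par y = z → par y' = z → y = y')
    (hV : Valid (T.map f) S) (hS : Apart S) (z z' : V) :
    (∑ y ∈ star par u z, f y = ∑ y ∈ star par u z', f y → z = z') ∧
    ((star par u z).card < (star par u z').card →
      ∑ y ∈ star par u z, f y < ∑ y ∈ star par u z', f y) := by
  obtain ⟨u1, u2⟩ := sum_star_u h hV
  obtain ⟨v1, v2⟩ := sum_star_v h hv hV
  obtain ⟨s1, s2, s3, s4, s5, s6, s7⟩ := hS
  have hz : z = u ∨ z = v ∨ (z ≠ u ∧ z ≠ v) := by tauto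
  have hz' : z' = u ∨ z' = v ∨ (z' ≠ u ∧ z' ≠ v) := by tauto
  rcases hz with rfl | rfl | ⟨h1, h2⟩ <;> rcases hz' with rfl | rfl | ⟨h3, h4⟩
  · exact ⟨fun _ => rfl, fun h => absurd h (lt_irrefl _)⟩
  · rw [u1, u2, v1, v2]
    exact ⟨fun h => absurd h s5, s6⟩
  · obtain ⟨o1, o2⟩ := sum_star_other h hd huniq hV h3 h4
    exact ⟨by omega, by omega⟩
  · rw [u1, u2, v1, v2]
    exact ⟨fun h => absurd h.symm s5, s7⟩
  · exact ⟨fun _ => rfl, fun h => absurd h (lt_irrefl _)⟩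
  · obtain ⟨o1, o2⟩ := sum_star_other h hd huniq hV h3 h4
    exact ⟨by omega, by omega⟩
  · obtain ⟨o1, o2⟩ := sum_star_other h hd huniq hV h1 h2
    exact ⟨by omega, by omega⟩
  · obtain ⟨o1, o2⟩ := sum_star_other h hd huniq hV h1 h2
    exact ⟨by omega, by omega⟩
  · exact sum_star_other_other h hd huniq hV h1 h2 h3 h4

end DoubleSpider

/-! ### Edges as child–parent pairs, and the theorem for graphs. -/

namespace DoubleSpider

open SimpleGraph

variable {V : Type*} {G : SimpleGraph V} {par : V → V} {d : V → ℕ} {u : V}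

/-- A tree with root `u` has a parent function `par` that decreases the depth `d` by one. -/
theorem exists_parent (hG : G.Connected) (u : V) :
    ∃ (par : V → V) (d : V → ℕ), d u = 0 ∧ (∀ x, x ≠ u → d (par x) + 1 = d x) ∧
      ∀ x, x ≠ u → G.Adj x (par x) := by
  have key : ∀ x, ∃ y, x ≠ u → G.dist y u + 1 = G.dist x u ∧ G.Adj x y := by
    intro x
    by_cases hx : x = u
    · exact ⟨x, fun h => absurd hx h⟩
    obtain ⟨p, hp⟩ := hG.exists_walk_length_eq_dist x u
    cases p with
    | nil => exact absurd rfl hx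
    | cons h q =>
      rename_i y
      refine ⟨y, fun _ => ⟨?_, h⟩⟩
      rw [Walk.length_cons] at hp
      have h1 := dist_le q
      obtain ⟨r, hr⟩ := hG.exists_walk_length_eq_dist y u
      have h2 := dist_le (Walk.cons h r)
      rw [Walk.length_cons] at h2
      omega
  choose par hpar using key
  exact ⟨par, fun x => G.dist x u, dist_self, fun x hx => (hpar x hx).1, fun x hx => (hpar x hx).2⟩

theorem injOn_edge (hd : ∀ x, x ≠ u → d (par x) + 1 = d x) :
    Set.InjOn (fun x => s(x, par x)) {x | x ≠ u} := by
  intro x hx y hy hxy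
  rcases Sym2.eq_iff.1 hxy with ⟨h, -⟩ | ⟨h1, h2⟩
  · exact h
  · have h3 := hd x hx
    have h4 := hd y hy
    rw [h2] at h3
    rw [← h1] at h4
    omega

variable [Fintype V] [DecidableEq V] [DecidableRel G.Adj]

/-- The edges from the vertices other than the root to their parents are distinct, and there are as
many of them as a tree on `V` has edges. -/
theorem edgeFinset_eq (hG : G.IsTree) (hd : ∀ x, x ≠ u → d (par x) + 1 = d x)
    (hadj : ∀ x, x ≠ u → G.Adj x (par x)) :
    G.edgeFinset = (Finset.univ.erase u).image fun x => s(x, par x) := by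
  symm
  refine Finset.eq_of_subset_of_card_le ?_ ?_
  · intro e he
    obtain ⟨x, hx, rfl⟩ := Finset.mem_image.1 he
    exact mem_edgeFinset.2 (hadj x (Finset.ne_of_mem_erase hx))
  · rw [Finset.card_image_of_injOn, Finset.card_erase_of_mem (Finset.mem_univ _),
      Finset.card_univ, ← hG.card_edgeFinset]
    · rfl
    · exact (injOn_edge hd).mono fun x hx => Finset.ne_of_mem_erase hx

theorem incidenceFinset_eq (hG : G.IsTree) (hd : ∀ x, x ≠ u → d (par x) + 1 = d x)
    (hadj : ∀ x, x ≠ u → G.Adj x (par x)) (z : V) :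
    G.incidenceFinset z = (star par u z).image fun x => s(x, par x) := by
  ext e
  have h1 : e ∈ G.incidenceFinset z ↔ e ∈ G.edgeFinset ∧ z ∈ e := by
    rw [mem_incidenceFinset, mem_edgeFinset]
    rfl
  rw [h1, edgeFinset_eq hG hd hadj]
  simp only [star, Finset.mem_image, Finset.mem_erase, Finset.mem_univ, and_true,
    Finset.mem_filter, true_and]
  constructor
  · rintro ⟨⟨x, hx, rfl⟩, h2⟩
    exact ⟨x, ⟨hx, (Sym2.mem_iff.1 h2).imp Eq.symm Eq.symm⟩, rfl⟩
  · rintro ⟨x, ⟨hx, h2⟩, rfl⟩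
    exact ⟨⟨x, hx, rfl⟩, Sym2.mem_iff.2 (h2.imp Eq.symm Eq.symm)⟩

theorem injOn_star (hd : ∀ x, x ≠ u → d (par x) + 1 = d x) (z : V) :
    Set.InjOn (fun x => s(x, par x)) (star par u z) :=
  (injOn_edge hd).mono fun _ hx => (Finset.mem_filter.1 hx).2.1

theorem card_star (hG : G.IsTree) (hd : ∀ x, x ≠ u → d (par x) + 1 = d x)
    (hadj : ∀ x, x ≠ u → G.Adj x (par x)) (z : V) : (star par u z).card = G.degree z := by
  rw [← card_incidenceFinset_eq_degree, incidenceFinset_eq hG hd hadj,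
    Finset.card_image_of_injOn (injOn_star hd z)]

/-- Away from the root the star contains the vertex itself besides its children, so two elements
leave room for only one child. -/
theorem child_unique (hd : ∀ x, x ≠ u → d (par x) + 1 = d x) {z : V} (hz : z ≠ u)
    (hc : (star par u z).card ≤ 2) {y y' : V} (hy : y ≠ u) (hy' : y' ≠ u) (h : par y = z)
    (h' : par y' = z) : y = y' := by
  by_contra hne
  have e1 := hd y hy
  have e2 := hd y' hy'
  rw [h] at e1
  rw [h'] at e2
  have h3 : ({z, y, y'} : Finset V) ⊆ star par u z := by
    intro w hw
    simp only [Finset.mem_insert, Finset.mem_singleton] at hw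
    rw [star, Finset.mem_filter]
    rcases hw with rfl | rfl | rfl
    exacts [⟨Finset.mem_univ _, hz, .inl rfl⟩, ⟨Finset.mem_univ _, hy, .inr h⟩,
      ⟨Finset.mem_univ _, hy', .inr h'⟩]
  have h4 := (Finset.card_le_card h3).trans hc
  rw [Finset.card_eq_three.2 ⟨z, y, y', by rintro rfl; omega, by rintro rfl; omega, hne, rfl⟩] at h4
  omega

theorem bijOn_of_valid {v : V} {T : Spider V} {f : V → ℕ} {S : Summary} (h : Lists par u v T)
    (hV : Valid (T.map f) S) :
    Set.BijOn f {x | x ≠ u} (Set.Icc 1 (Fintype.card V - 1)) := by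
  have hm : S.m = Fintype.card V - 1 := by
    have h1 := hV.labels.2.2
    rw [Spider.edges_map, List.length_map] at h1
    rw [← h1, ← List.toFinset_card_of_nodup h.nodup, ← Finset.card_univ,
      ← Finset.card_erase_of_mem (Finset.mem_univ u)]
    congr 1
    ext x
    simp [h.mem]
  have hmaps : ∀ x ∈ Finset.univ.erase u, f x ∈ Finset.Icc 1 S.m := by
    intro x hx
    refine Finset.mem_Icc.2 (hV.labels.2.1 _ ?_)
    rw [Spider.edges_map]
    exact List.mem_map_of_mem ((h.mem x).2 (Finset.ne_of_mem_erase hx))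
  have hinj := injOn_of_valid h hV
  rw [← hm]
  refine ⟨fun x hx => by simpa using hmaps x (by simpa using hx), hinj, ?_⟩
  have := Finset.surjOn_of_injOn_of_card_le f (s := Finset.univ.erase u) (t := Finset.Icc 1 S.m)
    hmaps (hinj.mono fun x hx => Finset.ne_of_mem_erase hx)
    (by
      rw [Finset.card_erase_of_mem (Finset.mem_univ _), Finset.card_univ, Nat.card_Icc, hm]
      omega)
  intro y hy
  obtain ⟨x, hx, e⟩ := this (by simpa using hy)
  exact ⟨x, by simpa using hx, e⟩

theorem isStronglyAntimagic (hG : G.IsDoubleSpider) :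
    G.IsStronglyAntimagic := by
  obtain ⟨hT, hcard⟩ := hG
  obtain ⟨u, v, huv, hbranch⟩ := Finset.card_eq_two.1 hcard
  have hdeg : ∀ z, 2 < G.degree z ↔ z = u ∨ z = v := by
    intro z
    have : z ∈ Finset.univ.filter (fun v : V => 2 < G.degree v) ↔ z ∈ ({u, v} : Finset V) := by
      rw [hbranch]
    simpa using this
  obtain ⟨par, d, hu, hd, hadj⟩ := exists_parent hT.1 u
  have hstar := card_star hT hd hadj
  have huniq : ∀ z, z ≠ u → z ≠ v → ∀ y y', y ≠ u → y' ≠ u → par y = z → par y' = z → y = y' := by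
    intro z hzu hzv y y'
    refine child_unique hd hzu ?_
    rw [hstar]
    exact not_lt.1 fun h => ((hdeg z).1 h).elim hzu hzv
  obtain ⟨T, h⟩ := exists_lists hu hd huv.symm huniq
  obtain ⟨f, S, hV, hS⟩ := exists_apart_map h
    (by rw [← List.toFinset_card_of_nodup h.nodup_atU, ← h.star_u, hstar]
        exact (hdeg u).2 (.inl rfl))
    (by rw [← List.toFinset_card_of_nodup h.nodup_atV, ← h.star_v huv.symm, hstar]
        exact (hdeg v).2 (.inr rfl))
  have hinj := injOn_edge hd
  have : Nonempty V := ⟨u⟩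
  -- An edge takes the label of its lower end; values outside the edge set are arbitrary and never
  -- used.
  let g : Sym2 V → ℕ := fun e => f (Function.invFunOn (fun x => s(x, par x)) {x | x ≠ u} e)
  have hg : ∀ x, x ≠ u → g s(x, par x) = f x := fun x hx =>
    congrArg f (hinj.leftInvOn_invFunOn hx)
  have hsum : ∀ z, G.vertexSum g z = ∑ y ∈ star par u z, f y := by
    intro z
    rw [vertexSum, incidenceFinset_eq hT hd hadj, Finset.sum_image (injOn_star hd z)]
    exact Finset.sum_congr rfl fun x hx => hg x (Finset.mem_filter.1 hx).2.1
  have hsums := star_sums h hd huv.symm huniq hV hS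
  refine ⟨g, ⟨?_, fun x y hxy => ?_⟩, fun x y hxy => ?_⟩
  · have hE : G.edgeSet = (fun x => s(x, par x)) '' {x | x ≠ u} := by
      rw [← coe_edgeFinset, edgeFinset_eq hT hd hadj]
      ext e
      simp
    have hc : G.edgeFinset.card = Fintype.card V - 1 := by
      rw [← hT.card_edgeFinset]
      rfl
    have hb := (bijOn_of_valid h hV).congr fun x hx => (hg x hx).symm
    rw [IsEdgeLabeling, hE, hc]
    exact ⟨Set.mapsTo_image_iff.2 hb.mapsTo, Set.InjOn.image_of_comp hb.injOn, by
      rw [Set.SurjOn, ← Set.image_comp]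
      exact hb.surjOn⟩
  · rw [hsum, hsum]
    exact fun h => hxy ((hsums x y).1 h)
  · rw [hsum, hsum]
    refine (hsums x y).2 ?_
    rwa [hstar, hstar]

end DoubleSpider

theorem theorem1 {V : Type*} [Fintype V] [DecidableEq V] (G : SimpleGraph V)
    [DecidableRel G.Adj] (hG : G.IsDoubleSpider) :
    G.IsStronglyAntimagic ∧ G.IsAntimagic := by
  obtain ⟨f, hf⟩ := DoubleSpider.isStronglyAntimagic hG
  exact ⟨⟨f, hf⟩, f, hf.1⟩
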